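/- **Setting.** Let $d\ge 1$ be fixed and $\mathcal X=\{\mathbf x\in\mathbb R^d:\|\mathbf x\|_2\le 1,\ \mathbf x\ge 0\}$. For $\mathbf X=[\mathbf x_1,\dots,\mathbf x_n]^{\mathrm T}$ with rows in $\mathcal X$, $\mathbf Y\sim\mathrm{RDPG}(\mathbf X)$ means that $\mathbf Y=(y_{ij})$ is a symmetric random $n\times n$ matrix with entries in $\{0,1\}$ such that $y_{ij}\sim\mathrm{Bernoulli}(\mathbf x_i^{\mathrm T}\mathbf x_j)$ independently for $1\le i\le j\le n$; $p(\mathbf Y\mid\mathbf X)$ denotes its probability mass function. Let $\pi_{\mathbf x}$ be a probability density on $\mathcal X$ bounded away from $0$ and $\infty$ on $\mathcal X$, let $\Pi$ be the prior on $\mathbf X\in\mathcal X^n$ under which the rows are i.i.d. with density $\pi_{\mathbf x}$, and let $\Pi(d\mathbf X\mid\mathbf Y)\propto p(\mathbf Y\mid\mathbf X)\,\Pi(d\mathbf X)$ be the posterior. Let $\widetilde{\mathbf P}=\int \mathbf X\mathbf X^{\mathrm T}\,\Pi(d\mathbf X\mid\mathbf Y)$ have spectral decomposition $\widetilde{\mathbf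 P}=\sum_{j=1}^n\widehat\lambda_j\widehat{\mathbf u}_j\widehat{\mathbf u}_j^{\mathrm T}$ with $\widehat\lambda_1\ge\dots\ge\widehat\lambda_n$ and orthonormal $\widehat{\mathbf u}_j$, and put $\widehat{\mathbf X}=[\widehat\lambda_1^{1/2}\widehat{\mathbf u}_1,\dots,\widehat\lambda_d^{1/2}\widehat{\mathbf u}_d]$. A left-singular vector matrix of an $n\times d$ matrix $\mathbf A$ is a $\mathbf U\in\mathbb R^{n\times d}$ with $\mathbf U^{\mathrm T}\mathbf U=\mathbf I_d$ and $\mathbf A=\mathbf U\,\mathrm{diag}(s)\,\mathbf V^{\mathrm T}$ for some $s_1\ge\dots\ge s_d\ge0$ and some orthogonal $\mathbf V$. *$K$-means.* For $\mathbf A\in\mathbb R^{n\times d}$, $\mathbf C(\mathbf A)$ is any minimizer of $\|\mathbf C-\mathbf A\|_{\mathrm F}$ over the matrices $\mathbf C\in\mathbb R^{n\times d}$ with exactly $K$ distinct rows, and $\tau(\cdot;\mathbf A):[n]\to[K]$ is any function such that $\tau(i;\mathbf A)=\tau(j;\mathbf A)$ if and only if $\mathbf C(\mathbf A)_{i*}=\mathbf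 C(\mathbf A)_{j*}$. Let $d_H(\tau_1,\tau_2)=\#\{i:\tau_1(i)\ne\tau_2(i)\}$ and let $\mathcal S_K$ be the set of permutations of $[K]$. **Theorem.** Let $\delta\in(0,1/2)$, let $\boldsymbol\Delta\in\mathbb R^{d\times d}$ be positive definite with least eigenvalue $\lambda_d(\boldsymbol\Delta)$, and let $\pi_{\mathbf x}$ be as above. There are constants $M_1,M_2>0$ depending only on $d$, $\delta$, $\boldsymbol\Delta$ and $\pi_{\mathbf x}$ such that the following holds. For each $n$ let $\mathbf X_0=\mathbf X_0^{(n)}=[\mathbf x_{01},\dots,\mathbf x_{0n}]^{\mathrm T}$ have rows in $\mathcal X$, and let $\mathbf Y=\mathbf Y^{(n)}\sim\mathrm{RDPG}(\mathbf X_0)$, all defined on one probability space with probability $\mathbb P_0$ and expectation $\mathbb E_0$. Assume that $\frac1n\mathbf X_0^{\mathrm T}\mathbf X_0\to\boldsymbol\Delta$ as $n\to\infty$, that $\delta\le\mathbf x_{0i}^{\mathrm T}\mathbf x_{0j}\le1-\delta$ for all $i,j\in[n]$ and all $n$, that $\mathbf X_0$ has exactly $K$ distinct rows $\mathbf x_{01}^*,\dots,\mathbf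 x_{0K}^*$ ($K$ may depend on $n$), that $\|\mathbf x_{0k}^*-\mathbf x_{0k'}^*\|_2>\xi$ for all $k\ne k'$ and a constant $\xi>0$, and that $\min_{k\in[K]}\#\{i:\mathbf x_{0i}=\mathbf x_{0k}^*\}\to\infty$ as $n\to\infty$. Then: 1. (Contraction.) For all sufficiently large $n$, $$\mathbb E_0\Big\{\Pi\Big(\tfrac1n\|\mathbf X\mathbf X^{\mathrm T}-\mathbf X_0\mathbf X_0^{\mathrm T}\|_{\mathrm F}>\tfrac{M_1}{\sqrt n}\,\Big|\,\mathbf Y\Big)\Big\}\le 8e^{-nd/2},\qquad \mathbb E_0\Big\{\Pi\Big(\tfrac1n\inf_{\mathbf W\in\mathbb O(d)}\|\mathbf X-\mathbf X_0\mathbf W\|_{\mathrm F}^2>\tfrac{M_2}{n}\,\Big|\,\mathbf Y\Big)\Big\}\le 8e^{-nd/2}.$$ 2. (Clustering of posterior draws.) For all sufficiently large $n$, $\tau(\cdot;\mathbf X_0)$ exists, $\tau(\cdot;\mathbf X)$ exists for $\Pi(\cdot\mid\mathbf Y)$-almost every $\mathbf X$, and $$\mathbb E_0\Big\{\Pi\Big(\inf_{\sigma\in\mathcal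 S_K}d_H\big(\sigma\circ\tau(\cdot;\mathbf X_0),\tau(\cdot;\mathbf X)\big)\ge\frac{16M_2^2}{\xi^2}\,\Big|\,\mathbf Y\Big)\Big\}\le 8\exp\Big(-\frac12 nd\Big),$$ where the event is that the inequality holds for at least one admissible choice of $\tau(\cdot;\mathbf X_0)$ and $\tau(\cdot;\mathbf X)$. 3. (Clustering of eigenvectors.) $\mathbb P_0$-almost surely, for all sufficiently large $n$, whenever $\widehat{\mathbf U}$ is a left-singular vector matrix of $\widehat{\mathbf X}$ and $\mathbf U_0$ is one of $\mathbf X_0$, $\tau(\cdot;\widehat{\mathbf U})$ and $\tau(\cdot;\mathbf U_0)$ exist, and every admissible choice of them satisfies $$\inf_{\sigma\in\mathcal S_K}d_H\big(\sigma\circ\tau(\cdot;\widehat{\mathbf U}),\tau(\cdot;\mathbf U_0)\big)\le\frac{16}{\xi^2}\left\{\frac{8M_1\sqrt{2d}}{\lambda_d(\boldsymbol\Delta)}\right\}^2.$$ -/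

import Mathlib

open MeasureTheory ProbabilityTheory Filter Topology Matrix

noncomputable section

/-- The space of latent positions: nonnegative vectors of Euclidean norm at most one. -/
def latentSpace (d : ℕ) : Set (Fin d → ℝ) :=
  {x | (∀ k, 0 ≤ x k) ∧ x ⬝ᵥ x ≤ 1}

/-- The Euclidean norm of a vector. -/
def euclNorm {d : ℕ} (x : Fin d → ℝ) : ℝ := √(x ⬝ᵥ x)

/-- The Frobenius norm of a matrix. -/
def frobNorm {m n : ℕ} (A : Matrix (Fin m) (Fin n) ℝ) : ℝ :=
  √(∑ i, ∑ j, A i j ^ 2)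

/-- The index pairs `i ≤ j`, diagonal included. -/
abbrev UpperPair (n : ℕ) : Type := {p : Fin n × Fin n // p.1 ≤ p.2}

/-- `Y ∼ RDPG(X)`: a symmetric random binary matrix (`true` is `1`, `false` is `0`) whose entries
with `i ≤ j` are independent Bernoulli variables with means `xᵢᵀ xⱼ`. -/
structure IsRDPG {Ω : Type*} [MeasurableSpace Ω] (μ : Measure Ω) {n d : ℕ}
    (X : Matrix (Fin n) (Fin d) ℝ) (Y : Ω → Matrix (Fin n) (Fin n) Bool) : Prop where
  mem_latentSpace : ∀ i, X i ∈ latentSpace d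
  symmetric : ∀ ω i j, Y ω i j = Y ω j i
  measurable : ∀ i j, Measurable (fun ω => Y ω i j)
  indep : iIndepFun (fun (p : UpperPair n) ω => Y ω p.1.1 p.1.2) μ
  bernoulli : ∀ i j, i ≤ j → μ {ω | Y ω i j = true} = ENNReal.ofReal (X i ⬝ᵥ X j)

/-- `π` is a probability density on the latent space, bounded away from `0` and `∞` there. -/
structure IsPriorDensity {d : ℕ} (π : (Fin d → ℝ) → ℝ) : Prop where
  measurable : Measurable π
  bounded : ∃ c C : ℝ, 0 < c ∧ ∀ x ∈ latentSpace d, c ≤ π x ∧ π x ≤ C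
  lintegral_eq_one : ∫⁻ x in latentSpace d, ENNReal.ofReal (π x) = 1

/-- The prior on a single row: density `π` on the latent space and `0` outside. -/
def rowPrior {d : ℕ} (π : (Fin d → ℝ) → ℝ) : Measure (Fin d → ℝ) :=
  (volume.restrict (latentSpace d)).withDensity (fun x => ENNReal.ofReal (π x))

/-- The prior on the latent position matrix: the rows are independent with density `π`.
Matrices are identified with the families of their rows. -/
def rdpgPrior {d : ℕ} (π : (Fin d → ℝ) → ℝ) (n : ℕ) : Measure (Fin n → Fin d → ℝ) :=
  Measure.pi (fun _ : Fin n => rowPrior π)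

/-- The Bernoulli likelihood `p(Y ∣ X)`. -/
def rdpgLikelihood {n d : ℕ} (Y : Matrix (Fin n) (Fin n) Bool) (X : Matrix (Fin n) (Fin d) ℝ) : ℝ :=
  ∏ p : UpperPair n,
    if Y p.1.1 p.1.2 = true then X p.1.1 ⬝ᵥ X p.1.2 else 1 - X p.1.1 ⬝ᵥ X p.1.2

/-- Likelihood times prior. -/
def rdpgPosteriorNumerator {d : ℕ} (π : (Fin d → ℝ) → ℝ) {n : ℕ} (Y : Matrix (Fin n) (Fin n) Bool) :
    Measure (Fin n → Fin d → ℝ) :=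
  (rdpgPrior π n).withDensity (fun X => ENNReal.ofReal (rdpgLikelihood Y (Matrix.of X)))

/-- The posterior distribution `Π(X ∈ · ∣ Y)` given by the Bayes formula. (Dividing the likelihood
in numerator and denominator by the positive number `p(Y ∣ X₀)` would change nothing.) -/
def rdpgPosterior {d : ℕ} (π : (Fin d → ℝ) → ℝ) {n : ℕ} (Y : Matrix (Fin n) (Fin n) Bool) :
    Measure (Fin n → Fin d → ℝ) :=
  (rdpgPosteriorNumerator π Y Set.univ)⁻¹ • rdpgPosteriorNumerator π Y

/-- The posterior mean of the edge probability matrix `X Xᵀ`. -/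
def rdpgPosteriorMean {d : ℕ} (π : (Fin d → ℝ) → ℝ) {n : ℕ} (Y : Matrix (Fin n) (Fin n) Bool) :
    Matrix (Fin n) (Fin n) ℝ :=
  Matrix.of fun i j => ∫ X, (Matrix.of X * (Matrix.of X)ᵀ) i j ∂(rdpgPosterior π Y)

/-- `Xhat = [√λ₁ u₁, …, √λ_d u_d]`, where `P = ∑ⱼ λⱼ uⱼ uⱼᵀ` is a spectral decomposition of `P` with
orthonormal eigenvectors and eigenvalues in non-increasing order. -/
def IsSpectralEmbedding {n d : ℕ} (P : Matrix (Fin n) (Fin n) ℝ)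
    (Xhat : Matrix (Fin n) (Fin d) ℝ) : Prop :=
  ∃ (h : d ≤ n) (Q : Matrix (Fin n) (Fin n) ℝ) (lam : Fin n → ℝ),
    Q ∈ Matrix.orthogonalGroup (Fin n) ℝ ∧ Antitone lam ∧ P = Q * Matrix.diagonal lam * Qᵀ ∧
    Xhat = Matrix.of fun i k => Q i (Fin.castLE h k) * √(lam (Fin.castLE h k))

/-- `U` is a left-singular vector matrix of the `n × d` matrix `X`: the left factor `U ∈ 𝕆(n, d)`
of a singular value decomposition `X = U diag(s) Vᵀ`. -/
def IsLeftSingularMatrix {n d : ℕ} (X U : Matrix (Fin n) (Fin d) ℝ) : Prop :=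
  Uᵀ * U = 1 ∧ ∃ (s : Fin d → ℝ) (V : Matrix (Fin d) (Fin d) ℝ),
    (∀ k, 0 ≤ s k) ∧ Antitone s ∧ V ∈ Matrix.orthogonalGroup (Fin d) ℝ ∧
    X = U * Matrix.diagonal s * Vᵀ

/-- The matrices with exactly `K` distinct rows. -/
def centroidMatrices (n d K : ℕ) : Set (Matrix (Fin n) (Fin d) ℝ) :=
  {C | (Set.range (fun i => C i)).ncard = K}

/-- `C` is a matrix of `K`-means centroids of the rows of `X`: a minimizer of `‖C - X‖_F` among the
matrices with `K` distinct rows. -/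
def IsKMeansCentroids {n d : ℕ} (K : ℕ) (X C : Matrix (Fin n) (Fin d) ℝ) : Prop :=
  C ∈ centroidMatrices n d K ∧
    ∀ C' ∈ centroidMatrices n d K, frobNorm (C - X) ≤ frobNorm (C' - X)

/-- `τ` is a cluster assignment function obtained by `K`-means applied to the rows of `X`. -/
def IsKMeansAssignment {n d : ℕ} (K : ℕ) (X : Matrix (Fin n) (Fin d) ℝ)
    (τ : Fin n → Fin K) : Prop :=
  ∃ C, IsKMeansCentroids K X C ∧ ∀ i j, τ i = τ j ↔ C i = C j

/-- The Hamming distance between two cluster assignments. -/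
def hammingDistance {n K : ℕ} (τ₁ τ₂ : Fin n → Fin K) : ℕ :=
  (Finset.univ.filter (fun i => τ₁ i ≠ τ₂ i)).card

/-- `inf_σ d_H(σ ∘ τ₁, τ₂)` over the permutations `σ` of the labels. -/
def misclustered {n K : ℕ} (τ₁ τ₂ : Fin n → Fin K) : ℕ :=
  ⨅ σ : Equiv.Perm (Fin K), hammingDistance (σ ∘ τ₁) τ₂

/-- The least eigenvalue of a real symmetric `d × d` matrix, `λ_d(A)`. -/
def leastEigenvalue {d : ℕ} {A : Matrix (Fin d) (Fin d) ℝ} (hA : A.IsHermitian) : ℝ :=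
  ⨅ k, hA.eigenvalues k

/-- The number of rows of `X` equal to `x`. -/
def blockSize {n d : ℕ} (X : Matrix (Fin n) (Fin d) ℝ) (x : Fin d → ℝ) : ℕ :=
  {i | X i = x}.ncard

end

/-!
The theorem holds because everything happens on one event, of probability at least
`1 - exp (-n d)`: the upper triangular matrix of the scores `(yᵢⱼ - pᵢⱼ) / (pᵢⱼ (1 - pᵢⱼ))`, with
`pᵢⱼ` the true edge probabilities, has operator norm of order `√n` (`ScoreBound`,
`measure_not_scoreBound_le`: Hoeffding's inequality for a bilinear form and a union bound over a net
of `5 ^ n` points). On this event the posterior is controlled deterministically, without tests.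

* The log-likelihood ratio of `X` against `X₀` is a linear form in the scores up to a multiple of
  `-‖X Xᵀ - X₀ X₀ᵀ‖²` (`rdpgLikelihood_le`, `le_rdpgLikelihood`). Writing
  `X Xᵀ - X₀ X₀ᵀ = V Eᵀ + E Vᵀ + E Eᵀ` with a rotation `V = X₀ W` and `E = X - V`, the linear form
  is at most of order `n ‖E‖`. The Procrustes bound `exists_orthogonal_frobSq_sub_le` says that, for
  the best rotation, `n ‖E‖²` is at most of order `‖X Xᵀ - X₀ X₀ᵀ‖²`. So away from the truth the
  likelihood decays like `exp (-a n ‖X - X₀ W‖²)` for some orthogonal `W`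
  (`exists_orthogonal_rdpgLikelihood_le`).
* Up to a polynomial factor, `W` may be fixed by rounding it to a grid. The Gaussian integral
  against the prior has order `Bⁿ n^(-nd/2)` (`rdpgPosteriorNumerator_le`), and the normalizing
  constant is, up to such a factor `Bⁿ`, at least the prior mass of a product of cubes of side
  proportional to `1 / √n`, which has the same order (`le_rdpgPosteriorNumerator_univ`). The powers
  of `n` cancel, and a large radius beats what remains: the posterior mass of
  `‖X Xᵀ - X₀ X₀ᵀ‖² > m² n` is at most `exp (-n d)` (`exists_contraction_constant`). The statement
  up to rotation is again Procrustes alignment.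
* A minimizer of the `K`-means problem for `A` is close to every matrix with `K` distinct rows that
  is close to `A`. If the latter has separated rows and large blocks, few rows can be misclassified,
  and the relabelling is a bijection because all `K` blocks are met (`kMeans_stability`). For
  posterior draws the reference matrix is a rotation of `X₀`.
* By Jensen's inequality the posterior mean is as close to `X₀ X₀ᵀ` as the draws are. Its first `d`
  eigenvalues are at least of order `n` (`le_eigenvalue_of_near_gram`), hence its leading
  eigenvectors are close to `X₀ H` for a square matrix `H` with `‖x H‖ ≥ ‖x‖ / (2 √n)`
  (`exists_leftSingular_near`). The rows of `X₀ H` are therefore separated by `ξ / (2 √n)`, and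
  `K`-means stability applies with reference matrix `X₀ H`; the exceptional events are summable
  in `n`.
-/

/-! ### Frobenius norm -/

/-- The squared Frobenius norm. -/
def frobSq {m n : ℕ} (A : Matrix (Fin m) (Fin n) ℝ) : ℝ := ∑ i, ∑ j, A i j ^ 2

lemma frobSq_nonneg {m n : ℕ} (A : Matrix (Fin m) (Fin n) ℝ) : 0 ≤ frobSq A :=
  Finset.sum_nonneg fun _ _ => Finset.sum_nonneg fun _ _ => sq_nonneg _

lemma frobNorm_sq {m n : ℕ} (A : Matrix (Fin m) (Fin n) ℝ) : frobNorm A ^ 2 = frobSq A :=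
  Real.sq_sqrt (frobSq_nonneg A)

lemma frobNorm_le_iff {m n : ℕ} (A B : Matrix (Fin m) (Fin n) ℝ) :
    frobNorm A ≤ frobNorm B ↔ frobSq A ≤ frobSq B :=
  Real.sqrt_le_sqrt_iff (frobSq_nonneg B)

lemma frobSq_eq_sum_dotProduct {m n : ℕ} (A : Matrix (Fin m) (Fin n) ℝ) :
    frobSq A = ∑ i, A i ⬝ᵥ A i := by
  simp [frobSq, dotProduct, sq]

lemma frobSq_eq_trace {m n : ℕ} (A : Matrix (Fin m) (Fin n) ℝ) : frobSq A = (A * Aᵀ).trace := by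
  simp [frobSq, Matrix.trace, Matrix.mul_apply, sq]

lemma frobSq_transpose {m n : ℕ} (A : Matrix (Fin m) (Fin n) ℝ) : frobSq Aᵀ = frobSq A :=
  Finset.sum_comm

lemma frobSq_neg {m n : ℕ} (A : Matrix (Fin m) (Fin n) ℝ) : frobSq (-A) = frobSq A := by
  simp [frobSq]

lemma frobSq_sub_comm {m n : ℕ} (A B : Matrix (Fin m) (Fin n) ℝ) :
    frobSq (A - B) = frobSq (B - A) := by
  rw [← frobSq_neg, neg_sub]

lemma frobSq_add_le {m n : ℕ} (A B : Matrix (Fin m) (Fin n) ℝ) :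
    frobSq (A + B) ≤ 2 * frobSq A + 2 * frobSq B := by
  simp only [frobSq, Finset.mul_sum, ← Finset.sum_add_distrib]
  gcongr with i _ j _
  simp only [Matrix.add_apply]
  nlinarith [sq_nonneg (A i j - B i j)]

lemma dotProduct_self_nonneg {n : ℕ} (v : Fin n → ℝ) : 0 ≤ v ⬝ᵥ v :=
  Finset.sum_nonneg fun _ _ => mul_self_nonneg _

lemma dotProduct_sq_le {n : ℕ} (u v : Fin n → ℝ) : (u ⬝ᵥ v) ^ 2 ≤ (u ⬝ᵥ u) * (v ⬝ᵥ v) := by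
  simpa [dotProduct, sq] using Finset.sum_mul_sq_le_sq_mul_sq Finset.univ u v

/-- `‖A v‖² ≤ ‖A‖_F² ‖v‖²`. -/
lemma dotProduct_mulVec_self_le {m n : ℕ} (A : Matrix (Fin m) (Fin n) ℝ) (v : Fin n → ℝ) :
    (A *ᵥ v) ⬝ᵥ (A *ᵥ v) ≤ frobSq A * (v ⬝ᵥ v) := by
  rw [frobSq_eq_sum_dotProduct, Finset.sum_mul]
  refine Finset.sum_le_sum fun i _ => ?_
  have := dotProduct_sq_le (A i) v
  rw [sq] at this
  exact this

lemma dotProduct_mulVec_mulVec {m n k : ℕ} (A : Matrix (Fin m) (Fin n) ℝ)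
    (B : Matrix (Fin m) (Fin k) ℝ) (v : Fin n → ℝ) (w : Fin k → ℝ) :
    (A *ᵥ v) ⬝ᵥ (B *ᵥ w) = v ⬝ᵥ ((Aᵀ * B) *ᵥ w) := by
  rw [← Matrix.mulVec_mulVec, Matrix.dotProduct_mulVec, Matrix.dotProduct_mulVec,
    Matrix.vecMul_transpose, ← Matrix.dotProduct_mulVec]

/-- `‖A B‖_F² ≤ ‖A‖_F² ‖B‖_F²`. -/
lemma frobSq_mul_le {m n k : ℕ} (A : Matrix (Fin m) (Fin n) ℝ) (B : Matrix (Fin n) (Fin k) ℝ) :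
    frobSq (A * B) ≤ frobSq A * frobSq B := by
  rw [← frobSq_transpose (A * B), ← frobSq_transpose B, frobSq_eq_sum_dotProduct (A * B)ᵀ,
    frobSq_eq_sum_dotProduct Bᵀ, Finset.mul_sum]
  exact Finset.sum_le_sum fun j _ => dotProduct_mulVec_self_le A (Bᵀ j)

/-- Multiplication on the right by a matrix with orthonormal rows preserves the Frobenius norm. -/
lemma frobSq_mul_of_mul_transpose {m n k : ℕ} (A : Matrix (Fin m) (Fin n) ℝ)
    {B : Matrix (Fin n) (Fin k) ℝ} (hB : B * Bᵀ = 1) : frobSq (A * B) = frobSq A := by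
  rw [frobSq_eq_trace, frobSq_eq_trace, Matrix.transpose_mul, ← Matrix.mul_assoc,
    Matrix.mul_assoc A, hB, Matrix.mul_one]

/-! ### Orthogonal Procrustes alignment -/

lemma isCompact_orthogonalGroup (d : ℕ) :
    IsCompact (Matrix.orthogonalGroup (Fin d) ℝ : Set (Matrix (Fin d) (Fin d) ℝ)) := by
  have hc : IsClosed (Matrix.orthogonalGroup (Fin d) ℝ : Set (Matrix (Fin d) (Fin d) ℝ)) := by
    have : (Matrix.orthogonalGroup (Fin d) ℝ : Set (Matrix (Fin d) (Fin d) ℝ))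
        = {A | A * Aᵀ = 1} := by
      ext A; exact Matrix.mem_orthogonalGroup_iff _ _
    rw [this]
    exact isClosed_eq (by fun_prop) continuous_const
  have hs : (Matrix.orthogonalGroup (Fin d) ℝ : Set (Matrix (Fin d) (Fin d) ℝ)) ⊆
      Set.pi Set.univ (fun _ : Fin d => Set.pi Set.univ fun _ : Fin d => Set.Icc (-1 : ℝ) 1) := by
    intro A hA i _ j _
    have := entry_norm_bound_of_unitary hA i j
    rwa [Real.norm_eq_abs, abs_le] at this
  exact (isCompact_univ_pi fun _ => isCompact_univ_pi fun _ => isCompact_Icc).of_isClosed_subset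
    hc hs

lemma reflection_mem_orthogonalGroup {d : ℕ} {v : Fin d → ℝ} (hv : v ⬝ᵥ v = 1) :
    (1 - (2 : ℝ) • Matrix.vecMulVec v v) ∈ Matrix.orthogonalGroup (Fin d) ℝ := by
  rw [Matrix.mem_orthogonalGroup_iff]
  have h1 : (1 - (2 : ℝ) • Matrix.vecMulVec v v)ᵀ = 1 - (2 : ℝ) • Matrix.vecMulVec v v := by
    simp [Matrix.transpose_vecMulVec]
  have h2 : Matrix.vecMulVec v v * Matrix.vecMulVec v v = Matrix.vecMulVec v v := by
    rw [Matrix.vecMulVec_mul_vecMulVec, hv]; simp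
  rw [h1, Matrix.mul_sub, Matrix.sub_mul, Matrix.sub_mul]
  simp only [Matrix.mul_smul, Matrix.smul_mul, h2, Matrix.mul_one, Matrix.one_mul]
  module

lemma trace_vecMulVec_mul {d : ℕ} (a b : Fin d → ℝ) (N : Matrix (Fin d) (Fin d) ℝ) :
    (Matrix.vecMulVec a b * N).trace = b ⬝ᵥ (N *ᵥ a) := by
  rw [Matrix.trace_mul_comm, Matrix.mul_vecMulVec, Matrix.trace_vecMulVec, dotProduct_comm]

/-- A matrix whose trace cannot be increased by an orthogonal factor is symmetric and positive
semidefinite: test against reflections and against products of two reflections. -/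
lemma symm_and_nonneg_of_trace_maximal {d : ℕ} (N : Matrix (Fin d) (Fin d) ℝ)
    (hN : ∀ O ∈ Matrix.orthogonalGroup (Fin d) ℝ, (O * N).trace ≤ N.trace) :
    Nᵀ = N ∧ ∀ v, 0 ≤ v ⬝ᵥ (N *ᵥ v) := by
  have hunit : ∀ v : Fin d → ℝ, v ⬝ᵥ v = 1 → 0 ≤ v ⬝ᵥ (N *ᵥ v) := by
    intro v hv
    have := hN _ (reflection_mem_orthogonalGroup hv)
    rw [Matrix.sub_mul, Matrix.one_mul, Matrix.trace_sub, Matrix.smul_mul, Matrix.trace_smul,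
      trace_vecMulVec_mul, smul_eq_mul] at this
    linarith
  constructor
  · -- the product of the reflections in `e_i` and `c e_i + s e_j` is a plane rotation
    have key : ∀ i j : Fin d, i ≠ j → N i j ≤ N j i := by
      intro i j hij
      have hrot : ∀ c s : ℝ, c ^ 2 + s ^ 2 = 1 →
          c * s * (N i j - N j i) ≤ s ^ 2 * (N i i + N j j) := by
        intro c s hcs
        set v : Fin d → ℝ := Pi.single i 1 with hv
        set w : Fin d → ℝ := Pi.single j 1 with hw
        have hvv : v ⬝ᵥ v = 1 := by simp [hv]
        have hww : w ⬝ᵥ w = 1 := by simp [hw]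
        have hvw : v ⬝ᵥ w = 0 := by simp [hv, hw, hij]
        have hwv : w ⬝ᵥ v = 0 := by rw [dotProduct_comm, hvw]
        have huu : (c • v + s • w) ⬝ᵥ (c • v + s • w) = 1 := by
          simp only [add_dotProduct, dotProduct_add, smul_dotProduct, dotProduct_smul, hvv, hww,
            hvw, hwv, smul_eq_mul]
          linarith
        have hu := reflection_mem_orthogonalGroup huu
        have hv' := reflection_mem_orthogonalGroup hvv
        have h := hN _ (mul_mem hu hv')
        have e1 : v ⬝ᵥ (N *ᵥ v) = N i i := by simp [hv]
        have e2 : v ⬝ᵥ (N *ᵥ w) = N i j := by simp [hv, hw]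
        have e3 : w ⬝ᵥ (N *ᵥ v) = N j i := by simp [hv, hw]
        have e4 : w ⬝ᵥ (N *ᵥ w) = N j j := by simp [hw]
        have huv : (c • v + s • w) ⬝ᵥ v = c := by
          simp [add_dotProduct, smul_dotProduct, hvv, hwv]
        rw [Matrix.sub_mul 1, Matrix.one_mul, Matrix.mul_sub, Matrix.mul_one] at h
        simp only [Matrix.smul_mul, Matrix.mul_smul, Matrix.vecMulVec_mul_vecMulVec, huv,
          Matrix.sub_mul, Matrix.one_mul, Matrix.trace_sub, Matrix.trace_smul, smul_eq_mul,
          Matrix.vecMulVec_smul, trace_vecMulVec_mul, Matrix.mulVec_add, Matrix.mulVec_smul,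
          add_dotProduct, dotProduct_add, smul_dotProduct, dotProduct_smul, e1, e2, e3, e4] at h
        have h5 : c ^ 2 * N i i = (1 - s ^ 2) * N i i := by rw [← hcs]; ring
        linarith
      by_contra hlt
      push Not at hlt
      set b := N i j - N j i with hb
      have hbpos : 0 < b := by linarith
      set a := N i i + N j j with ha
      have hpy : ∀ t : ℝ, ((1 / √(1 + t ^ 2)) ^ 2 + (t / √(1 + t ^ 2)) ^ 2) = 1 := by
        intro t
        have : (0 : ℝ) < 1 + t ^ 2 := by positivity
        rw [div_pow, div_pow, Real.sq_sqrt this.le]; field_simp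
      have ht : ∀ t : ℝ, 0 < t → b ≤ t * a := by
        intro t ht
        have h := hrot _ _ (hpy t)
        have hp : (0 : ℝ) < 1 + t ^ 2 := by positivity
        rw [div_mul_div_comm, div_pow, ← sq, Real.sq_sqrt hp.le] at h
        have h2 : t * b / (1 + t ^ 2) ≤ t ^ 2 * a / (1 + t ^ 2) := by
          calc _ = 1 * t / (1 + t ^ 2) * b := by ring
            _ ≤ _ := h
            _ = _ := by ring
        rw [div_le_div_iff_of_pos_right hp] at h2
        nlinarith
      have hapos : 0 < a := by have := ht 1 one_pos; linarith
      have := ht (b / (2 * a)) (by positivity)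
      rw [show b / (2 * a) * a = b / 2 by field_simp] at this
      linarith
    ext i j
    rcases eq_or_ne i j with rfl | hij
    · rfl
    · exact le_antisymm (key j i hij.symm) (key i j hij)
  · intro v
    rcases (dotProduct_self_nonneg v).eq_or_lt with h0 | hpos
    · have : v = 0 := dotProduct_self_eq_zero.mp h0.symm
      simp [this]
    · set r := √(v ⬝ᵥ v) with hr
      have hrpos : 0 < r := Real.sqrt_pos.mpr hpos
      have hrr : r * r = v ⬝ᵥ v := Real.mul_self_sqrt hpos.le
      have h := hunit (r⁻¹ • v) (by
        rw [smul_dotProduct, dotProduct_smul, smul_eq_mul, smul_eq_mul, ← hrr]; field_simp)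
      rw [Matrix.mulVec_smul, smul_dotProduct, dotProduct_smul, smul_eq_mul, smul_eq_mul] at h
      have : v ⬝ᵥ (N *ᵥ v) = r ^ 2 * (r⁻¹ * (r⁻¹ * (v ⬝ᵥ (N *ᵥ v)))) := by field_simp
      rw [this]; positivity

/-- Orthogonal factor of a polar decomposition. -/
lemma exists_orthogonal_transpose_mul_posSemidef {d : ℕ} (M : Matrix (Fin d) (Fin d) ℝ) :
    ∃ W ∈ Matrix.orthogonalGroup (Fin d) ℝ,
      (Wᵀ * M)ᵀ = Wᵀ * M ∧ ∀ v, 0 ≤ v ⬝ᵥ ((Wᵀ * M) *ᵥ v) := by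
  obtain ⟨W, hW, hmax⟩ := (isCompact_orthogonalGroup d).exists_isMaxOn ⟨1, one_mem _⟩
    (f := fun W : Matrix (Fin d) (Fin d) ℝ => (Wᵀ * M).trace) (by fun_prop)
  refine ⟨W, hW, symm_and_nonneg_of_trace_maximal _ fun O hO => ?_⟩
  have hO' : W * Oᵀ ∈ Matrix.orthogonalGroup (Fin d) ℝ := by
    have : Oᵀ ∈ Matrix.orthogonalGroup (Fin d) ℝ := by
      rw [Matrix.mem_orthogonalGroup_iff, Matrix.transpose_transpose]
      exact (Matrix.mem_orthogonalGroup_iff' _ _).mp hO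
    exact mul_mem hW this
  have := hmax hO'
  simpa [Matrix.transpose_mul, Matrix.mul_assoc] using this

lemma trace_transpose_mul_self_mul {n d : ℕ} (E : Matrix (Fin n) (Fin d) ℝ)
    (N : Matrix (Fin d) (Fin d) ℝ) : (Eᵀ * E * N).trace = ∑ i, E i ⬝ᵥ (N *ᵥ E i) := by
  rw [Matrix.mul_assoc, Matrix.trace_mul_comm]
  simp only [Matrix.trace, Matrix.diag_apply, Matrix.mul_apply, dotProduct, Matrix.mulVec,
    Matrix.transpose_apply, Finset.sum_mul, Finset.mul_sum]
  refine Finset.sum_congr rfl fun i _ => ?_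
  rw [Finset.sum_comm]
  exact Finset.sum_congr rfl fun _ _ => Finset.sum_congr rfl fun _ _ => by ring

/-- If `Vᵀ X` is symmetric positive semidefinite, the Frobenius distance of the Gram matrices
controls the distance of `X` and `V`. -/
lemma frobSq_sub_le_of_aligned {n d : ℕ} (X V : Matrix (Fin n) (Fin d) ℝ) {κ : ℝ}
    (hsymm : (Vᵀ * X)ᵀ = Vᵀ * X) (hpos : ∀ v, 0 ≤ v ⬝ᵥ ((Vᵀ * X) *ᵥ v))
    (hκ : ∀ v, κ * (v ⬝ᵥ v) ≤ v ⬝ᵥ ((Vᵀ * V) *ᵥ v)) :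
    4 / 5 * κ * frobSq (X - V) ≤ frobSq (X * Xᵀ - V * Vᵀ) := by
  set N := Vᵀ * X with hN
  set G := Vᵀ * V with hG
  set F := (X - V)ᵀ * (X - V) with hF
  set H := Xᵀ * X with hH
  have hN' : Xᵀ * V = N := by rw [← hsymm, hN, Matrix.transpose_mul, Matrix.transpose_transpose]
  have hFe : H = F + (2 : ℝ) • N - G := by
    have : F = H - Xᵀ * V - (N - G) := by
      rw [hF, Matrix.transpose_sub, Matrix.sub_mul, Matrix.mul_sub, Matrix.mul_sub]
    rw [this, hN']; module
  have hgram : frobSq (X * Xᵀ - V * Vᵀ)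
      = (H * H).trace - 2 * (N * N).trace + (G * G).trace := by
    rw [frobSq_eq_trace]
    have t1 : (X * Xᵀ * (X * Xᵀ)).trace = (H * H).trace := by
      rw [Matrix.mul_assoc, Matrix.trace_mul_comm, hH]; simp only [Matrix.mul_assoc]
    have t2 : (X * Xᵀ * (V * Vᵀ)).trace = (N * N).trace := by
      rw [Matrix.mul_assoc, Matrix.trace_mul_comm, ← Matrix.mul_assoc Xᵀ, hN',
        Matrix.mul_assoc, ← hN]
    have t3 : (V * Vᵀ * (X * Xᵀ)).trace = (N * N).trace := by
      rw [Matrix.trace_mul_comm, t2]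
    have t4 : (V * Vᵀ * (V * Vᵀ)).trace = (G * G).trace := by
      rw [Matrix.mul_assoc, Matrix.trace_mul_comm, hG]; simp only [Matrix.mul_assoc]
    simp only [Matrix.transpose_sub, Matrix.transpose_mul, Matrix.transpose_transpose,
      Matrix.sub_mul, Matrix.mul_sub, Matrix.trace_sub, t1, t2, t3, t4]
    ring
  have hFN : 0 ≤ (F * N).trace := by
    rw [hF, trace_transpose_mul_self_mul]; exact Finset.sum_nonneg fun i _ => hpos _
  have hFG : κ * frobSq (X - V) ≤ (F * G).trace := by
    rw [hF, trace_transpose_mul_self_mul, frobSq_eq_sum_dotProduct, Finset.mul_sum]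
    exact Finset.sum_le_sum fun i _ => hκ _
  have hsq : ∀ A : Matrix (Fin d) (Fin d) ℝ, Aᵀ = A → 0 ≤ (A * A).trace := by
    intro A hA
    have := frobSq_nonneg A
    rwa [frobSq_eq_trace, hA] at this
  have hFs : Fᵀ = F := by rw [hF, Matrix.transpose_mul, Matrix.transpose_transpose]
  have hGs : Gᵀ = G := by rw [hG, Matrix.transpose_mul, Matrix.transpose_transpose]
  -- with `D = N - G` the right-hand side is the trace of `F² + 2 D² + 4 F D + 2 F G`, that is, of
  -- `(F + (7/5) D)² + D² / 25 + (6/5) F N + (4/5) F G`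
  have s1 := hsq (N - G) (by rw [Matrix.transpose_sub, hsymm, hGs])
  have s2 := hsq (F + (7 / 5 : ℝ) • (N - G)) (by
    rw [Matrix.transpose_add, Matrix.transpose_smul, Matrix.transpose_sub, hsymm, hGs, hFs])
  rw [hgram, hFe]
  simp only [Matrix.sub_mul, Matrix.mul_sub, Matrix.add_mul, Matrix.mul_add, Matrix.smul_mul,
    Matrix.mul_smul, Matrix.trace_sub, Matrix.trace_add, Matrix.trace_smul, smul_eq_mul,
    Matrix.trace_mul_comm N F, Matrix.trace_mul_comm G F, Matrix.trace_mul_comm G N] at s1 s2 ⊢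
  nlinarith

/-- The Procrustes bound: closeness of the Gram matrices gives closeness up to an orthogonal
transformation. -/
lemma exists_orthogonal_frobSq_sub_le {n d : ℕ} (X X₀ : Matrix (Fin n) (Fin d) ℝ) {κ : ℝ}
    (hκ : ∀ v, κ * (v ⬝ᵥ v) ≤ v ⬝ᵥ ((X₀ᵀ * X₀) *ᵥ v)) :
    ∃ W ∈ Matrix.orthogonalGroup (Fin d) ℝ,
      4 / 5 * κ * frobSq (X - X₀ * W) ≤ frobSq (X * Xᵀ - X₀ * X₀ᵀ) := by
  obtain ⟨W, hW, h1, h2⟩ := exists_orthogonal_transpose_mul_posSemidef (X₀ᵀ * X)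
  refine ⟨W, hW, ?_⟩
  have hWW : W * Wᵀ = 1 := (Matrix.mem_orthogonalGroup_iff _ _).mp hW
  have hWW' : Wᵀ * W = 1 := mul_eq_one_comm.mp hWW
  have hV : (X₀ * W)ᵀ * X = Wᵀ * (X₀ᵀ * X) := by rw [Matrix.transpose_mul, Matrix.mul_assoc]
  have hVV : X₀ * W * (X₀ * W)ᵀ = X₀ * X₀ᵀ := by
    rw [Matrix.transpose_mul, ← Matrix.mul_assoc, Matrix.mul_assoc X₀, hWW, Matrix.mul_one]
  rw [← hVV]
  refine frobSq_sub_le_of_aligned X (X₀ * W) (by rw [hV, h1]) (fun v => by rw [hV]; exact h2 v) ?_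
  intro v
  rw [← dotProduct_mulVec_mulVec, ← Matrix.mulVec_mulVec, dotProduct_mulVec_mulVec]
  refine le_trans (le_of_eq ?_) (hκ _)
  rw [dotProduct_mulVec_mulVec, hWW', Matrix.one_mulVec]

/-! ### Operator norm of the noise -/

/-- The `(i, j)` entry of the noise, rescaled by the variance of the Bernoulli variable: the
derivative of the log-likelihood in the edge probability at the true parameter. -/
noncomputable def edgeScore {n d : ℕ} (X₀ : Matrix (Fin n) (Fin d) ℝ)
    (Y : Matrix (Fin n) (Fin n) Bool) (p : UpperPair n) : ℝ :=
  ((if Y p.1.1 p.1.2 = true then 1 else 0) - X₀ p.1.1 ⬝ᵥ X₀ p.1.2) /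
    (X₀ p.1.1 ⬝ᵥ X₀ p.1.2 * (1 - X₀ p.1.1 ⬝ᵥ X₀ p.1.2))

/-- The upper triangular matrix of scores has operator norm at most `S √n`. -/
def ScoreBound {n d : ℕ} (S : ℝ) (X₀ : Matrix (Fin n) (Fin d) ℝ)
    (Y : Matrix (Fin n) (Fin n) Bool) : Prop :=
  ∀ u v : Fin n → ℝ, |∑ p : UpperPair n, edgeScore X₀ Y p * (u p.1.1 * v p.1.2)|
    ≤ S * √(n : ℝ) * (√(u ⬝ᵥ u) * √(v ⬝ᵥ v))

/-- A maximal `1`-separated subset of the ball of radius `2`. -/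
lemma exists_net_ball_two (n : ℕ) : ∃ s : Finset (EuclideanSpace ℝ (Fin n)),
    s.card ≤ 5 ^ n ∧ (∀ c ∈ s, ‖c‖ ≤ 2) ∧ ∀ v, ‖v‖ ≤ 2 → ∃ c ∈ s, ‖v - c‖ ≤ 1 := by
  classical
  set P : Finset (EuclideanSpace ℝ (Fin n)) → Prop := fun s =>
    (∀ c ∈ s, ‖c‖ ≤ 2) ∧ ∀ c ∈ s, ∀ d ∈ s, c ≠ d → 1 ≤ ‖c - d‖ with hP
  -- volume comparison of the balls of radius `1 / 2` around the points of `s`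
  have hcard : ∀ s, P s → s.card ≤ 5 ^ n := by
    intro s hs
    simpa using Besicovitch.card_le_of_separated s hs.1 hs.2
  have hbdd : BddAbove {k | ∃ s, P s ∧ s.card = k} := by
    refine ⟨5 ^ n, ?_⟩
    rintro k ⟨s, hs, rfl⟩
    exact hcard s hs
  obtain ⟨s, hs, hmax⟩ := Nat.sSup_mem (s := {k | ∃ s, P s ∧ s.card = k})
    ⟨0, ∅, by simp [hP], rfl⟩ hbdd
  refine ⟨s, hcard s hs, hs.1, fun v hv => ?_⟩
  by_contra! hne
  have hvs : v ∉ s := fun h => by have := hne v h; simp at this; linarith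
  have hins : P (insert v s) := by
    refine ⟨?_, ?_⟩
    · intro c hc
      rcases Finset.mem_insert.mp hc with rfl | hc
      exacts [hv, hs.1 c hc]
    · intro c hc d hd hcd
      rcases Finset.mem_insert.mp hc with hc | hc <;> rcases Finset.mem_insert.mp hd with hd | hd
      · exact absurd (hc.trans hd.symm) hcd
      · rw [hc]; exact (hne d hd).le
      · rw [hd, norm_sub_rev]; exact (hne c hc).le
      · exact hs.2 c hc d hd hcd
  have := le_csSup hbdd ⟨_, hins, rfl⟩
  rw [← hmax, Finset.card_insert_of_notMem hvs] at this
  omega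

lemma opNorm_le_of_net {E F : Type*} [NormedAddCommGroup E] [NormedSpace ℝ E]
    [NormedAddCommGroup F] [NormedSpace ℝ F] (T : E →L[ℝ] F) {s : Finset E} {t : ℝ} (ht : 0 ≤ t)
    (hs : ∀ v, ‖v‖ ≤ 2 → ∃ c ∈ s, ‖v - c‖ ≤ 1) (hT : ∀ c ∈ s, ‖T c‖ ≤ t) : ‖T‖ ≤ t := by
  have h : ‖T‖ ≤ (t + ‖T‖) / 2 := by
    refine T.opNorm_le_bound (by positivity) fun v => ?_
    rcases eq_or_ne v 0 with rfl | hv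
    · simp
    have hvp : 0 < ‖v‖ := norm_pos_iff.mpr hv
    set w := (2 / ‖v‖) • v with hw
    have hwn : ‖w‖ = 2 := by rw [hw, norm_smul]; simp; field_simp
    obtain ⟨c, hc, hwc⟩ := hs w hwn.le
    have h1 : ‖T w‖ ≤ t + ‖T‖ := by
      calc ‖T w‖ = ‖T c + T (w - c)‖ := by rw [← map_add]; simp
        _ ≤ ‖T c‖ + ‖T (w - c)‖ := norm_add_le _ _
        _ ≤ t + ‖T‖ * 1 := add_le_add (hT c hc)
            ((T.le_opNorm _).trans (mul_le_mul_of_nonneg_left hwc (norm_nonneg _)))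
        _ = t + ‖T‖ := by ring
    rw [hw, map_smul, norm_smul, norm_div, norm_norm, Real.norm_ofNat] at h1
    rw [div_mul_eq_mul_div, div_le_iff₀ hvp] at h1
    linarith
  linarith

section

variable {Ω : Type*} [MeasurableSpace Ω] {μ : Measure Ω} [IsProbabilityMeasure μ]
  {n d : ℕ} {X₀ : Matrix (Fin n) (Fin d) ℝ} {Y : Ω → Matrix (Fin n) (Fin n) Bool} {δ : ℝ}

lemma abs_edgeScore_le (hδ : 0 < δ)
    (hX₀ : ∀ i j, δ ≤ X₀ i ⬝ᵥ X₀ j ∧ X₀ i ⬝ᵥ X₀ j ≤ 1 - δ) (Y : Matrix (Fin n) (Fin n) Bool)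
    (p : UpperPair n) : |edgeScore X₀ Y p| ≤ 1 / δ := by
  obtain ⟨h1, h2⟩ := hX₀ p.1.1 p.1.2
  unfold edgeScore
  set q := X₀ p.1.1 ⬝ᵥ X₀ p.1.2
  have hq : 0 < q := by linarith
  have hq' : 0 < 1 - q := by linarith
  split_ifs
  · rw [abs_of_nonneg (by positivity), div_le_div_iff₀ (by positivity) hδ]
    nlinarith
  · rw [abs_div, abs_of_neg (by linarith), abs_of_pos (by positivity),
      div_le_div_iff₀ (by positivity) hδ]
    nlinarith

omit [IsProbabilityMeasure μ] in
lemma measurable_edgeScore (hY : IsRDPG μ X₀ Y) (p : UpperPair n) :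
    Measurable fun ω => edgeScore X₀ (Y ω) p := by
  have : Measurable fun b : Bool => ((if b = true then 1 else 0) - X₀ p.1.1 ⬝ᵥ X₀ p.1.2) /
    (X₀ p.1.1 ⬝ᵥ X₀ p.1.2 * (1 - X₀ p.1.1 ⬝ᵥ X₀ p.1.2)) := measurable_of_finite _
  exact this.comp (hY.measurable _ _)

lemma integral_edgeScore (hδ : 0 < δ)
    (hX₀ : ∀ i j, δ ≤ X₀ i ⬝ᵥ X₀ j ∧ X₀ i ⬝ᵥ X₀ j ≤ 1 - δ) (hY : IsRDPG μ X₀ Y)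
    (p : UpperPair n) : ∫ ω, edgeScore X₀ (Y ω) p ∂μ = 0 := by
  unfold edgeScore
  set q := X₀ p.1.1 ⬝ᵥ X₀ p.1.2 with hq
  have hq0 : 0 ≤ q := by linarith [(hX₀ p.1.1 p.1.2).1]
  have hs : MeasurableSet {ω | Y ω p.1.1 p.1.2 = true} :=
    (hY.measurable _ _) (measurableSet_singleton true)
  have hind : (fun ω => if Y ω p.1.1 p.1.2 = true then (1 : ℝ) else 0)
      = {ω | Y ω p.1.1 p.1.2 = true}.indicator 1 := by
    ext ω; simp [Set.indicator]
  have hint : Integrable (fun ω => if Y ω p.1.1 p.1.2 = true then (1 : ℝ) else 0) μ := by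
    rw [hind]; exact (integrable_const (1 : ℝ)).indicator hs
  rw [integral_div, integral_sub hint (integrable_const _), hind, integral_indicator_one hs,
    Measure.real, hY.bernoulli _ _ p.2, ENNReal.toReal_ofReal hq0]
  simp [hq]

/-- Hoeffding's inequality for the bilinear form of the scores. -/
lemma measure_scoreForm_ge_le (hδ : 0 < δ)
    (hX₀ : ∀ i j, δ ≤ X₀ i ⬝ᵥ X₀ j ∧ X₀ i ⬝ᵥ X₀ j ≤ 1 - δ) (hY : IsRDPG μ X₀ Y)
    (u v : EuclideanSpace ℝ (Fin n)) (hu : ‖u‖ ≤ 2) (hv : ‖v‖ ≤ 2) {t : ℝ} (ht : 0 ≤ t) :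
    μ {ω | t ≤ ∑ p : UpperPair n, edgeScore X₀ (Y ω) p * (u p.1.1 * v p.1.2)}
      ≤ ENNReal.ofReal (Real.exp (-(t ^ 2 * δ ^ 2 / 32))) := by
  have hsub : ∀ p : UpperPair n, HasSubgaussianMGF
      (fun ω => (u p.1.1 * v p.1.2) * edgeScore X₀ (Y ω) p)
      (Real.toNNReal ((u p.1.1 * v p.1.2) ^ 2 * (1 / δ) ^ 2)) μ := by
    intro p
    convert (hasSubgaussianMGF_of_mem_Icc_of_integral_eq_zero
      (measurable_edgeScore hY p).aemeasurable
      (ae_of_all _ fun ω => abs_le.mp (abs_edgeScore_le hδ hX₀ (Y ω) p))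
      (integral_edgeScore hδ hX₀ hY p)).const_mul (u p.1.1 * v p.1.2) using 1
    apply NNReal.coe_injective
    have h1 : 1 / δ - -(1 / δ) = 2 * (1 / δ) := by ring
    have h2 : ‖2 * (1 / δ)‖ / 2 = 1 / δ := by
      rw [Real.norm_of_nonneg (by positivity)]; ring
    rw [Real.coe_toNNReal _ (by positivity)]
    change _ = (u p.1.1 * v p.1.2) ^ 2 * (‖1 / δ - -(1 / δ)‖ / 2) ^ 2
    rw [h1, h2]
  have hind : iIndepFun (fun (p : UpperPair n) ω =>
      (u p.1.1 * v p.1.2) * edgeScore X₀ (Y ω) p) μ :=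
    hY.indep.comp (fun (p : UpperPair n) (b : Bool) =>
      (u p.1.1 * v p.1.2) * (((if b = true then 1 else 0) - X₀ p.1.1 ⬝ᵥ X₀ p.1.2) /
        (X₀ p.1.1 ⬝ᵥ X₀ p.1.2 * (1 - X₀ p.1.1 ⬝ᵥ X₀ p.1.2)))) (fun p => measurable_of_finite _)
  have hsum : ∑ p : UpperPair n, (u p.1.1 * v p.1.2) ^ 2 ≤ 16 := by
    calc ∑ p : UpperPair n, (u p.1.1 * v p.1.2) ^ 2
        = ∑ p ∈ (Finset.univ.filter fun p : Fin n × Fin n => p.1 ≤ p.2), (u p.1 * v p.2) ^ 2 :=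
          (Finset.sum_subtype (p := fun p : Fin n × Fin n => p.1 ≤ p.2) _ (by simp)
            fun p => (u p.1 * v p.2) ^ 2).symm
      _ ≤ ∑ p : Fin n × Fin n, (u p.1 * v p.2) ^ 2 :=
          Finset.sum_le_sum_of_subset_of_nonneg (Finset.filter_subset _ _)
            fun _ _ _ => sq_nonneg _
      _ = (∑ i, u i ^ 2) * ∑ j, v j ^ 2 := by
          rw [Finset.sum_mul_sum, ← Finset.univ_product_univ, Finset.sum_product]
          simp only [mul_pow]
      _ = ‖u‖ ^ 2 * ‖v‖ ^ 2 := by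
          rw [EuclideanSpace.real_norm_sq_eq, EuclideanSpace.real_norm_sq_eq]
      _ ≤ 2 ^ 2 * 2 ^ 2 := by gcongr
      _ = 16 := by norm_num
  have h := HasSubgaussianMGF.sum_of_iIndepFun hind (s := Finset.univ) (fun p _ => hsub p)
  -- the variance proxy is enlarged to a positive number free of `u` and `v`
  have h' : HasSubgaussianMGF (fun ω => ∑ p : UpperPair n,
      (u p.1.1 * v p.1.2) * edgeScore X₀ (Y ω) p) (Real.toNNReal (16 / δ ^ 2)) μ := by
    refine ⟨h.integrable_exp_mul, fun s => (h.mgf_le s).trans (Real.exp_le_exp.mpr ?_)⟩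
    refine div_le_div_of_nonneg_right (mul_le_mul_of_nonneg_right ?_ (sq_nonneg s)) zero_le_two
    rw [NNReal.coe_sum, Real.coe_toNNReal _ (by positivity)]
    calc ∑ p : UpperPair n, ((Real.toNNReal ((u p.1.1 * v p.1.2) ^ 2 * (1 / δ) ^ 2) : NNReal) : ℝ)
        = (∑ p : UpperPair n, (u p.1.1 * v p.1.2) ^ 2) * (1 / δ) ^ 2 := by
          rw [Finset.sum_mul]
          exact Finset.sum_congr rfl fun p _ => Real.coe_toNNReal _ (by positivity)
      _ ≤ 16 * (1 / δ) ^ 2 := by gcongr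
      _ = 16 / δ ^ 2 := by ring
  have h3 := h'.measure_ge_le ht
  rw [Real.coe_toNNReal _ (by positivity)] at h3
  simp only [mul_comm (edgeScore _ _ _)]
  rw [← ENNReal.ofReal_toReal (measure_ne_top μ _)]
  refine ENNReal.ofReal_le_ofReal (h3.trans (le_of_eq ?_))
  congr 1
  field_simp
  ring

/-- The tail at level `(4 + d) n` beats a union over at most `2 · 25 ^ n ≤ exp (4 n)` events. -/
lemma card_sq_mul_exp_le (hn : 0 < n) {c : ℝ} (hc0 : 0 ≤ c) (hc : c ≤ 5 ^ n) :
    c * c * 2 * Real.exp (-((4 + d) * n : ℝ)) ≤ Real.exp (-(n * d : ℝ)) := by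
  have h2n : (2 : ℝ) ≤ 2 ^ n := by
    calc (2 : ℝ) = 2 ^ 1 := by norm_num
      _ ≤ 2 ^ n := pow_le_pow_right₀ (by norm_num) hn
  have he : (50 : ℝ) ≤ Real.exp 4 := by
    have : Real.exp 4 = Real.exp 1 ^ 4 := by rw [← Real.exp_nat_mul]; norm_num
    rw [this]
    calc (50 : ℝ) ≤ 2.718 ^ 4 := by norm_num
      _ ≤ _ := by gcongr; linarith [Real.exp_one_gt_d9]
  calc c * c * 2 * Real.exp (-((4 + d) * n : ℝ))
      ≤ (5 ^ n * 5 ^ n * 2 ^ n) * Real.exp (-((4 + d) * n : ℝ)) := by gcongr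
    _ = 50 ^ n * Real.exp (-((4 + d) * n : ℝ)) := by
        rw [← mul_pow, ← mul_pow]; norm_num
    _ ≤ Real.exp 4 ^ n * Real.exp (-((4 + d) * n : ℝ)) := by gcongr
    _ = Real.exp (-(n * d : ℝ)) := by
        rw [← Real.exp_nat_mul, ← Real.exp_add]; congr 1; ring

/-- With overwhelming probability the matrix of scores has operator norm of order `√n`:
Hoeffding's inequality and a union bound over pairs of points of a net. -/
lemma measure_not_scoreBound_le (hn : 0 < n) (hδ : 0 < δ)
    (hX₀ : ∀ i j, δ ≤ X₀ i ⬝ᵥ X₀ j ∧ X₀ i ⬝ᵥ X₀ j ≤ 1 - δ) (hY : IsRDPG μ X₀ Y) :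
    μ {ω | ¬ ScoreBound (√(32 * (4 + d)) / δ) X₀ (Y ω)}
      ≤ ENNReal.ofReal (Real.exp (-(n * d : ℝ))) := by
  obtain ⟨s, hcard, hs2, hnet⟩ := exists_net_ball_two n
  set S : ℝ := √(32 * (4 + d)) / δ with hS
  have hS0 : 0 ≤ S := by positivity
  set t : ℝ := S * √(n : ℝ) with ht
  have ht0 : 0 ≤ t := by positivity
  set f : EuclideanSpace ℝ (Fin n) → EuclideanSpace ℝ (Fin n) → Ω → ℝ := fun u v ω =>
    ∑ p : UpperPair n, edgeScore X₀ (Y ω) p * (u p.1.1 * v p.1.2) with hf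
  have hsub : {ω | ¬ ScoreBound S X₀ (Y ω)} ⊆
      ⋃ q ∈ s ×ˢ s, ({ω | t ≤ f q.1 q.2 ω} ∪ {ω | t ≤ f (-q.1) q.2 ω}) := by
    intro ω hω
    by_contra hcon
    simp only [Set.mem_iUnion, not_exists, Set.mem_union, Set.mem_ofPred_eq, not_or, not_le,
      Finset.mem_product] at hcon
    apply hω
    set B : EuclideanSpace ℝ (Fin n) →L[ℝ] EuclideanSpace ℝ (Fin n) →L[ℝ] ℝ :=
      ∑ p : UpperPair n, edgeScore X₀ (Y ω) p •
        (EuclideanSpace.proj p.1.1 : EuclideanSpace ℝ (Fin n) →L[ℝ] ℝ).smulRight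
          (EuclideanSpace.proj p.1.2 : EuclideanSpace ℝ (Fin n) →L[ℝ] ℝ) with hB
    have hBf : ∀ u v, B u v = f u v ω := by
      intro u v
      simp [hB, hf]
    have hBn : ‖B‖ ≤ t := by
      refine opNorm_le_of_net B ht0 hnet fun u hu => opNorm_le_of_net _ ht0 hnet fun v hv => ?_
      have h := hcon (u, v) ⟨hu, hv⟩
      have hneg : f (-u) v ω = - f u v ω := by rw [← hBf, ← hBf]; simp
      rw [hBf, Real.norm_eq_abs, abs_le]
      constructor <;> linarith [h.1, h.2, hneg]
    intro u v
    have hnorm : ∀ w : Fin n → ℝ, ‖WithLp.toLp 2 w‖ = √(w ⬝ᵥ w) := by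
      intro w
      rw [EuclideanSpace.norm_eq]
      simp [dotProduct, sq]
    have h := B.le_opNorm₂ (WithLp.toLp 2 u) (WithLp.toLp 2 v)
    rw [hBf, Real.norm_eq_abs, hnorm, hnorm, mul_assoc] at h
    exact h.trans (mul_le_mul_of_nonneg_right hBn (by positivity))
  have hexp : t ^ 2 * δ ^ 2 / 32 = (4 + d) * n := by
    rw [ht, hS, mul_pow, div_pow, Real.sq_sqrt (by positivity), Real.sq_sqrt (by positivity)]
    field_simp
  set ε := ENNReal.ofReal (Real.exp (-((4 + d) * n : ℝ))) with hε
  have hone : ∀ u ∈ s, ∀ v ∈ s,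
      μ ({ω | t ≤ f u v ω} ∪ {ω | t ≤ f (-u) v ω}) ≤ 2 * ε := by
    intro u hu v hv
    have h1 := measure_scoreForm_ge_le hδ hX₀ hY u v (hs2 u hu) (hs2 v hv) ht0
    have h2 := measure_scoreForm_ge_le hδ hX₀ hY (-u) v (by rw [norm_neg]; exact hs2 u hu)
      (hs2 v hv) ht0
    rw [hexp] at h1 h2
    rw [two_mul]
    exact (measure_union_le _ _).trans (add_le_add h1 h2)
  calc μ {ω | ¬ ScoreBound S X₀ (Y ω)}
      ≤ ∑ q ∈ s ×ˢ s, μ ({ω | t ≤ f q.1 q.2 ω} ∪ {ω | t ≤ f (-q.1) q.2 ω}) :=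
        (measure_mono hsub).trans (measure_biUnion_finset_le _ _)
    _ ≤ ∑ q ∈ s ×ˢ s, 2 * ε := Finset.sum_le_sum fun q hq =>
        hone _ (Finset.mem_product.mp hq).1 _ (Finset.mem_product.mp hq).2
    _ = ENNReal.ofReal ((s.card * s.card * 2 : ℝ) * Real.exp (-((4 + d) * n : ℝ))) := by
        have hk : (0 : ℝ) ≤ s.card := Nat.cast_nonneg _
        rw [Finset.sum_const, Finset.card_product, nsmul_eq_mul, hε,
          ENNReal.ofReal_mul (mul_nonneg (mul_nonneg hk hk) zero_le_two),
          ENNReal.ofReal_mul (mul_nonneg hk hk), ENNReal.ofReal_mul hk, ENNReal.ofReal_natCast,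
          ENNReal.ofReal_ofNat, Nat.cast_mul, mul_assoc _ 2]
    _ ≤ ENNReal.ofReal (Real.exp (-(n * d : ℝ))) := by
        apply ENNReal.ofReal_le_ofReal
        exact card_sq_mul_exp_le hn (Nat.cast_nonneg _) (by exact_mod_cast hcard)

end

/-! ### Quadratic bounds for the log-likelihood ratio -/

/-- With `u = x / q`, `√u ≤ exp (√u - 1)` gives `u ≤ exp (u - 1 - (√u - 1) ^ 2)`. -/
lemma le_mul_exp_sub_sq {δ q x : ℝ} (hδ : 0 < δ) (hq : δ ≤ q) (hq1 : q ≤ 1) (hx0 : 0 ≤ x)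
    (hx1 : x ≤ 1) : x ≤ q * Real.exp ((x - q) / q - δ / 4 * (x - q) ^ 2) := by
  have hq0 : 0 < q := by linarith
  set u := x / q with hu
  have hu0 : 0 ≤ u := by positivity
  have hux : x = q * u := by rw [hu]; field_simp
  set s := √u with hs
  have hs0 : 0 ≤ s := Real.sqrt_nonneg _
  have hss : s ^ 2 = u := Real.sq_sqrt hu0
  have h1 : u ≤ Real.exp (2 * (s - 1)) := by
    have := Real.add_one_le_exp (s - 1)
    calc u = s ^ 2 := hss.symm
      _ ≤ Real.exp (s - 1) ^ 2 := pow_le_pow_left₀ hs0 (by linarith) 2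
      _ = _ := by rw [← Real.exp_nat_mul]; norm_num
  have hxq : (x - q) / q = u - 1 := by rw [hu]; field_simp
  have hsq : δ / 4 * (x - q) ^ 2 ≤ (s - 1) ^ 2 := by
    have hδu : δ * (s + 1) ^ 2 ≤ 4 := by
      have hqu : q * u ≤ 1 := by rw [← hux]; exact hx1
      have : δ * u ≤ q * u := by gcongr
      nlinarith [sq_nonneg (s - 1)]
    have : (x - q) ^ 2 = q ^ 2 * ((s - 1) ^ 2 * (s + 1) ^ 2) := by
      rw [hux, ← hss]; ring
    rw [this]
    have hq2 : q ^ 2 ≤ 1 := by nlinarith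
    calc δ / 4 * (q ^ 2 * ((s - 1) ^ 2 * (s + 1) ^ 2))
        = q ^ 2 * ((s - 1) ^ 2 * (δ * (s + 1) ^ 2 / 4)) := by ring
      _ ≤ 1 * ((s - 1) ^ 2 * 1) := by gcongr; linarith
      _ = _ := by ring
  rw [hux]
  refine mul_le_mul_of_nonneg_left (h1.trans (Real.exp_le_exp.mpr ?_)) hq0.le
  rw [← hux, hxq]
  nlinarith

/-- With `u = x / q`, `exp (1 - 1 / u) ≤ u` gives `exp (u - 1 - 2 (u - 1) ^ 2) ≤ u` for
`u ≥ 1 / 2`. -/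
lemma mul_exp_sub_sq_le {δ q x : ℝ} (hδ : 0 < δ) (hq : δ ≤ q) (hx : |x - q| ≤ δ / 2) :
    q * Real.exp ((x - q) / q - 2 / δ ^ 2 * (x - q) ^ 2) ≤ x := by
  have hq0 : 0 < q := by linarith
  set u := x / q with hu
  have hux : x = q * u := by rw [hu]; field_simp
  have hxq : (x - q) / q = u - 1 := by rw [hu]; field_simp
  have hu2 : 1 / 2 ≤ u := by
    rw [hu, le_div_iff₀ hq0]; linarith [(abs_le.mp hx).1]
  have hu0 : 0 < u := by linarith
  have h1 : Real.exp (1 - 1 / u) ≤ u := by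
    have := Real.add_one_le_exp (1 / u - 1)
    rw [show 1 - 1 / u = -(1 / u - 1) by ring, Real.exp_neg, inv_le_comm₀ (Real.exp_pos _) hu0,
      ← one_div]
    linarith
  have h2 : u - 1 - 2 / δ ^ 2 * (x - q) ^ 2 ≤ 1 - 1 / u := by
    have e1 : 2 * (u - 1) ^ 2 ≤ 2 / δ ^ 2 * (x - q) ^ 2 := by
      rw [← hxq, div_pow, div_mul_eq_mul_div, mul_div_assoc]
      gcongr
    have e2 : (u - 1) - (1 - 1 / u) = (u - 1) ^ 2 / u := by field_simp
    have e3 : (u - 1) ^ 2 / u ≤ 2 * (u - 1) ^ 2 := by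
      rw [div_le_iff₀ hu0]; nlinarith [sq_nonneg (u - 1)]
    linarith
  calc q * Real.exp ((x - q) / q - 2 / δ ^ 2 * (x - q) ^ 2)
      ≤ q * Real.exp (1 - 1 / u) := by rw [hxq]; gcongr
    _ ≤ q * u := by gcongr
    _ = x := hux.symm

lemma abs_dotProduct_le {d : ℕ} {x y : Fin d → ℝ} {a b : ℝ} (ha : 0 ≤ a) (hb : 0 ≤ b)
    (hx : x ⬝ᵥ x ≤ a ^ 2) (hy : y ⬝ᵥ y ≤ b ^ 2) : |x ⬝ᵥ y| ≤ a * b := by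
  refine abs_le_of_sq_le_sq ?_ (by positivity)
  rw [mul_pow]
  exact (dotProduct_sq_le x y).trans
    (mul_le_mul hx hy (dotProduct_self_nonneg y) (by positivity))

lemma dotProduct_mem_Icc_of_mem_latentSpace {d : ℕ} {x y : Fin d → ℝ} (hx : x ∈ latentSpace d)
    (hy : y ∈ latentSpace d) : 0 ≤ x ⬝ᵥ y ∧ x ⬝ᵥ y ≤ 1 := by
  refine ⟨Finset.sum_nonneg fun k _ => mul_nonneg (hx.1 k) (hy.1 k), ?_⟩
  have := abs_dotProduct_le zero_le_one zero_le_one (by simpa using hx.2) (by simpa using hy.2)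
  linarith [le_abs_self (x ⬝ᵥ y)]

lemma frobSq_le_of_mem_latentSpace {n d : ℕ} {X : Matrix (Fin n) (Fin d) ℝ}
    (hX : ∀ i, X i ∈ latentSpace d) : frobSq X ≤ n := by
  rw [frobSq_eq_sum_dotProduct]
  calc ∑ i, X i ⬝ᵥ X i ≤ ∑ _i : Fin n, (1 : ℝ) := Finset.sum_le_sum fun i _ => (hX i).2
    _ = n := by simp

lemma mul_transpose_apply_eq {n d : ℕ} (X : Matrix (Fin n) (Fin d) ℝ) (i j : Fin n) :
    (X * Xᵀ) i j = X i ⬝ᵥ X j := rfl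

section

variable {n d : ℕ} {X₀ : Matrix (Fin n) (Fin d) ℝ} {Y : Matrix (Fin n) (Fin n) Bool} {S δ κ : ℝ}

/-- The difference of the edge probabilities of `X` and `X₀` at an index pair. -/
def edgeDiff (X X₀ : Matrix (Fin n) (Fin d) ℝ) (p : UpperPair n) : ℝ :=
  X p.1.1 ⬝ᵥ X p.1.2 - X₀ p.1.1 ⬝ᵥ X₀ p.1.2

lemma sum_edgeDiff_sq_le (X X₀ : Matrix (Fin n) (Fin d) ℝ) :
    ∑ p, edgeDiff X X₀ p ^ 2 ≤ frobSq (X * Xᵀ - X₀ * X₀ᵀ) := by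
  calc ∑ p, edgeDiff X X₀ p ^ 2
      = ∑ p ∈ (Finset.univ.filter fun p : Fin n × Fin n => p.1 ≤ p.2),
          (X * Xᵀ - X₀ * X₀ᵀ) p.1 p.2 ^ 2 :=
        (Finset.sum_subtype (p := fun p : Fin n × Fin n => p.1 ≤ p.2) _ (by simp)
          fun p => (X * Xᵀ - X₀ * X₀ᵀ) p.1 p.2 ^ 2).symm
    _ ≤ ∑ p : Fin n × Fin n, (X * Xᵀ - X₀ * X₀ᵀ) p.1 p.2 ^ 2 :=
        Finset.sum_le_sum_of_subset_of_nonneg (Finset.filter_subset _ _) fun _ _ _ => sq_nonneg _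
    _ = _ := by rw [← Finset.univ_product_univ, Finset.sum_product]; rfl

lemma frobSq_le_two_mul_sum_edgeDiff_sq (X X₀ : Matrix (Fin n) (Fin d) ℝ) :
    frobSq (X * Xᵀ - X₀ * X₀ᵀ) ≤ 2 * ∑ p, edgeDiff X X₀ p ^ 2 := by
  set A := X * Xᵀ - X₀ * X₀ᵀ with hA
  have hsymm : ∀ i j, A i j = A j i := fun i j => by
    simp only [hA, Matrix.sub_apply, mul_transpose_apply_eq]
    rw [dotProduct_comm, dotProduct_comm (X₀ i)]
  have h1 : ∑ p, edgeDiff X X₀ p ^ 2 = ∑ i, ∑ j, if i ≤ j then A i j ^ 2 else 0 := by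
    rw [← Finset.sum_product', Finset.univ_product_univ, ← Finset.sum_filter]
    exact (Finset.sum_subtype (p := fun p : Fin n × Fin n => p.1 ≤ p.2) _ (by simp)
          fun p => A p.1 p.2 ^ 2).symm
  have h2 : ∑ p, edgeDiff X X₀ p ^ 2 = ∑ i, ∑ j, if j ≤ i then A i j ^ 2 else 0 := by
    rw [h1, Finset.sum_comm]
    simp only [hsymm]
  rw [two_mul]
  nth_rw 1 [h1]
  rw [h2, ← Finset.sum_add_distrib, frobSq]
  refine Finset.sum_le_sum fun i _ => ?_
  rw [← Finset.sum_add_distrib]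
  refine Finset.sum_le_sum fun j _ => ?_
  rcases le_total i j with h | h
  · rw [if_pos h]; split_ifs <;> linarith [sq_nonneg (A i j)]
  · rw [if_pos h]; split_ifs <;> linarith [sq_nonneg (A i j)]

lemma rdpgLikelihood_pos (hδ : 0 < δ)
    (hX₀ : ∀ i j, δ ≤ X₀ i ⬝ᵥ X₀ j ∧ X₀ i ⬝ᵥ X₀ j ≤ 1 - δ) : 0 < rdpgLikelihood Y X₀ := by
  refine Finset.prod_pos fun p _ => ?_
  have := hX₀ p.1.1 p.1.2
  split_ifs <;> linarith

/-- The log-likelihood ratio is at most a linear term minus a quadratic term. -/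
lemma rdpgLikelihood_le (hδ : 0 < δ)
    (hX₀ : ∀ i j, δ ≤ X₀ i ⬝ᵥ X₀ j ∧ X₀ i ⬝ᵥ X₀ j ≤ 1 - δ) {X : Matrix (Fin n) (Fin d) ℝ}
    (hX : ∀ i, X i ∈ latentSpace d) :
    rdpgLikelihood Y X ≤ rdpgLikelihood Y X₀ *
      Real.exp (∑ p, edgeScore X₀ Y p * edgeDiff X X₀ p
        - δ / 8 * frobSq (X * Xᵀ - X₀ * X₀ᵀ)) := by
  have h1 : rdpgLikelihood Y X ≤ rdpgLikelihood Y X₀ *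
      Real.exp (∑ p, (edgeScore X₀ Y p * edgeDiff X X₀ p - δ / 4 * edgeDiff X X₀ p ^ 2)) := by
    unfold rdpgLikelihood
    rw [Real.exp_sum, ← Finset.prod_mul_distrib]
    refine Finset.prod_le_prod (fun p _ => ?_) fun p _ => ?_
    · have := dotProduct_mem_Icc_of_mem_latentSpace (hX p.1.1) (hX p.1.2)
      split_ifs <;> linarith
    · have hx := dotProduct_mem_Icc_of_mem_latentSpace (hX p.1.1) (hX p.1.2)
      have hq := hX₀ p.1.1 p.1.2
      unfold edgeScore edgeDiff
      set x := X p.1.1 ⬝ᵥ X p.1.2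
      set q := X₀ p.1.1 ⬝ᵥ X₀ p.1.2
      have hq0 : q ≠ 0 := by linarith
      have hq1 : 1 - q ≠ 0 := by linarith
      split_ifs
      · refine (le_mul_exp_sub_sq hδ hq.1 (by linarith) hx.1 hx.2).trans (le_of_eq ?_)
        congr 3; field_simp
      · refine (le_mul_exp_sub_sq (q := 1 - q) (x := 1 - x) hδ (by linarith) (by linarith)
          (by linarith) (by linarith)).trans (le_of_eq ?_)
        congr 2; field_simp; ring
  refine h1.trans (mul_le_mul_of_nonneg_left (Real.exp_le_exp.mpr ?_)
    (rdpgLikelihood_pos hδ hX₀).le)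
  rw [Finset.sum_sub_distrib, ← Finset.mul_sum]
  have := frobSq_le_two_mul_sum_edgeDiff_sq X X₀
  nlinarith

/-- Near the truth the log-likelihood ratio is at least a linear term minus a quadratic term. -/
lemma le_rdpgLikelihood (hδ : 0 < δ)
    (hX₀ : ∀ i j, δ ≤ X₀ i ⬝ᵥ X₀ j ∧ X₀ i ⬝ᵥ X₀ j ≤ 1 - δ) {X : Matrix (Fin n) (Fin d) ℝ}
    (hX : ∀ p, |edgeDiff X X₀ p| ≤ δ / 2) :
    rdpgLikelihood Y X₀ *
      Real.exp (∑ p, edgeScore X₀ Y p * edgeDiff X X₀ p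
        - 2 / δ ^ 2 * frobSq (X * Xᵀ - X₀ * X₀ᵀ)) ≤ rdpgLikelihood Y X := by
  have h1 : rdpgLikelihood Y X₀ *
      Real.exp (∑ p, (edgeScore X₀ Y p * edgeDiff X X₀ p - 2 / δ ^ 2 * edgeDiff X X₀ p ^ 2))
      ≤ rdpgLikelihood Y X := by
    unfold rdpgLikelihood
    rw [Real.exp_sum, ← Finset.prod_mul_distrib]
    refine Finset.prod_le_prod (fun p _ => ?_) fun p _ => ?_
    · have := hX₀ p.1.1 p.1.2
      refine mul_nonneg ?_ (Real.exp_nonneg _)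
      split_ifs <;> linarith
    · have hx := hX p
      have hq := hX₀ p.1.1 p.1.2
      unfold edgeDiff at hx
      unfold edgeScore edgeDiff
      set x := X p.1.1 ⬝ᵥ X p.1.2
      set q := X₀ p.1.1 ⬝ᵥ X₀ p.1.2
      have hq0 : q ≠ 0 := by linarith
      have hq1 : 1 - q ≠ 0 := by linarith
      split_ifs
      · refine le_trans (le_of_eq ?_) (mul_exp_sub_sq_le hδ hq.1 hx)
        congr 3; field_simp
      · refine le_trans (le_of_eq ?_) (mul_exp_sub_sq_le (q := 1 - q) (x := 1 - x) hδ
          (by linarith) (by rw [← abs_neg]; convert hx using 2; ring))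
        congr 2; field_simp; ring
  refine le_trans (mul_le_mul_of_nonneg_left (Real.exp_le_exp.mpr ?_)
    (rdpgLikelihood_pos hδ hX₀).le) h1
  rw [Finset.sum_sub_distrib, ← Finset.mul_sum]
  have := sum_edgeDiff_sq_le X X₀
  gcongr

lemma abs_sum_score_mul_le (hS : ScoreBound S X₀ Y) (hS0 : 0 ≤ S)
    (A B : Matrix (Fin n) (Fin d) ℝ) :
    |∑ p : UpperPair n, edgeScore X₀ Y p * (A p.1.1 ⬝ᵥ B p.1.2)|
      ≤ S * √(n : ℝ) * (√(frobSq A) * √(frobSq B)) := by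
  have h1 : ∑ p : UpperPair n, edgeScore X₀ Y p * (A p.1.1 ⬝ᵥ B p.1.2)
      = ∑ k, ∑ p : UpperPair n, edgeScore X₀ Y p * (Aᵀ k p.1.1 * Bᵀ k p.1.2) := by
    rw [Finset.sum_comm]
    simp only [dotProduct, Finset.mul_sum, Matrix.transpose_apply]
  rw [h1]
  calc _ ≤ ∑ k, |∑ p : UpperPair n, edgeScore X₀ Y p * (Aᵀ k p.1.1 * Bᵀ k p.1.2)| :=
        Finset.abs_sum_le_sum_abs _ _
    _ ≤ ∑ k, S * √(n : ℝ) * (√(Aᵀ k ⬝ᵥ Aᵀ k) * √(Bᵀ k ⬝ᵥ Bᵀ k)) :=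
        Finset.sum_le_sum fun k _ => hS _ _
    _ = S * √(n : ℝ) * ∑ k, √(Aᵀ k ⬝ᵥ Aᵀ k) * √(Bᵀ k ⬝ᵥ Bᵀ k) := by rw [Finset.mul_sum]
    _ ≤ S * √(n : ℝ) * (√(∑ k, Aᵀ k ⬝ᵥ Aᵀ k) * √(∑ k, Bᵀ k ⬝ᵥ Bᵀ k)) := by
        gcongr
        exact Real.sum_sqrt_mul_sqrt_le _ (fun _ => dotProduct_self_nonneg _)
          fun _ => dotProduct_self_nonneg _
    _ = _ := by rw [← frobSq_eq_sum_dotProduct, ← frobSq_eq_sum_dotProduct, frobSq_transpose,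
          frobSq_transpose]

/-- The linear term of the log-likelihood ratio is controlled by the distance of `X` to any
matrix `V` with the same Gram matrix as `X₀`: the difference of Gram matrices is
`V Eᵀ + E Vᵀ + E Eᵀ` with `E = X - V`. -/
lemma abs_sum_score_mul_edgeDiff_le (hS : ScoreBound S X₀ Y) (hS0 : 0 ≤ S)
    {X V : Matrix (Fin n) (Fin d) ℝ} (hV : V * Vᵀ = X₀ * X₀ᵀ) (hXn : frobSq X ≤ n)
    (hVn : frobSq V ≤ n) :
    |∑ p, edgeScore X₀ Y p * edgeDiff X X₀ p| ≤ 4 * S * n * √(frobSq (X - V)) := by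
  set E := X - V with hE
  have hXE : X = V + E := by rw [hE]; abel
  have hd : ∀ p : UpperPair n, edgeDiff X X₀ p = V p.1.1 ⬝ᵥ E p.1.2 + E p.1.1 ⬝ᵥ V p.1.2
      + E p.1.1 ⬝ᵥ E p.1.2 := by
    intro p
    have : X₀ p.1.1 ⬝ᵥ X₀ p.1.2 = V p.1.1 ⬝ᵥ V p.1.2 := by
      rw [← mul_transpose_apply_eq, ← mul_transpose_apply_eq, hV]
    have hr : ∀ i, X i = V i + E i := fun i => congrFun hXE i
    rw [edgeDiff, this, hr, hr, add_dotProduct, dotProduct_add, dotProduct_add]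
    ring
  simp only [hd, mul_add, Finset.sum_add_distrib]
  have b1 := abs_sum_score_mul_le hS hS0 V E
  have b2 := abs_sum_score_mul_le hS hS0 E V
  have b3 := abs_sum_score_mul_le hS hS0 E E
  have hEn : frobSq E ≤ (2 * √(n : ℝ)) ^ 2 := by
    have h := frobSq_add_le X (-V)
    rw [frobSq_neg, ← sub_eq_add_neg] at h
    rw [mul_pow, Real.sq_sqrt (Nat.cast_nonneg _)]
    linarith
  have hEs : √(frobSq E) ≤ 2 * √(n : ℝ) := Real.sqrt_le_iff.mpr ⟨by positivity, hEn⟩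
  have hVs : √(frobSq V) ≤ √(n : ℝ) := Real.sqrt_le_sqrt hVn
  have hnn : √(n : ℝ) * √(n : ℝ) = n := Real.mul_self_sqrt (Nat.cast_nonneg _)
  have c1 : S * √(n : ℝ) * (√(frobSq V) * √(frobSq E)) ≤ S * n * √(frobSq E) := by
    calc _ ≤ S * √(n : ℝ) * (√(n : ℝ) * √(frobSq E)) := by gcongr
      _ = S * (√(n : ℝ) * √(n : ℝ)) * √(frobSq E) := by ring
      _ = _ := by rw [hnn]
  have c3 : S * √(n : ℝ) * (√(frobSq E) * √(frobSq E)) ≤ 2 * S * n * √(frobSq E) := by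
    calc _ ≤ S * √(n : ℝ) * (2 * √(n : ℝ) * √(frobSq E)) := by gcongr
      _ = 2 * S * (√(n : ℝ) * √(n : ℝ)) * √(frobSq E) := by ring
      _ = _ := by rw [hnn]
  rw [mul_comm √(frobSq E) √(frobSq V)] at b2
  refine (abs_add_le _ _).trans ?_
  linarith [abs_add_le (∑ p : UpperPair n, edgeScore X₀ Y p * (V p.1.1 ⬝ᵥ E p.1.2))
    (∑ p : UpperPair n, edgeScore X₀ Y p * (E p.1.1 ⬝ᵥ V p.1.2))]

/-- Away from the truth the likelihood decays like a Gaussian in the distance to some rotation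
of the truth. -/
lemma exists_orthogonal_rdpgLikelihood_le (hδ : 0 < δ) (hκ : 0 < κ)
    (hX₀ : ∀ i j, δ ≤ X₀ i ⬝ᵥ X₀ j ∧ X₀ i ⬝ᵥ X₀ j ≤ 1 - δ) (hX₀n : frobSq X₀ ≤ n)
    (hgram : ∀ v, κ * n * (v ⬝ᵥ v) ≤ v ⬝ᵥ ((X₀ᵀ * X₀) *ᵥ v))
    (hS : ScoreBound S X₀ Y) (hS0 : 0 ≤ S) {X : Matrix (Fin n) (Fin d) ℝ}
    (hX : ∀ i, X i ∈ latentSpace d) {m : ℝ}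
    (hfar : m ^ 2 * n ≤ frobSq (X * Xᵀ - X₀ * X₀ᵀ)) :
    ∃ W ∈ Matrix.orthogonalGroup (Fin d) ℝ, rdpgLikelihood Y X ≤ rdpgLikelihood Y X₀ *
      Real.exp (n * (80 * S ^ 2 / (δ * κ) - δ / 32 * m ^ 2)
        - δ * κ / 40 * n * frobSq (X - X₀ * W)) := by
  obtain ⟨W, hW, hproc⟩ := exists_orthogonal_frobSq_sub_le X X₀ hgram
  refine ⟨W, hW, (rdpgLikelihood_le hδ hX₀ hX).trans ?_⟩
  have hWW : W * Wᵀ = 1 := (Matrix.mem_orthogonalGroup_iff _ _).mp hW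
  have hV : X₀ * W * (X₀ * W)ᵀ = X₀ * X₀ᵀ := by
    rw [Matrix.transpose_mul, ← Matrix.mul_assoc, Matrix.mul_assoc X₀, hWW, Matrix.mul_one]
  have hlin := abs_sum_score_mul_edgeDiff_le hS hS0 hV (frobSq_le_of_mem_latentSpace hX)
    (by rw [frobSq_mul_of_mul_transpose _ hWW]; exact hX₀n)
  refine mul_le_mul_of_nonneg_left (Real.exp_le_exp.mpr ?_) (rdpgLikelihood_pos hδ hX₀).le
  set e2 := frobSq (X - X₀ * W)
  set r2 := frobSq (X * Xᵀ - X₀ * X₀ᵀ)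
  have he2 : √e2 ^ 2 = e2 := Real.sq_sqrt (frobSq_nonneg _)
  set e := √e2
  have hn : (0 : ℝ) ≤ n := Nat.cast_nonneg n
  -- the linear term is absorbed by half of the quadratic one
  have hamgm : 4 * S * e ≤ δ * κ / 20 * e2 + 80 * S ^ 2 / (δ * κ) := by
    rw [← he2, ← sub_nonneg]
    have : δ * κ / 20 * e ^ 2 + 80 * S ^ 2 / (δ * κ) - 4 * S * e
        = (δ * κ / 20) * (e - 40 * S / (δ * κ)) ^ 2 := by field_simp; ring
    rw [this]; positivity
  have hlin' := (abs_le.mp hlin).2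
  have h4 : 4 * S * n * e ≤ δ * κ / 20 * n * e2 + n * (80 * S ^ 2 / (δ * κ)) := by
    calc 4 * S * n * e = n * (4 * S * e) := by ring
      _ ≤ n * (δ * κ / 20 * e2 + 80 * S ^ 2 / (δ * κ)) := by gcongr
      _ = _ := by ring
  have h5 : δ * κ / 20 * n * e2 ≤ δ / 16 * r2 := by
    calc δ * κ / 20 * n * e2 = δ / 16 * (4 / 5 * (κ * n) * e2) := by ring
      _ ≤ _ := by gcongr
  have h6 : δ * (m ^ 2 * n) ≤ δ * r2 := by gcongr
  linarith

/-- In a neighbourhood of `X₀` with rows at distance of order `1 / √n`, the likelihood loses at most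
a factor exponential in `n`. -/
lemma le_rdpgLikelihood_of_near (hδ : 0 < δ) (hn : 0 < n) (hnδ : 8 / δ ≤ √(n : ℝ))
    (hX₀ : ∀ i j, δ ≤ X₀ i ⬝ᵥ X₀ j ∧ X₀ i ⬝ᵥ X₀ j ≤ 1 - δ) (hX₀l : ∀ i, X₀ i ∈ latentSpace d)
    (hS : ScoreBound S X₀ Y) (hS0 : 0 ≤ S) {X : Matrix (Fin n) (Fin d) ℝ}
    (hX : ∀ i, X i ∈ latentSpace d) (hnear : ∀ i, (X i - X₀ i) ⬝ᵥ (X i - X₀ i) ≤ 4 / n) :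
    rdpgLikelihood Y X₀ * Real.exp (-(n * (8 * S + 32 / δ ^ 2))) ≤ rdpgLikelihood Y X := by
  have hn' : (0 : ℝ) < n := by exact_mod_cast hn
  have hsn : 0 < √(n : ℝ) := Real.sqrt_pos.mpr hn'
  have hnear' : ∀ i, (X i - X₀ i) ⬝ᵥ (X i - X₀ i) ≤ (2 / √(n : ℝ)) ^ 2 := fun i => by
    rw [div_pow, Real.sq_sqrt hn'.le]; convert hnear i using 2; norm_num
  have hentry : ∀ i j, |X i ⬝ᵥ X j - X₀ i ⬝ᵥ X₀ j| ≤ 4 / √(n : ℝ) := by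
    intro i j
    have h1 := abs_dotProduct_le (by positivity) zero_le_one (hnear' i)
      (by simpa using (hX j).2)
    have h2 := abs_dotProduct_le zero_le_one (by positivity) (by simpa using (hX₀l i).2)
      (hnear' j)
    have h3 : X i ⬝ᵥ X j - X₀ i ⬝ᵥ X₀ j = (X i - X₀ i) ⬝ᵥ X j + X₀ i ⬝ᵥ (X j - X₀ j) := by
      rw [sub_dotProduct, dotProduct_sub]; ring
    rw [h3]
    refine (abs_add_le _ _).trans ((add_le_add h1 h2).trans (le_of_eq ?_))
    ring
  have hr : frobSq (X * Xᵀ - X₀ * X₀ᵀ) ≤ 16 * n := by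
    have hij : ∀ i j, (X * Xᵀ - X₀ * X₀ᵀ) i j ^ 2 ≤ 16 / n := fun i j => by
      have := pow_le_pow_left₀ (abs_nonneg _) (hentry i j) 2
      rw [sq_abs, div_pow, Real.sq_sqrt hn'.le] at this
      rw [Matrix.sub_apply, mul_transpose_apply_eq, mul_transpose_apply_eq]
      norm_num at this ⊢
      exact this
    calc frobSq (X * Xᵀ - X₀ * X₀ᵀ) ≤ ∑ _i : Fin n, ∑ _j : Fin n, (16 / n : ℝ) :=
          Finset.sum_le_sum fun i _ => Finset.sum_le_sum fun j _ => hij i j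
      _ = 16 * n := by simp; field_simp
  have hE : √(frobSq (X - X₀)) ≤ 2 := by
    rw [Real.sqrt_le_iff]
    refine ⟨by norm_num, ?_⟩
    rw [frobSq_eq_sum_dotProduct]
    calc _ ≤ ∑ _i : Fin n, (4 / n : ℝ) := Finset.sum_le_sum fun i _ => hnear i
      _ = 2 ^ 2 := by simp; field_simp; norm_num
  have hlin := abs_sum_score_mul_edgeDiff_le hS hS0 (V := X₀) rfl
    (frobSq_le_of_mem_latentSpace hX) (frobSq_le_of_mem_latentSpace hX₀l)
  have hhalf : 4 / √(n : ℝ) ≤ δ / 2 := by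
    rw [div_le_iff₀ hδ] at hnδ
    rw [div_le_div_iff₀ hsn two_pos]; linarith
  refine le_trans (mul_le_mul_of_nonneg_left (Real.exp_le_exp.mpr ?_)
    (rdpgLikelihood_pos hδ hX₀).le)
    (le_rdpgLikelihood hδ hX₀ fun p => (hentry p.1.1 p.1.2).trans hhalf)
  have h1 := (abs_le.mp hlin).1
  have h2 : 4 * S * n * √(frobSq (X - X₀)) ≤ 4 * S * n * 2 := by gcongr
  have h3 : 2 / δ ^ 2 * frobSq (X * Xᵀ - X₀ * X₀ᵀ) ≤ 2 / δ ^ 2 * (16 * n) := by gcongr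
  have h4 : (n : ℝ) * (8 * S + 32 / δ ^ 2) = 4 * S * n * 2 + 2 / δ ^ 2 * (16 * n) := by ring
  linarith

end

/-! ### The prior: Gaussian integrals and small balls -/

lemma measurableSet_latentSpace (d : ℕ) : MeasurableSet (latentSpace d) := by
  have h : IsClosed (latentSpace d) := by
    have : latentSpace d = (⋂ k, {x | 0 ≤ x k}) ∩ {x | x ⬝ᵥ x ≤ 1} := by
      ext x; simp [latentSpace]
    rw [this]
    refine (isClosed_iInter fun k => isClosed_le continuous_const (continuous_apply k)).inter
      (isClosed_le ?_ continuous_const)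
    unfold dotProduct
    fun_prop
  exact h.measurableSet

section

variable {d n : ℕ} {π : (Fin d → ℝ) → ℝ}

lemma rowPrior_apply (s : Set (Fin d → ℝ)) :
    rowPrior π s = ∫⁻ x in s, ENNReal.ofReal (π x) ∂(volume.restrict (latentSpace d)) :=
  withDensity_apply' _ _

lemma isProbabilityMeasure_rowPrior (hπ : IsPriorDensity π) :
    IsProbabilityMeasure (rowPrior π) :=
  ⟨by rw [rowPrior_apply, Measure.restrict_univ, hπ.lintegral_eq_one]⟩

lemma isProbabilityMeasure_rdpgPrior (hπ : IsPriorDensity π) (n : ℕ) :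
    IsProbabilityMeasure (rdpgPrior π n) := by
  have := isProbabilityMeasure_rowPrior hπ
  unfold rdpgPrior
  infer_instance

lemma ae_rowPrior_mem_latentSpace : ∀ᵐ x ∂(rowPrior π), x ∈ latentSpace d :=
  (withDensity_absolutelyContinuous _ _).ae_le
    (ae_restrict_mem (measurableSet_latentSpace d))

lemma ae_rdpgPrior_mem_latentSpace (hπ : IsPriorDensity π) (n : ℕ) :
    ∀ᵐ X ∂(rdpgPrior π n), ∀ i, X i ∈ latentSpace d := by
  have := isProbabilityMeasure_rowPrior hπ
  rw [ae_all_iff]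
  intro i
  exact (measurePreserving_eval (fun _ : Fin n => rowPrior π) i).quasiMeasurePreserving.ae
    ae_rowPrior_mem_latentSpace

lemma lintegral_rowPrior_le {C : ℝ} (hπ : IsPriorDensity π)
    (hC : ∀ x ∈ latentSpace d, π x ≤ C) {f : (Fin d → ℝ) → ENNReal} (hf : Measurable f) :
    ∫⁻ x, f x ∂(rowPrior π) ≤ ENNReal.ofReal C * ∫⁻ x, f x := by
  unfold rowPrior
  rw [lintegral_withDensity_eq_lintegral_mul _ hπ.measurable.ennreal_ofReal hf,
    ← lintegral_const_mul _ hf]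
  refine le_trans ?_ (setLIntegral_le_lintegral (latentSpace d) _)
  refine setLIntegral_mono (hf.const_mul _) fun x hx => ?_
  exact mul_le_mul_left (ENNReal.ofReal_le_ofReal (hC x hx)) _

lemma lintegral_prod_rdpgPrior (hπ : IsPriorDensity π) (f : Fin n → (Fin d → ℝ) → ENNReal)
    (hf : ∀ i, Measurable (f i)) :
    ∫⁻ X, ∏ i, f i (X i) ∂(rdpgPrior π n) = ∏ i, ∫⁻ x, f i x ∂(rowPrior π) := by
  have := isProbabilityMeasure_rowPrior hπ
  unfold rdpgPrior
  refine (lintegral_prod_eq_prod_lintegral_of_indepFun Finset.univ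
    (fun i (X : Fin n → Fin d → ℝ) => f i (X i)) (iIndepFun_pi fun i => (hf i).aemeasurable)
    fun i => (hf i).comp (measurable_pi_apply i)).trans ?_
  refine Finset.prod_congr rfl fun i _ => ?_
  exact (measurePreserving_eval (fun _ : Fin n => rowPrior π) i).lintegral_comp (hf i)

lemma measurable_gaussian (b : ℝ) (m : Fin d → ℝ) :
    Measurable fun x : Fin d → ℝ => ENNReal.ofReal (Real.exp (-b * ((x - m) ⬝ᵥ (x - m)))) := by
  unfold dotProduct
  refine Measurable.ennreal_ofReal (Continuous.measurable ?_)
  fun_prop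

lemma lintegral_gaussian_row {b : ℝ} (hb : 0 < b) (m : Fin d → ℝ) :
    ∫⁻ x : Fin d → ℝ, ENNReal.ofReal (Real.exp (-b * ((x - m) ⬝ᵥ (x - m))))
      = ENNReal.ofReal (√(Real.pi / b) ^ d) := by
  have hprod : ∀ x : Fin d → ℝ, Real.exp (-b * ((x - m) ⬝ᵥ (x - m)))
      = ∏ k, Real.exp (-b * (x k - m k) ^ 2) := by
    intro x
    rw [← Real.exp_sum, ← Finset.mul_sum]
    simp [dotProduct, sq]
  have hint : ∀ k : Fin d, Integrable (fun y : ℝ => Real.exp (-b * (y - m k) ^ 2)) :=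
    fun k => (integrable_exp_neg_mul_sq hb).comp_sub_right (m k)
  simp only [hprod]
  have hint' : Integrable fun x : Fin d → ℝ => ∏ k, Real.exp (-b * (x k - m k) ^ 2) :=
    Integrable.fintype_prod (f := fun k y => Real.exp (-b * (y - m k) ^ 2)) hint
  rw [← ofReal_integral_eq_lintegral_ofReal hint'
      (ae_of_all _ fun x => Finset.prod_nonneg fun _ _ => Real.exp_nonneg _),
    integral_fintype_prod_volume_eq_prod (fun k y => Real.exp (-b * (y - m k) ^ 2))]
  congr 1
  rw [Finset.prod_congr rfl fun k _ => (integral_sub_right_eq_self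
    (fun y : ℝ => Real.exp (-b * y ^ 2)) (m k)).trans (integral_gaussian b)]
  simp

/-- The Gaussian integral against the prior has the order `n^{-nd/2}` when the precision is of
order `n`. -/
lemma lintegral_gaussian_rdpgPrior_le {C b : ℝ} (hπ : IsPriorDensity π) (hC0 : 0 ≤ C)
    (hC : ∀ x ∈ latentSpace d, π x ≤ C) (hb : 0 < b) (V : Matrix (Fin n) (Fin d) ℝ) :
    ∫⁻ X, ENNReal.ofReal (Real.exp (-b * frobSq (Matrix.of X - V))) ∂(rdpgPrior π n)
      ≤ ENNReal.ofReal ((C * √(Real.pi / b) ^ d) ^ n) := by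
  have hprod : ∀ X : Fin n → Fin d → ℝ,
      ENNReal.ofReal (Real.exp (-b * frobSq (Matrix.of X - V)))
        = ∏ i, ENNReal.ofReal (Real.exp (-b * ((X i - V i) ⬝ᵥ (X i - V i)))) := by
    intro X
    rw [← ENNReal.ofReal_prod_of_nonneg fun _ _ => Real.exp_nonneg _, ← Real.exp_sum,
      ← Finset.mul_sum, frobSq_eq_sum_dotProduct]
    rfl
  simp only [hprod]
  rw [lintegral_prod_rdpgPrior hπ (fun i x => ENNReal.ofReal
    (Real.exp (-b * ((x - V i) ⬝ᵥ (x - V i))))) fun i => measurable_gaussian b (V i)]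
  calc _ ≤ ∏ _i : Fin n, ENNReal.ofReal (C * √(Real.pi / b) ^ d) := by
        refine Finset.prod_le_prod' fun i _ => ?_
        rw [ENNReal.ofReal_mul hC0, ← lintegral_gaussian_row hb (V i)]
        exact lintegral_rowPrior_le hπ hC (measurable_gaussian b (V i))
    _ = _ := by rw [Finset.prod_const, Finset.card_univ, Fintype.card_fin,
          ENNReal.ofReal_pow (by positivity)]

/-- A ball of radius `2 ε` around a point of the latent space contains a cube of side `ε / d`
inside the latent space, the image of `[0, 1/d]^d` under a contraction. -/
lemma le_rowPrior_ball {c ε : ℝ} (hd : 0 < d) (hc0 : 0 ≤ c)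
    (hc : ∀ x ∈ latentSpace d, c ≤ π x) (hε0 : 0 ≤ ε) (hε1 : ε ≤ 1) {x₀ : Fin d → ℝ}
    (hx₀ : x₀ ∈ latentSpace d) :
    ENNReal.ofReal (c * (ε / d) ^ d)
      ≤ rowPrior π {x | x ∈ latentSpace d ∧ (x - x₀) ⬝ᵥ (x - x₀) ≤ 4 * ε ^ 2} := by
  have hd' : (0 : ℝ) < d := by exact_mod_cast hd
  set lo : Fin d → ℝ := (1 - ε) • x₀ with hlo
  set hi : Fin d → ℝ := lo + fun _ => ε / d with hhi
  have hbox : Set.Icc lo hi ⊆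
      {x | x ∈ latentSpace d ∧ (x - x₀) ⬝ᵥ (x - x₀) ≤ 4 * ε ^ 2} := by
    intro x hx
    set w := x - lo with hw
    have hw0 : ∀ k, 0 ≤ w k := fun k => by simpa [hw] using hx.1 k
    have hw1 : ∀ k, w k ≤ ε / d := fun k => by
      have := hx.2 k
      simp only [hhi, Pi.add_apply] at this
      simp only [hw, Pi.sub_apply]; linarith
    have hww : w ⬝ᵥ w ≤ ε ^ 2 := by
      calc w ⬝ᵥ w ≤ ∑ _k : Fin d, (ε / d) * (ε / d) :=
            Finset.sum_le_sum fun k _ => mul_le_mul (hw1 k) (hw1 k) (hw0 k) (by positivity)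
        _ = ε ^ 2 / d := by simp; field_simp
        _ ≤ ε ^ 2 := div_le_self (by positivity) (by exact_mod_cast hd)
    have hxw : |x₀ ⬝ᵥ w| ≤ 1 * ε :=
      abs_dotProduct_le zero_le_one hε0 (by simpa using hx₀.2) hww
    have hxw' := abs_le.mp hxw
    have hxe : x = (1 - ε) • x₀ + w := by rw [hw, hlo]; abel
    have hx0n := dotProduct_self_nonneg x₀
    refine ⟨⟨fun k => ?_, ?_⟩, ?_⟩
    · rw [hxe]
      exact add_nonneg (mul_nonneg (by linarith) (hx₀.1 k)) (hw0 k)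
    · rw [hxe]
      simp only [add_dotProduct, dotProduct_add, smul_dotProduct, dotProduct_smul, smul_eq_mul]
      rw [dotProduct_comm w x₀]
      have h1e : 0 ≤ 1 - ε := by linarith
      have h1 : (1 - ε) * ((1 - ε) * (x₀ ⬝ᵥ x₀)) ≤ (1 - ε) * ((1 - ε) * 1) := by
        gcongr
        exact hx₀.2
      have h2 : (1 - ε) * (x₀ ⬝ᵥ w) ≤ (1 - ε) * ε := by
        gcongr
        linarith
      nlinarith
    · have hxe' : x - x₀ = w + (-ε) • x₀ := by rw [hxe]; module
      rw [hxe']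
      simp only [add_dotProduct, dotProduct_add, smul_dotProduct, dotProduct_smul, smul_eq_mul]
      rw [dotProduct_comm w x₀]
      have h1 : ε * ε * (x₀ ⬝ᵥ x₀) ≤ ε * ε * 1 := by gcongr; exact hx₀.2
      have h2 : -(ε * (x₀ ⬝ᵥ w)) ≤ ε * ε := by nlinarith
      nlinarith
  refine le_trans ?_ (measure_mono hbox)
  rw [rowPrior_apply, Measure.restrict_restrict measurableSet_Icc,
    Set.inter_eq_left.mpr fun x hx => (hbox hx).1]
  calc ENNReal.ofReal (c * (ε / d) ^ d)
      = ENNReal.ofReal c * volume (Set.Icc lo hi) := by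
        rw [Real.volume_Icc_pi, ENNReal.ofReal_mul hc0, ENNReal.ofReal_pow (by positivity)]
        simp [hhi]
    _ = ∫⁻ _ in Set.Icc lo hi, ENNReal.ofReal c := by rw [setLIntegral_const]
    _ ≤ _ := setLIntegral_mono' measurableSet_Icc fun x hx =>
        ENNReal.ofReal_le_ofReal (hc x (hbox hx).1)

/-! ### Posterior contraction on the event that the noise is small -/

lemma rdpgPosteriorNumerator_apply (hπ : IsPriorDensity π) (Y : Matrix (Fin n) (Fin n) Bool)
    (s : Set (Fin n → Fin d → ℝ)) : rdpgPosteriorNumerator π Y s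
      = ∫⁻ X in s, ENNReal.ofReal (rdpgLikelihood Y (Matrix.of X)) ∂(rdpgPrior π n) := by
  have := isProbabilityMeasure_rdpgPrior hπ n
  exact withDensity_apply' _ _

/-- A lower bound for the normalizing constant of the posterior. -/
lemma le_rdpgPosteriorNumerator_univ {c C₁ ε : ℝ} (hπ : IsPriorDensity π) (hd : 0 < d)
    (hc0 : 0 ≤ c) (hc : ∀ x ∈ latentSpace d, c ≤ π x) (hε0 : 0 ≤ ε) (hε1 : ε ≤ 1)
    {X₀ : Matrix (Fin n) (Fin d) ℝ} (hX₀ : ∀ i, X₀ i ∈ latentSpace d)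
    {Y : Matrix (Fin n) (Fin n) Bool} (hC₁ : 0 ≤ C₁)
    (hlik : ∀ X : Matrix (Fin n) (Fin d) ℝ, (∀ i, X i ∈ latentSpace d) →
      (∀ i, (X i - X₀ i) ⬝ᵥ (X i - X₀ i) ≤ 4 * ε ^ 2) → C₁ ≤ rdpgLikelihood Y X) :
    ENNReal.ofReal (C₁ * (c * (ε / d) ^ d) ^ n) ≤ rdpgPosteriorNumerator π Y Set.univ := by
  have := isProbabilityMeasure_rowPrior hπ
  set B : Fin n → Set (Fin d → ℝ) := fun i =>
    {x | x ∈ latentSpace d ∧ (x - X₀ i) ⬝ᵥ (x - X₀ i) ≤ 4 * ε ^ 2} with hB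
  have hBm : ∀ i, MeasurableSet (B i) := fun i => by
    refine (measurableSet_latentSpace d).inter (IsClosed.measurableSet ?_)
    have hcont : Continuous fun x : Fin d → ℝ => (x - X₀ i) ⬝ᵥ (x - X₀ i) := by
      unfold dotProduct
      fun_prop
    exact isClosed_le hcont continuous_const
  calc ENNReal.ofReal (C₁ * (c * (ε / d) ^ d) ^ n)
      = ENNReal.ofReal C₁ * ∏ _i : Fin n, ENNReal.ofReal (c * (ε / d) ^ d) := by
        rw [ENNReal.ofReal_mul hC₁, ENNReal.ofReal_pow (by positivity), Finset.prod_const,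
          Finset.card_univ, Fintype.card_fin]
    _ ≤ ENNReal.ofReal C₁ * ∏ i : Fin n, rowPrior π (B i) := by
        gcongr with i
        exact le_rowPrior_ball hd hc0 hc hε0 hε1 (hX₀ i)
    _ = ENNReal.ofReal C₁ * rdpgPrior π n (Set.univ.pi B) := by
        rw [rdpgPrior, Measure.pi_pi]
    _ = ∫⁻ _ in Set.univ.pi B, ENNReal.ofReal C₁ ∂(rdpgPrior π n) := by
        rw [setLIntegral_const]
    _ ≤ ∫⁻ X in Set.univ.pi B, ENNReal.ofReal (rdpgLikelihood Y (Matrix.of X))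
          ∂(rdpgPrior π n) := by
        refine setLIntegral_mono' (MeasurableSet.univ_pi hBm) fun X hX => ?_
        refine ENNReal.ofReal_le_ofReal (hlik _ (fun i => ?_) fun i => ?_)
        · exact (hX i (Set.mem_univ i)).1
        · exact (hX i (Set.mem_univ i)).2
    _ = rdpgPosteriorNumerator π Y (Set.univ.pi B) := (rdpgPosteriorNumerator_apply hπ Y _).symm
    _ ≤ _ := measure_mono (Set.subset_univ _)

/-- The matrix with entries `k / n`, `k` an integer between `-n` and `n`. -/
noncomputable def gridMatrix (n : ℕ) (g : Fin d → Fin d → Fin (2 * n + 1)) :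
    Matrix (Fin d) (Fin d) ℝ :=
  Matrix.of fun i j => ((g i j : ℕ) - n : ℝ) / n

lemma exists_gridMatrix_near (hn : 0 < n) {W : Matrix (Fin d) (Fin d) ℝ}
    (hW : W ∈ Matrix.orthogonalGroup (Fin d) ℝ) :
    ∃ g : Fin d → Fin d → Fin (2 * n + 1), frobSq (W - gridMatrix n g) ≤ d ^ 2 / n ^ 2 := by
  have hn' : (0 : ℝ) < n := by exact_mod_cast hn
  have hentry : ∀ i j, ∃ k : Fin (2 * n + 1), (W i j - ((k : ℕ) - n : ℝ) / n) ^ 2 ≤ 1 / n ^ 2 := by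
    intro i j
    have h := entry_norm_bound_of_unitary hW i j
    rw [Real.norm_eq_abs, abs_le] at h
    have h0 : 0 ≤ (W i j + 1) * n := mul_nonneg (by linarith) hn'.le
    have hfl := Nat.floor_le h0
    have hlt := Nat.lt_floor_add_one ((W i j + 1) * n)
    have hle : ⌊(W i j + 1) * n⌋₊ < 2 * n + 1 := by
      rw [Nat.lt_succ_iff]
      refine Nat.floor_le_of_le ?_
      push_cast
      exact mul_le_mul_of_nonneg_right (by linarith) hn'.le
    refine ⟨⟨_, hle⟩, ?_⟩
    have e : W i j - ((⌊(W i j + 1) * n⌋₊ : ℝ) - n) / n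
        = ((W i j + 1) * n - ⌊(W i j + 1) * n⌋₊) / n := by field_simp; ring
    simp only
    rw [e, div_pow]
    gcongr
    rw [sq_le_one_iff₀ (by linarith)]
    linarith
  choose g hg using hentry
  refine ⟨g, ?_⟩
  calc frobSq (W - gridMatrix n g) ≤ ∑ _i : Fin d, ∑ _j : Fin d, (1 / n ^ 2 : ℝ) :=
        Finset.sum_le_sum fun i _ => Finset.sum_le_sum fun j _ => hg i j
    _ = d ^ 2 / n ^ 2 := by simp; ring

/-- A set on which the likelihood has a Gaussian bound centred at a rotation of `X₀` has small
mass: the rotation is approximated by one of polynomially many grid matrices. -/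
lemma rdpgPosteriorNumerator_le {C C₂ a : ℝ} (hπ : IsPriorDensity π) (hn : 0 < n)
    (hdn : d ^ 2 ≤ n) (hC0 : 0 ≤ C) (hC : ∀ x ∈ latentSpace d, π x ≤ C) (ha : 0 < a)
    {X₀ : Matrix (Fin n) (Fin d) ℝ} (hX₀n : frobSq X₀ ≤ n)
    {Y : Matrix (Fin n) (Fin n) Bool} (hC₂ : 0 ≤ C₂) (s : Set (Fin n → Fin d → ℝ))
    (hlik : ∀ X ∈ s, (∀ i, X i ∈ latentSpace d) → ∃ W ∈ Matrix.orthogonalGroup (Fin d) ℝ,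
      rdpgLikelihood Y (Matrix.of X)
        ≤ C₂ * Real.exp (-(2 * a * n) * frobSq (Matrix.of X - X₀ * W))) :
    rdpgPosteriorNumerator π Y s ≤ ENNReal.ofReal ((2 * n + 1) ^ (d * d) *
      (C₂ * Real.exp (2 * a * n) * (C * √(Real.pi / (a * n)) ^ d) ^ n)) := by
  have hn' : (0 : ℝ) < n := by exact_mod_cast hn
  set F : (Fin d → Fin d → Fin (2 * n + 1)) → (Fin n → Fin d → ℝ) → ENNReal := fun g X =>
    ENNReal.ofReal (C₂ * Real.exp (2 * a * n)) *
      ENNReal.ofReal (Real.exp (-(a * n) * frobSq (Matrix.of X - X₀ * gridMatrix n g))) with hF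
  have hFm : ∀ V : Matrix (Fin n) (Fin d) ℝ, Measurable fun X : Fin n → Fin d → ℝ =>
      ENNReal.ofReal (Real.exp (-(a * n) * frobSq (Matrix.of X - V))) := by
    intro V
    refine Measurable.ennreal_ofReal (Continuous.measurable ?_)
    simp only [frobSq, Matrix.sub_apply, Matrix.of_apply]
    fun_prop
  have hbound : ∀ X ∈ s, (∀ i, X i ∈ latentSpace d) →
      ENNReal.ofReal (rdpgLikelihood Y (Matrix.of X)) ≤ ∑ g, F g X := by
    intro X hX hXl
    obtain ⟨W, hW, hle⟩ := hlik X hX hXl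
    obtain ⟨g, hg⟩ := exists_gridMatrix_near hn hW
    refine le_trans ?_ (Finset.single_le_sum (fun _ _ => zero_le) (Finset.mem_univ g))
    simp only [hF]
    rw [← ENNReal.ofReal_mul (by positivity), mul_assoc, ← Real.exp_add]
    refine ENNReal.ofReal_le_ofReal (hle.trans ?_)
    refine mul_le_mul_of_nonneg_left (Real.exp_le_exp.mpr ?_) hC₂
    have h1 : frobSq (Matrix.of X - X₀ * gridMatrix n g)
        ≤ 2 * frobSq (Matrix.of X - X₀ * W) + 2 * frobSq (X₀ * (W - gridMatrix n g)) := by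
      have : Matrix.of X - X₀ * gridMatrix n g
          = (Matrix.of X - X₀ * W) + X₀ * (W - gridMatrix n g) := by
        rw [Matrix.mul_sub]; abel
      rw [this]; exact frobSq_add_le _ _
    have h2 : frobSq (X₀ * (W - gridMatrix n g)) ≤ 1 := by
      calc _ ≤ frobSq X₀ * frobSq (W - gridMatrix n g) := frobSq_mul_le _ _
        _ ≤ n * (d ^ 2 / n ^ 2) := mul_le_mul hX₀n hg (frobSq_nonneg _) hn'.le
        _ = d ^ 2 / n := by field_simp
        _ ≤ 1 := by rw [div_le_one hn']; exact_mod_cast hdn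
    have h3 : a * n * frobSq (Matrix.of X - X₀ * gridMatrix n g)
        ≤ a * n * (2 * frobSq (Matrix.of X - X₀ * W) + 2 * 1) := by
      gcongr; linarith
    linarith
  rw [rdpgPosteriorNumerator_apply hπ]
  have hae := ae_rdpgPrior_mem_latentSpace hπ n
  calc ∫⁻ X in s, ENNReal.ofReal (rdpgLikelihood Y (Matrix.of X)) ∂(rdpgPrior π n)
      ≤ ∫⁻ X in s, ∑ g, F g X ∂(rdpgPrior π n) := by
        refine setLIntegral_mono_ae ?_ ?_
        · exact (Finset.measurable_sum _ fun g _ => (hFm _).const_mul _).aemeasurable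
        · filter_upwards [hae] with X hX hXs using hbound X hXs hX
    _ ≤ ∫⁻ X, ∑ g, F g X ∂(rdpgPrior π n) := setLIntegral_le_lintegral _ _
    _ = ∑ g, ∫⁻ X, F g X ∂(rdpgPrior π n) :=
        lintegral_finsetSum _ fun g _ => (hFm _).const_mul _
    _ ≤ ∑ _g : Fin d → Fin d → Fin (2 * n + 1), ENNReal.ofReal
          (C₂ * Real.exp (2 * a * n) * (C * √(Real.pi / (a * n)) ^ d) ^ n) := by
        refine Finset.sum_le_sum fun g _ => ?_
        rw [hF, lintegral_const_mul _ (hFm _),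
          ENNReal.ofReal_mul (p := C₂ * Real.exp (2 * a * n)) (by positivity)]
        gcongr
        exact lintegral_gaussian_rdpgPrior_le hπ hC0 hC (by positivity) _
    _ = _ := by
        rw [Finset.sum_const, nsmul_eq_mul, ← ENNReal.ofReal_natCast,
          ← ENNReal.ofReal_mul (Nat.cast_nonneg _)]
        congr 2
        simp [← pow_mul]

end

section

variable {d n : ℕ} {π : (Fin d → ℝ) → ℝ}

lemma rdpgPosterior_apply (Y : Matrix (Fin n) (Fin n) Bool) (s : Set (Fin n → Fin d → ℝ)) :
    rdpgPosterior π Y s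
      = (rdpgPosteriorNumerator π Y Set.univ)⁻¹ * rdpgPosteriorNumerator π Y s := by
  rw [rdpgPosterior, Measure.smul_apply, smul_eq_mul]

lemma rdpgPosterior_le_one (Y : Matrix (Fin n) (Fin n) Bool) (s : Set (Fin n → Fin d → ℝ)) :
    rdpgPosterior π Y s ≤ 1 := by
  rw [rdpgPosterior_apply]
  exact (mul_le_mul_right (measure_mono (Set.subset_univ s)) _).trans (ENNReal.inv_mul_le_one _)

lemma rdpgLikelihood_le_one {X : Matrix (Fin n) (Fin d) ℝ} (hX : ∀ i, X i ∈ latentSpace d)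
    (Y : Matrix (Fin n) (Fin n) Bool) : rdpgLikelihood Y X ≤ 1 := by
  refine Finset.prod_le_one (fun p _ => ?_) fun p _ => ?_ <;>
  · have := dotProduct_mem_Icc_of_mem_latentSpace (hX p.1.1) (hX p.1.2)
    split_ifs <;> linarith

lemma rdpgPosteriorNumerator_univ_ne_top (hπ : IsPriorDensity π)
    (Y : Matrix (Fin n) (Fin n) Bool) : rdpgPosteriorNumerator π Y Set.univ ≠ ⊤ := by
  have := isProbabilityMeasure_rdpgPrior hπ n
  rw [rdpgPosteriorNumerator_apply hπ, Measure.restrict_univ]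
  refine ne_top_of_le_ne_top ENNReal.one_ne_top ?_
  calc _ ≤ ∫⁻ _, 1 ∂(rdpgPrior π n) := by
        refine lintegral_mono_ae ?_
        filter_upwards [ae_rdpgPrior_mem_latentSpace hπ n] with X hX
        rw [← ENNReal.ofReal_one]
        exact ENNReal.ofReal_le_ofReal (rdpgLikelihood_le_one (X := Matrix.of X) hX Y)
    _ = 1 := by simp

lemma rdpgPosterior_absolutelyContinuous (Y : Matrix (Fin n) (Fin n) Bool) :
    rdpgPosterior π Y ≪ rdpgPrior π n :=
  (Measure.AbsolutelyContinuous.rfl.smul_left _).trans (withDensity_absolutelyContinuous _ _)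

lemma eventually_pow_le_exp (k : ℕ) : ∀ᶠ n : ℕ in atTop, (2 * n + 1 : ℝ) ^ k ≤ Real.exp n := by
  have h := (Real.tendsto_pow_mul_exp_neg_atTop_nhds_zero k).comp tendsto_natCast_atTop_atTop
  have h2 := h.eventually_le_const (show (0 : ℝ) < (3 ^ k)⁻¹ by positivity)
  filter_upwards [h2, eventually_ge_atTop 1] with n hn hn1
  have hn1' : (1 : ℝ) ≤ n := by exact_mod_cast hn1
  simp only [Function.comp_apply] at hn
  rw [Real.exp_neg, ← div_eq_mul_inv, div_le_iff₀ (Real.exp_pos _)] at hn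
  calc (2 * n + 1 : ℝ) ^ k ≤ (3 * n) ^ k := by gcongr; linarith
    _ = 3 ^ k * (n : ℝ) ^ k := mul_pow _ _ _
    _ ≤ 3 ^ k * ((3 ^ k)⁻¹ * Real.exp n) := by gcongr
    _ = Real.exp n := by field_simp

/-- Posterior contraction holds deterministically on the event that the noise is small. The powers
of `n` in the prior mass of a neighbourhood of the truth and in the Gaussian integral of the
likelihood cancel, so that there is no logarithmic loss. -/
lemma exists_contraction_constant (hd : 0 < d) (hπ : IsPriorDensity π) {δ κ S : ℝ} (hδ : 0 < δ)
    (hκ : 0 < κ) (hS0 : 0 ≤ S) :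
    ∃ m : ℝ, 0 < m ∧ ∀ᶠ n : ℕ in atTop, ∀ (X₀ : Matrix (Fin n) (Fin d) ℝ)
      (Y : Matrix (Fin n) (Fin n) Bool), (∀ i, X₀ i ∈ latentSpace d) →
      (∀ i j, δ ≤ X₀ i ⬝ᵥ X₀ j ∧ X₀ i ⬝ᵥ X₀ j ≤ 1 - δ) →
      (∀ v, κ * n * (v ⬝ᵥ v) ≤ v ⬝ᵥ ((X₀ᵀ * X₀) *ᵥ v)) →
      ScoreBound S X₀ Y →
      rdpgPosteriorNumerator π Y Set.univ ≠ 0 ∧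
      rdpgPosterior π Y {X | m ^ 2 * n < frobSq (Matrix.of X * (Matrix.of X)ᵀ - X₀ * X₀ᵀ)}
        ≤ ENNReal.ofReal (Real.exp (-(n * d : ℝ))) := by
  obtain ⟨c, C, hc0, hcC⟩ := hπ.bounded
  have hd' : (0 : ℝ) < d := by exact_mod_cast hd
  have hC0 : 0 < C := by
    have h0 : (0 : Fin d → ℝ) ∈ latentSpace d := ⟨fun _ => le_rfl, by simp⟩
    linarith [(hcC 0 h0).1, (hcC 0 h0).2]
  set a : ℝ := δ * κ / 80 with ha
  have ha0 : 0 < a := by positivity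
  set C₁ : ℝ := 8 * S + 32 / δ ^ 2 with hC₁
  have hC₁0 : 0 ≤ C₁ := by positivity
  set B : ℝ := C * √(Real.pi / a) ^ d * d ^ d / c with hB
  have hB0 : 0 < B := by
    have := Real.pi_pos
    positivity
  -- the exponential rates to be beaten: the linear term, the number of grid points, the rounding to
  -- the grid, the ratio of the bounds for the integrals, the lower bound for the likelihood near
  -- the truth, and the rate of the conclusion
  set T : ℝ := 80 * S ^ 2 / (δ * κ) + 1 + 2 * a + |Real.log B| + C₁ + d with hT
  have hT0 : 0 < T := by positivity
  refine ⟨√(32 / δ * T), by positivity, ?_⟩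
  have hm : √(32 / δ * T) ^ 2 = 32 / δ * T := Real.sq_sqrt (by positivity)
  set m := √(32 / δ * T)
  have hsqrt : ∀ᶠ n : ℕ in atTop, 8 / δ ≤ √(n : ℝ) :=
    (Real.tendsto_sqrt_atTop.comp tendsto_natCast_atTop_atTop).eventually_ge_atTop _
  filter_upwards [eventually_pow_le_exp (d * d), eventually_ge_atTop 1, hsqrt,
    eventually_ge_atTop (d ^ 2)] with n hpow hn1 hns hdn X₀ Y hX₀ hX₀δ hgram hS
  have hn : 0 < n := hn1
  have hn' : (0 : ℝ) < n := by exact_mod_cast hn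
  have hsn : 0 < √(n : ℝ) := Real.sqrt_pos.mpr hn'
  set ε : ℝ := 1 / √(n : ℝ) with hε
  have hε0 : 0 < ε := by positivity
  have hε1 : ε ≤ 1 := by
    rw [hε, div_le_one hsn, Real.one_le_sqrt]
    exact_mod_cast hn1
  have hεsq : 4 * ε ^ 2 = 4 / n := by
    rw [hε, div_pow, Real.sq_sqrt hn'.le]; ring
  have hX₀n := frobSq_le_of_mem_latentSpace hX₀
  set l₀ := rdpgLikelihood Y X₀ with hl₀
  have hl₀0 : 0 < l₀ := rdpgLikelihood_pos hδ hX₀δ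
  set D : ℝ := l₀ * Real.exp (-(n * C₁)) * (c * (ε / d) ^ d) ^ n with hD
  have hD0 : 0 < D := by positivity
  have hden : ENNReal.ofReal D ≤ rdpgPosteriorNumerator π Y Set.univ := by
    refine le_rdpgPosteriorNumerator_univ hπ hd hc0.le (fun x hx => (hcC x hx).1) hε0.le hε1 hX₀
      (by positivity) fun X hX hXn => ?_
    exact le_rdpgLikelihood_of_near hδ hn hns hX₀δ hX₀ hS hS0 hX fun i => hεsq ▸ hXn i
  set A := {X : Fin n → Fin d → ℝ |
    m ^ 2 * n < frobSq (Matrix.of X * (Matrix.of X)ᵀ - X₀ * X₀ᵀ)} with hA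
  have hnum := rdpgPosteriorNumerator_le (C₂ := l₀ *
      Real.exp (n * (80 * S ^ 2 / (δ * κ) - δ / 32 * m ^ 2))) hπ hn hdn hC0.le
    (fun x hx => (hcC x hx).2) ha0 hX₀n (Y := Y) (by positivity) A (fun X hX hXl => by
      obtain ⟨W, hW, h⟩ := exists_orthogonal_rdpgLikelihood_le hδ hκ hX₀δ hX₀n hgram hS hS0
        (X := Matrix.of X) hXl (le_of_lt hX)
      refine ⟨W, hW, h.trans (le_of_eq ?_)⟩
      rw [mul_assoc l₀, ← Real.exp_add]
      congr 2
      rw [ha]; ring)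
  have hcancel : C * √(Real.pi / (a * n)) ^ d = B * (c * (ε / d) ^ d) := by
    have h1 : √(Real.pi / (a * n)) = √(Real.pi / a) * ε := by
      rw [← div_div, Real.sqrt_div' _ hn'.le, hε]; ring
    rw [h1, hB, mul_pow, div_pow ε (d : ℝ) d]
    field_simp
  have hBn : B ^ n = Real.exp (n * Real.log B) := by
    rw [Real.exp_nat_mul, Real.exp_log hB0]
  have hfinal : (2 * n + 1 : ℝ) ^ (d * d) * (l₀ *
      Real.exp (n * (80 * S ^ 2 / (δ * κ) - δ / 32 * m ^ 2)) * Real.exp (2 * a * n)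
      * (C * √(Real.pi / (a * n)) ^ d) ^ n) ≤ Real.exp (-(n * d : ℝ)) * D := by
    rw [hcancel, mul_pow B, hBn, hD]
    calc _ ≤ Real.exp n * (l₀ * Real.exp (n * (80 * S ^ 2 / (δ * κ) - δ / 32 * m ^ 2))
          * Real.exp (2 * a * n) * (Real.exp (n * Real.log B) * (c * (ε / d) ^ d) ^ n)) := by
          gcongr
      _ = Real.exp (n + n * (80 * S ^ 2 / (δ * κ) - δ / 32 * m ^ 2) + 2 * a * n
            + n * Real.log B) * (l₀ * (c * (ε / d) ^ d) ^ n) := by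
          rw [Real.exp_add, Real.exp_add, Real.exp_add]; ring
      _ ≤ Real.exp (-(n * d : ℝ) + -(n * C₁)) * (l₀ * (c * (ε / d) ^ d) ^ n) := by
          refine mul_le_mul_of_nonneg_right (Real.exp_le_exp.mpr ?_) (by positivity)
          have h1 : δ / 32 * m ^ 2 = T := by rw [hm]; field_simp
          rw [h1, hT]
          have h2 : (n : ℝ) * Real.log B ≤ n * |Real.log B| := by gcongr; exact le_abs_self _
          linarith
      _ = _ := by rw [Real.exp_add]; ring
  have hden0 : rdpgPosteriorNumerator π Y Set.univ ≠ 0 :=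
    ((ENNReal.ofReal_pos.mpr hD0).trans_le hden).ne'
  refine ⟨hden0, ?_⟩
  rw [rdpgPosterior_apply]
  have hle : rdpgPosteriorNumerator π Y A
      ≤ ENNReal.ofReal (Real.exp (-(n * d : ℝ))) * rdpgPosteriorNumerator π Y Set.univ := by
    refine hnum.trans ((ENNReal.ofReal_le_ofReal hfinal).trans ?_)
    rw [ENNReal.ofReal_mul (Real.exp_nonneg _)]
    gcongr
  calc _ ≤ (rdpgPosteriorNumerator π Y Set.univ)⁻¹ *
        (ENNReal.ofReal (Real.exp (-(n * d : ℝ))) * rdpgPosteriorNumerator π Y Set.univ) := by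
        gcongr
    _ = _ := by
        rw [mul_left_comm, ENNReal.inv_mul_cancel hden0
          (rdpgPosteriorNumerator_univ_ne_top hπ Y), mul_one]

/-- A posterior probability that is small on a likely event is small on average. -/
lemma lintegral_rdpgPosterior_le {Ω : Type*} [MeasurableSpace Ω] {μ : Measure Ω}
    [IsProbabilityMeasure μ] (Y : Ω → Matrix (Fin n) (Fin n) Bool)
    (s : Set (Fin n → Fin d → ℝ)) (G : Set Ω) {ε : ℝ} (hε : 0 ≤ ε)
    (hG : μ Gᶜ ≤ ENNReal.ofReal ε) (h : ∀ ω ∈ G, rdpgPosterior π (Y ω) s ≤ ENNReal.ofReal ε) :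
    ∫⁻ ω, rdpgPosterior π (Y ω) s ∂μ ≤ ENNReal.ofReal (2 * ε) := by
  calc ∫⁻ ω, rdpgPosterior π (Y ω) s ∂μ
      ≤ ∫⁻ ω, (Gᶜ.indicator (fun _ => 1) ω + ENNReal.ofReal ε) ∂μ := by
        refine lintegral_mono fun ω => ?_
        by_cases hω : ω ∈ G
        · exact (h ω hω).trans le_add_self
        · rw [Set.indicator_of_mem (show ω ∈ Gᶜ from hω)]
          exact (rdpgPosterior_le_one _ _).trans le_self_add
    _ = ∫⁻ ω, Gᶜ.indicator (fun _ => 1) ω ∂μ + ENNReal.ofReal ε := by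
        rw [lintegral_add_right _ measurable_const]; simp
    _ ≤ ENNReal.ofReal ε + ENNReal.ofReal ε := by
        gcongr
        refine (lintegral_indicator_const_le _ _).trans ?_
        rwa [one_mul]
    _ = ENNReal.ofReal (2 * ε) := by rw [← ENNReal.ofReal_add hε hε]; ring_nf

end

/-- Positive definiteness as a lower bound for the quadratic form. -/
lemma Matrix.PosDef.exists_pos_mul_dotProduct_le {d : ℕ} {Δ : Matrix (Fin d) (Fin d) ℝ}
    (hΔ : Δ.PosDef) : ∃ κ : ℝ, 0 < κ ∧ ∀ v, κ * (v ⬝ᵥ v) ≤ v ⬝ᵥ (Δ *ᵥ v) := by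
  have hpos : ∀ v : Fin d → ℝ, v ≠ 0 → 0 < v ⬝ᵥ (Δ *ᵥ v) := fun v hv => by
    simpa using hΔ.dotProduct_mulVec_pos hv
  have hcdot : Continuous fun v : Fin d → ℝ => v ⬝ᵥ v := by unfold dotProduct; fun_prop
  set Sph : Set (Fin d → ℝ) := {v | v ⬝ᵥ v = 1} with hSph
  have hcpt : IsCompact Sph := by
    refine (isCompact_univ_pi fun _ : Fin d =>
      isCompact_Icc (a := (-1 : ℝ)) (b := 1)).of_isClosed_subset (isClosed_eq hcdot continuous_const)
        fun v hv k _ => ?_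
    have h1 : v k * v k ≤ v ⬝ᵥ v :=
      Finset.single_le_sum (f := fun k => v k * v k) (fun i _ => mul_self_nonneg _)
        (Finset.mem_univ k)
    rw [show v ⬝ᵥ v = 1 from hv] at h1
    rw [Set.mem_Icc, ← abs_le]
    exact abs_le_of_sq_le_sq (by nlinarith) zero_le_one
  have hcont : Continuous fun v : Fin d → ℝ => v ⬝ᵥ (Δ *ᵥ v) := by
    unfold Matrix.mulVec dotProduct; fun_prop
  rcases Sph.eq_empty_or_nonempty with hemp | hne
  · refine ⟨1, one_pos, fun v => ?_⟩
    have hv : v = 0 := by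
      by_contra hv
      have hvv : 0 < v ⬝ᵥ v := lt_of_le_of_ne (dotProduct_self_nonneg v)
        fun h => hv (dotProduct_self_eq_zero.mp h.symm)
      have : (√(v ⬝ᵥ v))⁻¹ • v ∈ Sph := by
        rw [hSph, Set.mem_ofPred_eq, smul_dotProduct, dotProduct_smul, smul_eq_mul, smul_eq_mul,
          ← mul_assoc, ← mul_inv, Real.mul_self_sqrt hvv.le, inv_mul_cancel₀ hvv.ne']
      rw [hemp] at this
      exact this
    simp [hv]
  · obtain ⟨v₀, hv₀, hmin⟩ := hcpt.exists_isMinOn hne hcont.continuousOn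
    have hv₀0 : v₀ ≠ 0 := by rintro rfl; simp [hSph] at hv₀
    refine ⟨v₀ ⬝ᵥ (Δ *ᵥ v₀), hpos v₀ hv₀0, fun v => ?_⟩
    rcases eq_or_ne v 0 with rfl | hv
    · simp
    have hvv : 0 < v ⬝ᵥ v := lt_of_le_of_ne (dotProduct_self_nonneg v)
      fun h => hv (dotProduct_self_eq_zero.mp h.symm)
    have hmem : (√(v ⬝ᵥ v))⁻¹ • v ∈ Sph := by
      rw [hSph, Set.mem_ofPred_eq, smul_dotProduct, dotProduct_smul, smul_eq_mul, smul_eq_mul,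
        ← mul_assoc, ← mul_inv, Real.mul_self_sqrt hvv.le, inv_mul_cancel₀ hvv.ne']
    have h := hmin hmem
    simp only [Set.mem_ofPred_eq, Matrix.mulVec_smul, smul_dotProduct, dotProduct_smul,
      smul_eq_mul] at h
    rw [← mul_assoc, ← mul_inv, Real.mul_self_sqrt hvv.le, ← div_eq_inv_mul,
      le_div_iff₀ hvv] at h
    exact h

/-- Convergence of the Gram matrices gives, eventually, a lower bound for their quadratic forms. -/
lemma eventually_gram_ge {d : ℕ} {Δ : Matrix (Fin d) (Fin d) ℝ} {κ : ℝ} (hκ : 0 < κ)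
    (hΔ : ∀ v, 2 * κ * (v ⬝ᵥ v) ≤ v ⬝ᵥ (Δ *ᵥ v)) {X₀ : ∀ n : ℕ, Matrix (Fin n) (Fin d) ℝ}
    (h : Tendsto (fun n : ℕ => (n : ℝ)⁻¹ • ((X₀ n)ᵀ * X₀ n)) atTop (𝓝 Δ)) :
    ∀ᶠ n : ℕ in atTop, ∀ v, κ * n * (v ⬝ᵥ v) ≤ v ⬝ᵥ (((X₀ n)ᵀ * X₀ n) *ᵥ v) := by
  have hc : Continuous fun A : Matrix (Fin d) (Fin d) ℝ => frobSq (A - Δ) := by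
    simp only [frobSq, Matrix.sub_apply]; fun_prop
  have h1 : Tendsto (fun n : ℕ => frobSq ((n : ℝ)⁻¹ • ((X₀ n)ᵀ * X₀ n) - Δ)) atTop (𝓝 0) := by
    have := (hc.tendsto Δ).comp h
    simpa [frobSq, Function.comp_def] using this
  filter_upwards [h1.eventually_le_const (show (0 : ℝ) < κ ^ 2 by positivity),
    eventually_ge_atTop 1] with n hn hn1 v
  have hn' : (0 : ℝ) < n := by exact_mod_cast hn1
  set A := (n : ℝ)⁻¹ • ((X₀ n)ᵀ * X₀ n) with hA
  have hAe : (X₀ n)ᵀ * X₀ n = (n : ℝ) • A := by rw [hA, smul_smul]; field_simp; simp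
  have hdiff : |v ⬝ᵥ ((A - Δ) *ᵥ v)| ≤ κ * (v ⬝ᵥ v) := by
    refine abs_le_of_sq_le_sq ?_ (mul_nonneg hκ.le (dotProduct_self_nonneg v))
    calc (v ⬝ᵥ ((A - Δ) *ᵥ v)) ^ 2
        ≤ (v ⬝ᵥ v) * (((A - Δ) *ᵥ v) ⬝ᵥ ((A - Δ) *ᵥ v)) := dotProduct_sq_le _ _
      _ ≤ (v ⬝ᵥ v) * (frobSq (A - Δ) * (v ⬝ᵥ v)) :=
          mul_le_mul_of_nonneg_left (dotProduct_mulVec_self_le _ _) (dotProduct_self_nonneg v)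
      _ ≤ (v ⬝ᵥ v) * (κ ^ 2 * (v ⬝ᵥ v)) := by
          have := dotProduct_self_nonneg v
          gcongr
      _ = _ := by ring
  rw [Matrix.sub_mulVec, dotProduct_sub] at hdiff
  have h2 := (abs_le.mp hdiff).1
  have h3 := hΔ v
  rw [hAe, Matrix.smul_mulVec, dotProduct_smul, smul_eq_mul]
  calc κ * n * (v ⬝ᵥ v) = n * (κ * (v ⬝ᵥ v)) := by ring
    _ ≤ n * (v ⬝ᵥ (A *ᵥ v)) := by gcongr; linarith

lemma leastEigenvalue_pos {d : ℕ} (hd : 0 < d) {Δ : Matrix (Fin d) (Fin d) ℝ} (hΔ : Δ.PosDef) :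
    0 < leastEigenvalue hΔ.1 := by
  have : Nonempty (Fin d) := ⟨⟨0, hd⟩⟩
  obtain ⟨k, hk⟩ := exists_eq_ciInf_of_finite (f := hΔ.1.eigenvalues)
  rw [leastEigenvalue, ← hk]
  exact hΔ.eigenvalues_pos k

/-! ### Existence and stability of `K`-means clustering -/

lemma sq_apply_le_frobSq {m n : ℕ} (A : Matrix (Fin m) (Fin n) ℝ) (i : Fin m) (j : Fin n) :
    A i j ^ 2 ≤ frobSq A :=
  (Finset.single_le_sum (f := fun j => A i j ^ 2) (fun _ _ => sq_nonneg _)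
    (Finset.mem_univ j)).trans (Finset.single_le_sum (f := fun i => ∑ j, A i j ^ 2)
      (fun _ _ => Finset.sum_nonneg fun _ _ => sq_nonneg _) (Finset.mem_univ i))

lemma eq_of_frobSq_sub_le_zero {m n : ℕ} {A B : Matrix (Fin m) (Fin n) ℝ}
    (h : frobSq (A - B) ≤ 0) : A = B := by
  ext i j
  have h1 := (sq_apply_le_frobSq (A - B) i j).trans h
  have h2 := pow_eq_zero_iff two_ne_zero |>.mp (le_antisymm h1 (sq_nonneg _))
  exact sub_eq_zero.mp h2

lemma ncard_range_le_of_factors {ι α β : Type*} [Finite ι] {f : ι → α} {g : ι → β}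
    (h : ∀ i j, g i = g j → f i = f j) : (Set.range f).ncard ≤ (Set.range g).ncard := by
  classical
  rcases isEmpty_or_nonempty ι with hι | ⟨⟨i₀⟩⟩
  · simp [Set.range_eq_empty]
  set φ : β → α := fun b => if hb : ∃ i, g i = b then f hb.choose else f i₀ with hφ
  have hφg : ∀ i, φ (g i) = f i := fun i => by
    have hb : ∃ j, g j = g i := ⟨i, rfl⟩
    simp only [hφ, dif_pos hb]
    exact h _ _ hb.choose_spec
  have : Set.range f = φ '' Set.range g := by
    rw [← Set.range_comp]; congr 1; funext i; exact (hφg i).symm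
  rw [this]
  exact Set.ncard_image_le (Set.finite_range g)

lemma ncard_range_congr {ι α β : Type*} [Finite ι] {f : ι → α} {g : ι → β}
    (h : ∀ i j, g i = g j ↔ f i = f j) : (Set.range f).ncard = (Set.range g).ncard :=
  le_antisymm (ncard_range_le_of_factors fun i j => (h i j).mp)
    (ncard_range_le_of_factors fun i j => (h i j).mpr)

lemma surjective_of_ncard_range {n K : ℕ} {τ : Fin n → Fin K} (h : (Set.range τ).ncard = K) :
    Function.Surjective τ := by
  rw [← Set.range_eq_univ]
  exact Set.eq_of_subset_of_ncard_le (Set.subset_univ _) (by simp [Set.ncard_univ, h])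

section

variable {n d K : ℕ}

lemma isClosed_ncard_range_le (n d K : ℕ) :
    IsClosed {C : Matrix (Fin n) (Fin d) ℝ | (Set.range fun i => C i).ncard ≤ K} := by
  have : {C : Matrix (Fin n) (Fin d) ℝ | (Set.range fun i => C i).ncard ≤ K}
      = ⋃ τ : Fin n → Fin K, {C | ∀ i j, τ i = τ j → C i = C j} := by
    ext C
    simp only [Set.mem_ofPred_eq, Set.mem_iUnion]
    constructor
    · intro h
      have hfin : (Set.range fun i => C i).Finite := Set.finite_range _
      have := hfin.to_subtype
      have hcard : Nat.card (Set.range fun i => C i) ≤ Nat.card (Fin K) := by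
        rw [Nat.card_coe_set_eq]; simpa using h
      have := Fintype.ofFinite (Set.range fun i => C i)
      rw [Nat.card_eq_fintype_card, Nat.card_eq_fintype_card] at hcard
      obtain ⟨e⟩ := Function.Embedding.nonempty_of_card_le hcard
      refine ⟨fun i => e ⟨C i, i, rfl⟩, fun i j hij => ?_⟩
      exact congrArg Subtype.val (e.injective hij)
    · rintro ⟨τ, hτ⟩
      calc _ ≤ (Set.range τ).ncard := ncard_range_le_of_factors hτ
        _ ≤ (Set.univ : Set (Fin K)).ncard := Set.ncard_le_ncard (Set.subset_univ _)
        _ = K := by simp [Set.ncard_univ]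
  rw [this]
  refine isClosed_iUnion_of_finite fun τ => ?_
  have : {C : Matrix (Fin n) (Fin d) ℝ | ∀ i j, τ i = τ j → C i = C j}
      = ⋂ i, ⋂ j, ⋂ _ : τ i = τ j, {C : Matrix (Fin n) (Fin d) ℝ | C i = C j} := by
    ext C; simp
  rw [this]
  exact isClosed_iInter fun i => isClosed_iInter fun j => isClosed_iInter fun _ =>
    isClosed_eq (continuous_pi fun k => continuous_id.matrix_elem i k)
      (continuous_pi fun k => continuous_id.matrix_elem j k)

/-- `K`-means assignments exist as soon as there are `K` distinct rows: a minimizer over the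
matrices with at most `K` distinct rows exists by compactness, and it has exactly `K` distinct
rows, because otherwise one of its rows could be replaced by the corresponding row of `A`. -/
lemma exists_isKMeansAssignment (hK : 0 < K) (A : Matrix (Fin n) (Fin d) ℝ)
    (hA : K ≤ (Set.range fun i => A i).ncard) : ∃ τ : Fin n → Fin K, IsKMeansAssignment K A τ := by
  classical
  have hcont : Continuous fun C : Matrix (Fin n) (Fin d) ℝ => frobSq (C - A) := by
    simp only [frobSq, Matrix.sub_apply]; fun_prop
  set R := frobSq (0 - A) with hR
  set Cl : Set (Matrix (Fin n) (Fin d) ℝ) := {C | (Set.range fun i => C i).ncard ≤ K} with hCl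
  have h0 : (0 : Matrix (Fin n) (Fin d) ℝ) ∈ Cl := by
    rcases isEmpty_or_nonempty (Fin n) with h | h
    · simp [hCl, Set.range_eq_empty]
    · have : (Set.range fun i : Fin n => (0 : Matrix (Fin n) (Fin d) ℝ) i) = {0} := by
        ext x; simp [Set.mem_range, eq_comm, funext_iff]
      rw [hCl, Set.mem_ofPred_eq, this, Set.ncard_singleton]; exact hK
  have hcpt : IsCompact (Cl ∩ {C | frobSq (C - A) ≤ R}) := by
    refine (isCompact_univ_pi fun i : Fin n => isCompact_univ_pi fun j : Fin d =>
      isCompact_Icc (a := A i j - √R) (b := A i j + √R)).of_isClosed_subset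
      ((isClosed_ncard_range_le n d K).inter (isClosed_le hcont continuous_const)) ?_
    intro (C : Matrix (Fin n) (Fin d) ℝ) ⟨_, hC⟩ i _ j _
    have h1 : (C i j - A i j) ^ 2 ≤ R := (sq_apply_le_frobSq (C - A) i j).trans hC
    have h2 := abs_le.mp (Real.abs_le_sqrt h1)
    constructor <;> linarith [h2.1, h2.2]
  obtain ⟨C, ⟨hCK, hCR⟩, hmin⟩ := hcpt.exists_isMinOn ⟨0, h0, hR.ge⟩ hcont.continuousOn
  have hmin' : ∀ C' ∈ Cl, frobSq (C - A) ≤ frobSq (C' - A) := by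
    intro C' hC'
    by_cases h : frobSq (C' - A) ≤ R
    · exact hmin ⟨hC', h⟩
    · exact hCR.trans (not_le.mp h).le
  have hCeq : (Set.range fun i => C i).ncard = K := by
    refine le_antisymm hCK (not_lt.mp fun hlt => ?_)
    have hne : ∃ i, C i ≠ A i := by
      by_contra! h
      rw [funext h] at hlt
      omega
    obtain ⟨i, hi⟩ := hne
    have hC' : C.updateRow i (A i) ∈ Cl := by
      have hsub : (Set.range fun k => C.updateRow i (A i) k) ⊆
          insert (A i) (Set.range fun k => C k) := by
        rintro _ ⟨k, rfl⟩
        rcases eq_or_ne k i with rfl | hk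
        · left; exact Matrix.updateRow_self
        · right; exact ⟨k, (Matrix.updateRow_ne hk).symm⟩
      calc _ ≤ _ := Set.ncard_le_ncard hsub ((Set.finite_range _).insert _)
        _ ≤ (Set.range fun k => C k).ncard + 1 := Set.ncard_insert_le _ _
        _ ≤ K := hlt
    refine absurd (hmin' _ hC') (not_le.mpr ?_)
    simp only [frobSq_eq_sum_dotProduct]
    refine Finset.sum_lt_sum (fun k _ => ?_) ⟨i, Finset.mem_univ i, ?_⟩
    · rcases eq_or_ne k i with rfl | hk
      · have : (C.updateRow k (A k) - A) k = 0 := by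
          change C.updateRow k (A k) k - A k = 0
          rw [Matrix.updateRow_self, sub_self]
        rw [this]; simpa using dotProduct_self_nonneg _
      · have : (C.updateRow i (A i) - A) k = (C - A) k := by
          change C.updateRow i (A i) k - A k = C k - A k
          rw [Matrix.updateRow_ne hk]
        rw [this]
    · have : (C.updateRow i (A i) - A) i = 0 := by
        change C.updateRow i (A i) i - A i = 0
        rw [Matrix.updateRow_self, sub_self]
      rw [this, dotProduct_zero]
      refine lt_of_le_of_ne (dotProduct_self_nonneg _) fun h => hi ?_
      have := dotProduct_self_eq_zero.mp h.symm
      exact sub_eq_zero.mp this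
  have hfin : Finite (Set.range fun i => C i) := (Set.finite_range _).to_subtype
  set e := Finite.equivFinOfCardEq (α := Set.range fun i => C i) (n := K)
    (by rw [Nat.card_coe_set_eq, hCeq]) with he
  refine ⟨fun i => e ⟨C i, i, rfl⟩, C, ⟨hCeq, fun C' hC' => ?_⟩, fun i j => ?_⟩
  · rw [frobNorm_le_iff]; exact hmin' C' (le_of_eq hC')
  · rw [e.injective.eq_iff]
    exact Subtype.ext_iff

/-- If `A` has exactly `K` distinct rows, its `K`-means clusters are the sets of equal rows. -/
lemma IsKMeansAssignment.eq_iff_of_mem {A : Matrix (Fin n) (Fin d) ℝ} {τ : Fin n → Fin K}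
    (h : IsKMeansAssignment K A τ) (hA : A ∈ centroidMatrices n d K) (i j : Fin n) :
    τ i = τ j ↔ A i = A j := by
  obtain ⟨C, ⟨-, hmin⟩, hτ⟩ := h
  have h0 := (frobNorm_le_iff _ _).mp (hmin A hA)
  have hz : frobSq (A - A) = 0 := by simp [frobSq]
  rw [hz] at h0
  have hCA : C = A := eq_of_frobSq_sub_le_zero h0
  rw [hτ, hCA]

lemma IsKMeansAssignment.surjective {A : Matrix (Fin n) (Fin d) ℝ} {τ : Fin n → Fin K}
    (h : IsKMeansAssignment K A τ) : Function.Surjective τ := by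
  obtain ⟨C, ⟨hC, -⟩, hτ⟩ := h
  refine surjective_of_ncard_range ?_
  rw [← ncard_range_congr hτ]
  exact hC

lemma misclustered_le_hammingDistance (τ₁ τ₂ : Fin n → Fin K) (σ : Equiv.Perm (Fin K)) :
    misclustered τ₁ τ₂ ≤ hammingDistance (σ ∘ τ₁) τ₂ :=
  ciInf_le (OrderBot.bddBelow _) σ

/-- If off the set `S` the clustering `τ` refines `τ₀`, and `S` contains no cluster of `τ₀`, then
the clusterings agree off `S` up to relabelling: both have `K` clusters. -/
lemma misclustered_le_card {τ₀ τ : Fin n → Fin K}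
    (S : Finset (Fin n)) (hS : ∀ i ∉ S, ∀ j ∉ S, τ i = τ j → τ₀ i = τ₀ j)
    (hrep : ∀ k, ∃ i ∉ S, τ₀ i = k) :
    misclustered τ₀ τ ≤ S.card ∧ misclustered τ τ₀ ≤ S.card := by
  choose g hgS hg using hrep
  have hinj : Function.Injective fun k => τ (g k) := fun k k' hkk => by
    have := hS _ (hgS k) _ (hgS k') hkk
    rwa [hg, hg] at this
  set σ : Equiv.Perm (Fin K) := Equiv.ofBijective _ (Finite.injective_iff_bijective.mp hinj) with hσ
  have hagree : ∀ i ∉ S, σ (τ₀ i) = τ i := by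
    intro i hi
    obtain ⟨k, hk⟩ := σ.surjective (τ i)
    have hk' : τ (g k) = τ i := hk
    have := hS _ (hgS k) _ hi hk'
    rw [hg] at this
    rw [← this, hk]
  constructor
  · refine (misclustered_le_hammingDistance τ₀ τ σ).trans (Finset.card_le_card fun i hi => ?_)
    by_contra hiS
    exact (Finset.mem_filter.mp hi).2 (hagree i hiS)
  · refine (misclustered_le_hammingDistance τ τ₀ σ.symm).trans
      (Finset.card_le_card fun i hi => ?_)
    by_contra hiS
    refine (Finset.mem_filter.mp hi).2 ?_
    rw [Function.comp_apply, ← hagree i hiS, Equiv.symm_apply_apply]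

/-- Few rows of `C` can be far from the corresponding rows of `B`, and the other rows inherit the
separation of the rows of `B`. -/
lemma exists_exceptional_set {B C : Matrix (Fin n) (Fin d) ℝ} {τ₀ : Fin n → Fin K} {ζ s : ℝ}
    (hζ : 0 < ζ) (hsep : ∀ i j, τ₀ i ≠ τ₀ j → ζ ^ 2 < (B i - B j) ⬝ᵥ (B i - B j))
    (hC : frobSq (C - B) ≤ ζ ^ 2 / 4 * s) :
    ∃ S : Finset (Fin n), (S.card : ℝ) ≤ s ∧ ∀ i ∉ S, ∀ j ∉ S, C i = C j → τ₀ i = τ₀ j := by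
  classical
  set S : Finset (Fin n) :=
    Finset.univ.filter fun i => ζ ^ 2 / 4 ≤ (C i - B i) ⬝ᵥ (C i - B i) with hS
  refine ⟨S, ?_, fun i hi j hj hij => ?_⟩
  · have h1 : (S.card : ℝ) * (ζ ^ 2 / 4) ≤ frobSq (C - B) := by
      rw [frobSq_eq_sum_dotProduct, ← nsmul_eq_mul]
      refine (Finset.card_nsmul_le_sum S _ _ fun i hi => (Finset.mem_filter.mp hi).2).trans ?_
      exact Finset.sum_le_sum_of_subset_of_nonneg (Finset.subset_univ S)
        fun i _ _ => dotProduct_self_nonneg _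
    have h2 : ζ ^ 2 / 4 * (S.card : ℝ) ≤ ζ ^ 2 / 4 * s := by linarith
    exact le_of_mul_le_mul_left h2 (by positivity)
  · by_contra hne
    have h := hsep i j hne
    simp only [hS, Finset.mem_filter, Finset.mem_univ, true_and, not_le] at hi hj
    set a := C i - B i with ha
    set b := C j - B j with hb
    have hab : B i - B j = b - a := by rw [ha, hb, hij]; abel
    rw [hab] at h
    have hpar : (b - a) ⬝ᵥ (b - a) + (b + a) ⬝ᵥ (b + a) = 2 * (b ⬝ᵥ b) + 2 * (a ⬝ᵥ a) := by
      simp only [sub_dotProduct, dotProduct_sub, add_dotProduct, dotProduct_add]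
      ring
    linarith [dotProduct_self_nonneg (b + a)]

/-- Stability of `K`-means: if `A` is close to a matrix `B` with `K` well separated rows and large
blocks, then every `K`-means clustering of `A` misclassifies few rows. -/
theorem kMeans_stability {A B : Matrix (Fin n) (Fin d) ℝ} {τ₀ : Fin n → Fin K} {ζ s : ℝ}
    (hK : 0 < K) (hζ : 0 < ζ) (hs : 0 ≤ s) (hτ₀ : Function.Surjective τ₀)
    (hB : ∀ i j, τ₀ i = τ₀ j → B i = B j)
    (hsep : ∀ i j, τ₀ i ≠ τ₀ j → ζ ^ 2 < (B i - B j) ⬝ᵥ (B i - B j))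
    (hblock : ∀ k, s < (Finset.univ.filter fun i => τ₀ i = k).card)
    (hclose : 16 * frobSq (A - B) ≤ ζ ^ 2 * s) :
    (∃ τ : Fin n → Fin K, IsKMeansAssignment K A τ) ∧
    ∀ τ : Fin n → Fin K, IsKMeansAssignment K A τ →
      (misclustered τ₀ τ : ℝ) ≤ s ∧ (misclustered τ τ₀ : ℝ) ≤ s := by
  have hBτ : ∀ i j, τ₀ i = τ₀ j ↔ B i = B j := fun i j => ⟨hB i j, fun h => by
    by_contra hne
    have := hsep i j hne
    rw [h, sub_self, dotProduct_zero] at this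
    exact absurd this (not_lt.mpr (by positivity))⟩
  have hBK : B ∈ centroidMatrices n d K := by
    change (Set.range fun i => B i).ncard = K
    rw [ncard_range_congr hBτ, Set.range_eq_univ.mpr hτ₀]
    simp [Set.ncard_univ]
  -- a set with at most `s` elements misses a point of every block
  have hrep : ∀ S : Finset (Fin n), (S.card : ℝ) ≤ s → ∀ k, ∃ i ∉ S, τ₀ i = k := by
    intro S hS k
    by_contra! h
    have hsub : (Finset.univ.filter fun i => τ₀ i = k) ⊆ S := fun i hi => by
      by_contra hiS
      exact h i hiS (Finset.mem_filter.mp hi).2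
    have : ((Finset.univ.filter fun i => τ₀ i = k).card : ℝ) ≤ S.card := by
      exact_mod_cast Finset.card_le_card hsub
    linarith [hblock k]
  constructor
  · refine exists_isKMeansAssignment hK A ?_
    obtain ⟨S, hSs, hS⟩ := exists_exceptional_set (C := A) (s := s) hζ hsep
      (by nlinarith [mul_nonneg (sq_nonneg ζ) hs])
    choose g hgS hg using hrep S hSs
    have hinj : Function.Injective fun k => A (g k) := fun k k' h => by
      have := hS _ (hgS k) _ (hgS k') h
      rwa [hg, hg] at this
    calc K = (Set.range fun k => A (g k)).ncard := by
          rw [← Set.image_univ, Set.ncard_image_of_injective _ hinj]; simp [Set.ncard_univ]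
      _ ≤ _ := Set.ncard_le_ncard (by rintro _ ⟨k, rfl⟩; exact ⟨g k, rfl⟩) (Set.finite_range _)
  · intro τ hτ
    obtain ⟨C, ⟨hCK, hmin⟩, hCτ⟩ := hτ
    have hCB : frobSq (C - B) ≤ ζ ^ 2 / 4 * s := by
      have h1 := (frobNorm_le_iff _ _).mp (hmin B hBK)
      have h2 := frobSq_add_le (C - A) (A - B)
      rw [sub_add_sub_cancel] at h2
      rw [frobSq_sub_comm B A] at h1
      linarith
    obtain ⟨S, hSs, hS⟩ := exists_exceptional_set hζ hsep hCB
    have h := misclustered_le_card S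
      (fun i hi j hj hij => hS i hi j hj ((hCτ i j).mp hij)) (hrep S hSs)
    constructor
    · exact le_trans (by exact_mod_cast h.1) hSs
    · exact le_trans (by exact_mod_cast h.2) hSs

end

/-! ### Perturbation of eigenvectors -/

section

variable {n d : ℕ}

lemma frobSq_mul_diagonal_le {m : ℕ} (A : Matrix (Fin m) (Fin d) ℝ) {c : Fin d → ℝ} {b : ℝ}
    (hc : ∀ k, c k ^ 2 ≤ b) : frobSq (A * Matrix.diagonal c) ≤ b * frobSq A := by
  simp only [frobSq, Finset.mul_sum, Matrix.mul_diagonal, mul_pow]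
  refine Finset.sum_le_sum fun i _ => Finset.sum_le_sum fun k _ => ?_
  rw [mul_comm]
  exact mul_le_mul_of_nonneg_right (hc k) (sq_nonneg _)

/-- Multiplication by some of the columns of an orthogonal matrix does not increase the Frobenius
norm. -/
lemma frobSq_mul_columns_le {m : ℕ} (A : Matrix (Fin m) (Fin n) ℝ) {Q : Matrix (Fin n) (Fin n) ℝ}
    (hQ : Q * Qᵀ = 1) {e : Fin d → Fin n} (he : Function.Injective e) :
    frobSq (A * Q.submatrix id e) ≤ frobSq A := by
  rw [← frobSq_mul_of_mul_transpose A hQ]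
  refine Finset.sum_le_sum fun i _ => ?_
  calc ∑ k, (A * Q.submatrix id e) i k ^ 2
      = ∑ j ∈ Finset.univ.map ⟨e, he⟩, (A * Q) i j ^ 2 := by
        rw [Finset.sum_map]; rfl
    _ ≤ _ := Finset.sum_le_sum_of_subset_of_nonneg (Finset.subset_univ _)
        fun _ _ _ => sq_nonneg _

/-- Weyl's inequality in the form needed here, by the Courant–Fischer argument: some vector in the
column space of `X₀` is orthogonal to the first `d - 1` eigenvectors of `P`. -/
lemma le_eigenvalue_of_near_gram {X₀ : Matrix (Fin n) (Fin d) ℝ} {P Q : Matrix (Fin n) (Fin n) ℝ}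
    {lam : Fin n → ℝ} {κ ρ : ℝ} (hdn : d ≤ n) (hQ : Q * Qᵀ = 1) (hlam : Antitone lam)
    (hP : P = Q * Matrix.diagonal lam * Qᵀ) (hκ : 0 < κ) (hρ : 0 ≤ ρ)
    (hgram : ∀ v, κ * (v ⬝ᵥ v) ≤ v ⬝ᵥ ((X₀ᵀ * X₀) *ᵥ v))
    (hclose : frobSq (P - X₀ * X₀ᵀ) ≤ ρ ^ 2) (k : Fin d) :
    κ - ρ ≤ lam (Fin.castLE hdn k) := by
  set e : Fin d → Fin n := Fin.castLE hdn with he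
  -- `w` is orthogonal to the constraints given by the eigenvectors before the `k`-th
  set L : (Fin d → ℝ) →ₗ[ℝ] ({j : Fin d // j < k} → ℝ) :=
    { toFun := fun w j => (Qᵀ *ᵥ (X₀ *ᵥ w)) (e j)
      map_add' := fun v w => by ext j; simp [Matrix.mulVec_add]
      map_smul' := fun c w => by ext j; simp [Matrix.mulVec_smul] } with hL
  have hker : LinearMap.ker L ≠ ⊥ := by
    apply LinearMap.ker_ne_bot_of_finrank_lt
    rw [Module.finrank_fintype_fun_eq_card, Module.finrank_fintype_fun_eq_card, Fintype.card_fin]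
    calc Fintype.card {j : Fin d // j < k} < Fintype.card (Fin d) :=
          Fintype.card_subtype_lt (x := k) (lt_irrefl k)
      _ = d := Fintype.card_fin d
  obtain ⟨w, hwL, hw0⟩ := Submodule.exists_mem_ne_zero_of_ne_bot hker
  have hwz : ∀ j : Fin d, j < k → (Qᵀ *ᵥ (X₀ *ᵥ w)) (e j) = 0 := fun j hj =>
    congrFun (LinearMap.mem_ker.mp hwL) ⟨j, hj⟩
  have hww : 0 < w ⬝ᵥ w := lt_of_le_of_ne (dotProduct_self_nonneg w)
    fun h => hw0 (dotProduct_self_eq_zero.mp h.symm)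
  set v := X₀ *ᵥ w with hv
  set c := Qᵀ *ᵥ v with hc
  have hvv : v ⬝ᵥ v = w ⬝ᵥ ((X₀ᵀ * X₀) *ᵥ w) := dotProduct_mulVec_mulVec _ _ _ _
  have hvpos : 0 < v ⬝ᵥ v := by
    rw [hvv]; exact lt_of_lt_of_le (mul_pos hκ hww) (hgram w)
  have hcc : c ⬝ᵥ c = v ⬝ᵥ v := by
    rw [hc, dotProduct_mulVec_mulVec, Matrix.transpose_transpose, hQ, Matrix.one_mulVec]
  have hPv : v ⬝ᵥ (P *ᵥ v) = ∑ j, lam j * c j ^ 2 := by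
    have : P *ᵥ v = Q *ᵥ (Matrix.diagonal lam *ᵥ c) := by
      rw [hP, ← Matrix.mulVec_mulVec, ← Matrix.mulVec_mulVec]
    rw [this, Matrix.dotProduct_mulVec, ← Matrix.mulVec_transpose, ← hc]
    simp only [dotProduct, Matrix.mulVec_diagonal]
    exact Finset.sum_congr rfl fun j _ => by ring
  have hupper : v ⬝ᵥ (P *ᵥ v) ≤ lam (e k) * (v ⬝ᵥ v) := by
    rw [hPv, ← hcc, dotProduct, Finset.mul_sum]
    refine Finset.sum_le_sum fun j _ => ?_
    by_cases hj : (j : ℕ) < k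
    · have : c j = 0 := hwz ⟨j, hj.trans k.2⟩ hj
      simp [this]
    · have : lam j ≤ lam (e k) := hlam (by rw [Fin.le_def]; simpa [he] using hj)
      rw [← sq]
      exact mul_le_mul_of_nonneg_right this (sq_nonneg _)
  have hlow : κ * (v ⬝ᵥ v) ≤ v ⬝ᵥ ((X₀ * X₀ᵀ) *ᵥ v) := by
    set u := X₀ᵀ *ᵥ v with hu
    have h1 : v ⬝ᵥ ((X₀ * X₀ᵀ) *ᵥ v) = u ⬝ᵥ u := by
      have := dotProduct_mulVec_mulVec X₀ᵀ X₀ᵀ v v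
      rw [Matrix.transpose_transpose] at this
      exact this.symm
    have h2 : v ⬝ᵥ v = w ⬝ᵥ u := by rw [hvv, hu, hv, Matrix.mulVec_mulVec]
    rw [h1]
    have h3 := dotProduct_sq_le w u
    have h4 : κ * (w ⬝ᵥ w) ≤ v ⬝ᵥ v := by rw [hvv]; exact hgram w
    have huu := dotProduct_self_nonneg u
    rw [← h2] at h3
    have h5 : κ * (v ⬝ᵥ v) * (v ⬝ᵥ v) ≤ (u ⬝ᵥ u) * (v ⬝ᵥ v) := by
      calc κ * (v ⬝ᵥ v) * (v ⬝ᵥ v) = κ * (v ⬝ᵥ v) ^ 2 := by ring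
        _ ≤ κ * ((w ⬝ᵥ w) * (u ⬝ᵥ u)) := by gcongr
        _ = κ * (w ⬝ᵥ w) * (u ⬝ᵥ u) := by ring
        _ ≤ (v ⬝ᵥ v) * (u ⬝ᵥ u) := by gcongr
        _ = _ := by ring
    exact le_of_mul_le_mul_right h5 hvpos
  have hdiff : |v ⬝ᵥ ((P - X₀ * X₀ᵀ) *ᵥ v)| ≤ ρ * (v ⬝ᵥ v) := by
    refine abs_le_of_sq_le_sq ?_ (mul_nonneg hρ hvpos.le)
    calc _ ≤ (v ⬝ᵥ v) * (((P - X₀ * X₀ᵀ) *ᵥ v) ⬝ᵥ ((P - X₀ * X₀ᵀ) *ᵥ v)) := dotProduct_sq_le _ _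
      _ ≤ (v ⬝ᵥ v) * (ρ ^ 2 * (v ⬝ᵥ v)) := by
          refine mul_le_mul_of_nonneg_left ((dotProduct_mulVec_self_le _ _).trans ?_) hvpos.le
          exact mul_le_mul_of_nonneg_right hclose hvpos.le
      _ = _ := by ring
  rw [Matrix.sub_mulVec, dotProduct_sub] at hdiff
  have h6 := (abs_le.mp hdiff).1
  refine le_of_mul_le_mul_right (a := v ⬝ᵥ v) ?_ hvpos
  linarith

/-- A lower bound for `‖H v‖` is also one for `‖Hᵀ v‖` if `H` is square. -/
lemma le_vecMul_of_le_mulVec {H : Matrix (Fin d) (Fin d) ℝ} {c : ℝ} (hc : 0 < c)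
    (hH : ∀ v, c * (v ⬝ᵥ v) ≤ (H *ᵥ v) ⬝ᵥ (H *ᵥ v)) (x : Fin d → ℝ) :
    c * (x ⬝ᵥ x) ≤ (x ᵥ* H) ⬝ᵥ (x ᵥ* H) := by
  have hinj : Function.Injective (Matrix.mulVecLin H) := by
    rw [← LinearMap.ker_eq_bot, LinearMap.ker_eq_bot']
    intro v hv
    have h := hH v
    rw [show H *ᵥ v = 0 from hv, dotProduct_zero] at h
    refine dotProduct_self_eq_zero.mp (le_antisymm ?_ (dotProduct_self_nonneg v))
    nlinarith
  obtain ⟨v, hv⟩ := LinearMap.surjective_of_injective hinj x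
  have hv' : H *ᵥ v = x := hv
  have h1 := hH v
  rw [hv'] at h1
  have h2 : x ⬝ᵥ x = (x ᵥ* H) ⬝ᵥ v := by rw [← Matrix.dotProduct_mulVec, hv']
  have h3 := dotProduct_sq_le (x ᵥ* H) v
  rw [← h2] at h3
  rcases (dotProduct_self_nonneg x).eq_or_lt with h0 | hpos
  · rw [← h0, mul_zero]; exact dotProduct_self_nonneg _
  · have hy := dotProduct_self_nonneg (x ᵥ* H)
    refine le_of_mul_le_mul_right (a := x ⬝ᵥ x) ?_ hpos
    calc c * (x ⬝ᵥ x) * (x ⬝ᵥ x) = c * (x ⬝ᵥ x) ^ 2 := by ring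
      _ ≤ c * (((x ᵥ* H) ⬝ᵥ (x ᵥ* H)) * (v ⬝ᵥ v)) := by gcongr
      _ = ((x ᵥ* H) ⬝ᵥ (x ᵥ* H)) * (c * (v ⬝ᵥ v)) := by ring
      _ ≤ _ := by gcongr

/-- The left singular vectors of the spectral embedding of a matrix `P` close to `X₀ X₀ᵀ` are close
to a nondegenerate linear image of the rows of `X₀`: they are `P Q Λ⁻¹ O`, with `Q` the leading
eigenvectors and `O` orthogonal, and `P` may be replaced by `X₀ X₀ᵀ`. -/
theorem exists_leftSingular_near {X₀ Xhat Uhat : Matrix (Fin n) (Fin d) ℝ}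
    {P : Matrix (Fin n) (Fin n) ℝ} {κ ρ : ℝ} (hn : 0 < n) (hκ : 0 < κ) (hρ : 0 ≤ ρ)
    (hgram : ∀ v, κ * n * (v ⬝ᵥ v) ≤ v ⬝ᵥ ((X₀ᵀ * X₀) *ᵥ v)) (hX₀n : frobSq X₀ ≤ n)
    (hclose : frobSq (P - X₀ * X₀ᵀ) ≤ ρ ^ 2 * n) (hlarge : 16 * ρ ^ 2 ≤ κ ^ 2 * n)
    (hXhat : IsSpectralEmbedding P Xhat) (hUhat : IsLeftSingularMatrix Xhat Uhat) :
    ∃ H : Matrix (Fin d) (Fin d) ℝ, frobSq (Uhat - X₀ * H) ≤ 4 * ρ ^ 2 / (κ ^ 2 * n) ∧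
      ∀ x, 1 / (4 * n) * (x ⬝ᵥ x) ≤ (x ᵥ* H) ⬝ᵥ (x ᵥ* H) := by
  obtain ⟨hdn, Q, lam, hQ, hanti, hP, hX⟩ := hXhat
  obtain ⟨hUU, s, V, -, -, -, hUX⟩ := hUhat
  have hn' : (0 : ℝ) < n := by exact_mod_cast hn
  have hQQ : Q * Qᵀ = 1 := (Matrix.mem_orthogonalGroup_iff _ _).mp hQ
  have hQQ' : Qᵀ * Q = 1 := mul_eq_one_comm.mp hQQ
  set e : Fin d → Fin n := Fin.castLE hdn with he
  have hinj : Function.Injective e := Fin.castLE_injective hdn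
  have hrn : ρ * √(n : ℝ) ≤ κ * n / 2 := by
    refine (pow_le_pow_iff_left₀ (by positivity) (by positivity) two_ne_zero).mp ?_
    rw [mul_pow, Real.sq_sqrt hn'.le]
    nlinarith
  have hlam : ∀ k, κ * n / 2 ≤ lam (e k) := fun k => by
    have := le_eigenvalue_of_near_gram (κ := κ * n) (ρ := ρ * √(n : ℝ)) hdn hQQ hanti hP
      (by positivity) (by positivity) hgram
      (by rw [mul_pow, Real.sq_sqrt hn'.le]; exact hclose) k
    linarith
  have hlam0 : ∀ k, 0 < lam (e k) := fun k => lt_of_lt_of_le (by positivity) (hlam k)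
  set Q₁ := Q.submatrix id e with hQ₁
  have hQ₁Q₁ : Q₁ᵀ * Q₁ = 1 := by
    have : Q₁ᵀ * Q₁ = (Qᵀ * Q).submatrix e e := by
      ext i j; simp [hQ₁, Matrix.mul_apply]
    rw [this, hQQ', Matrix.submatrix_one _ hinj]
  have hPQ₁ : P * Q₁ = Q₁ * Matrix.diagonal (lam ∘ e) := by
    have h1 : P * Q = Q * Matrix.diagonal lam := by rw [hP, Matrix.mul_assoc, hQQ', Matrix.mul_one]
    ext i k
    have h2 := congrFun (congrFun h1 i) (e k)
    rw [Matrix.mul_diagonal] at h2 ⊢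
    exact h2
  have hXQ : Xhat = Q₁ * Matrix.diagonal fun k => √(lam (e k)) := by
    rw [hX]; ext i k; rw [Matrix.mul_diagonal]; rfl
  set T := Matrix.diagonal s * Vᵀ with hT
  have hUT : Uhat * T = Q₁ * Matrix.diagonal fun k => √(lam (e k)) := by
    rw [← hXQ, hUX, hT, Matrix.mul_assoc]
  have hTdet : IsUnit T.det := by
    have h1 : Tᵀ * T = Matrix.diagonal (lam ∘ e) := by
      calc Tᵀ * T = Tᵀ * (Uhatᵀ * Uhat) * T := by rw [hUU, Matrix.mul_one]
        _ = (Uhat * T)ᵀ * (Uhat * T) := by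
            rw [Matrix.transpose_mul Uhat T]; simp only [Matrix.mul_assoc]
        _ = (Matrix.diagonal fun k => √(lam (e k))) * (Q₁ᵀ * Q₁) *
              Matrix.diagonal fun k => √(lam (e k)) := by
            rw [hUT, Matrix.transpose_mul, Matrix.diagonal_transpose]
            simp only [Matrix.mul_assoc]
        _ = _ := by
            rw [hQ₁Q₁, Matrix.mul_one, Matrix.diagonal_mul_diagonal]
            congr 1; funext k; exact Real.mul_self_sqrt (hlam0 k).le
    have h2 := congrArg Matrix.det h1
    rw [Matrix.det_mul, Matrix.det_transpose, Matrix.det_diagonal] at h2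
    have h3 : 0 < ∏ k, (lam ∘ e) k := Finset.prod_pos fun k _ => hlam0 k
    rw [isUnit_iff_ne_zero]
    intro h0
    rw [h0, zero_mul] at h2
    linarith
  set O := (Matrix.diagonal fun k => √(lam (e k))) * T⁻¹ with hO
  have hUO : Uhat = Q₁ * O := by
    rw [hO, ← Matrix.mul_assoc, ← hUT, Matrix.mul_assoc, Matrix.mul_nonsing_inv _ hTdet,
      Matrix.mul_one]
  have hOO : O * Oᵀ = 1 := by
    rw [mul_eq_one_comm]
    calc Oᵀ * O = Oᵀ * (Q₁ᵀ * Q₁) * O := by rw [hQ₁Q₁, Matrix.mul_one]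
      _ = (Q₁ * O)ᵀ * (Q₁ * O) := by
          rw [Matrix.transpose_mul Q₁ O]; simp only [Matrix.mul_assoc]
      _ = 1 := by rw [← hUO, hUU]
  set D := Matrix.diagonal fun k => (lam (e k))⁻¹ with hD
  have hPD : P * Q₁ * D = Q₁ := by
    rw [hPQ₁, hD, Matrix.mul_assoc, Matrix.diagonal_mul_diagonal]
    have : (fun k => (lam ∘ e) k * (lam (e k))⁻¹) = fun _ => 1 := by
      funext k; exact mul_inv_cancel₀ (hlam0 k).ne'
    rw [this, Matrix.diagonal_one, Matrix.mul_one]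
  set H := X₀ᵀ * Q₁ * D * O with hH
  have hdiff : Uhat - X₀ * H = (P - X₀ * X₀ᵀ) * Q₁ * D * O := by
    have h1 : Uhat = P * Q₁ * D * O := by rw [hPD, hUO]
    have h2 : X₀ * H = X₀ * X₀ᵀ * Q₁ * D * O := by rw [hH]; simp only [Matrix.mul_assoc]
    rw [h1, h2, Matrix.sub_mul, Matrix.sub_mul, Matrix.sub_mul]
  have hsmall : frobSq (Uhat - X₀ * H) ≤ 4 * ρ ^ 2 / (κ ^ 2 * n) := by
    rw [hdiff, frobSq_mul_of_mul_transpose _ hOO]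
    calc frobSq ((P - X₀ * X₀ᵀ) * Q₁ * D)
        ≤ (2 / (κ * n)) ^ 2 * frobSq ((P - X₀ * X₀ᵀ) * Q₁) := by
          refine frobSq_mul_diagonal_le _ fun k => ?_
          refine pow_le_pow_left₀ (inv_nonneg.mpr (hlam0 k).le) ?_ 2
          rw [inv_le_comm₀ (hlam0 k) (by positivity)]
          refine le_trans (le_of_eq ?_) (hlam k)
          rw [inv_div]
      _ ≤ (2 / (κ * n)) ^ 2 * (ρ ^ 2 * n) := by
          gcongr
          exact (frobSq_mul_columns_le _ hQQ hinj).trans hclose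
      _ = _ := by field_simp; ring
  refine ⟨H, hsmall, le_vecMul_of_le_mulVec (by positivity) fun v => ?_⟩
  have hU : (Uhat *ᵥ v) ⬝ᵥ (Uhat *ᵥ v) = v ⬝ᵥ v := by
    rw [dotProduct_mulVec_mulVec, hUU, Matrix.one_mulVec]
  set a := X₀ *ᵥ (H *ᵥ v) with ha
  set b := (Uhat - X₀ * H) *ᵥ v with hb
  have hab : Uhat *ᵥ v = a + b := by
    rw [ha, hb, Matrix.sub_mulVec, Matrix.mulVec_mulVec]; abel
  have hvv := dotProduct_self_nonneg v
  have h1 : v ⬝ᵥ v ≤ 2 * (a ⬝ᵥ a) + 2 * (b ⬝ᵥ b) := by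
    rw [← hU, hab]
    have hpar : (a + b) ⬝ᵥ (a + b) + (a - b) ⬝ᵥ (a - b) = 2 * (a ⬝ᵥ a) + 2 * (b ⬝ᵥ b) := by
      simp only [sub_dotProduct, dotProduct_sub, add_dotProduct, dotProduct_add]
      ring
    linarith [dotProduct_self_nonneg (a - b)]
  have h2 : a ⬝ᵥ a ≤ n * ((H *ᵥ v) ⬝ᵥ (H *ᵥ v)) := (dotProduct_mulVec_self_le _ _).trans
    (mul_le_mul_of_nonneg_right hX₀n (dotProduct_self_nonneg _))
  have h3 : b ⬝ᵥ b ≤ 1 / 4 * (v ⬝ᵥ v) := by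
    refine (dotProduct_mulVec_self_le _ _).trans (mul_le_mul_of_nonneg_right ?_ hvv)
    refine hsmall.trans ?_
    rw [div_le_div_iff₀ (by positivity) (by norm_num)]
    linarith
  rw [div_mul_eq_mul_div, div_le_iff₀ (by positivity)]
  linarith

/-- The left singular vectors of a matrix of full column rank have the same coincidences among
their rows as the matrix itself. -/
lemma IsLeftSingularMatrix.row_eq_iff {X U : Matrix (Fin n) (Fin d) ℝ} {κ : ℝ} (hκ : 0 < κ)
    (hgram : ∀ v, κ * (v ⬝ᵥ v) ≤ v ⬝ᵥ ((Xᵀ * X) *ᵥ v)) (h : IsLeftSingularMatrix X U)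
    (i j : Fin n) : U i = U j ↔ X i = X j := by
  obtain ⟨hUU, s, V, -, -, -, hX⟩ := h
  set T := Matrix.diagonal s * Vᵀ with hT
  have hXT : X = U * T := by rw [hX, hT, Matrix.mul_assoc]
  have hrow : ∀ i, X i = U i ᵥ* T := fun i => by rw [hXT]; rfl
  have hTle : ∀ v, κ * (v ⬝ᵥ v) ≤ (T *ᵥ v) ⬝ᵥ (T *ᵥ v) := by
    intro v
    refine (hgram v).trans (le_of_eq ?_)
    rw [← dotProduct_mulVec_mulVec, hXT, ← Matrix.mulVec_mulVec, dotProduct_mulVec_mulVec, hUU,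
      Matrix.one_mulVec]
  constructor
  · intro hU
    rw [hrow, hrow, hU]
  · intro hXij
    have h1 := le_vecMul_of_le_mulVec hκ hTle (U i - U j)
    rw [Matrix.sub_vecMul, ← hrow, ← hrow, hXij, sub_self, dotProduct_zero] at h1
    refine sub_eq_zero.mp (dotProduct_self_eq_zero.mp (le_antisymm ?_ (dotProduct_self_nonneg _)))
    nlinarith [dotProduct_self_nonneg (U i - U j)]

/-! ### The posterior mean -/

lemma sq_integral_le_integral_sq {α : Type*} [MeasurableSpace α] {ν : Measure α}
    [IsProbabilityMeasure ν] {f : α → ℝ} (hf : MemLp f 2 ν) :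
    (∫ x, f x ∂ν) ^ 2 ≤ ∫ x, f x ^ 2 ∂ν := by
  have h := variance_eq_sub hf
  have h0 := variance_nonneg f ν
  rw [h] at h0
  simpa using h0

/-- The posterior mean of `X Xᵀ` is as close to the truth as typical posterior draws are. -/
lemma frobSq_rdpgPosteriorMean_sub_le {π : (Fin d → ℝ) → ℝ} (hπ : IsPriorDensity π)
    {Y : Matrix (Fin n) (Fin n) Bool} (hden : rdpgPosteriorNumerator π Y Set.univ ≠ 0)
    {X₀ : Matrix (Fin n) (Fin d) ℝ} (hX₀ : ∀ i, X₀ i ∈ latentSpace d) {r ε : ℝ} (hr : 0 ≤ r)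
    (hε : 0 ≤ ε) (hpost : rdpgPosterior π Y
      {X | r < frobSq (Matrix.of X * (Matrix.of X)ᵀ - X₀ * X₀ᵀ)} ≤ ENNReal.ofReal ε) :
    frobSq (rdpgPosteriorMean π Y - X₀ * X₀ᵀ) ≤ r + n ^ 2 * ε := by
  set ν := rdpgPosterior π Y with hν
  have hprob : IsProbabilityMeasure ν := ⟨by
    rw [hν, rdpgPosterior_apply, ENNReal.inv_mul_cancel hden
      (rdpgPosteriorNumerator_univ_ne_top hπ Y)]⟩
  have hae : ∀ᵐ X ∂ν, ∀ i, X i ∈ latentSpace d :=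
    (rdpgPosterior_absolutelyContinuous Y).ae_le (ae_rdpgPrior_mem_latentSpace hπ n)
  set f : Fin n → Fin n → (Fin n → Fin d → ℝ) → ℝ := fun i j X =>
    (Matrix.of X * (Matrix.of X)ᵀ - X₀ * X₀ᵀ) i j with hf
  have hfe : ∀ i j X, f i j X = X i ⬝ᵥ X j - X₀ i ⬝ᵥ X₀ j := fun i j X => rfl
  have hfc : ∀ i j, Continuous (f i j) := fun i j => by
    have : f i j = fun X => X i ⬝ᵥ X j - X₀ i ⬝ᵥ X₀ j := funext (hfe i j)
    rw [this]; unfold dotProduct; fun_prop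
  have hfb : ∀ i j, ∀ᵐ X ∂ν, ‖f i j X‖ ≤ 1 := fun i j => by
    filter_upwards [hae] with X hX
    have h1 := dotProduct_mem_Icc_of_mem_latentSpace (hX i) (hX j)
    have h2 := dotProduct_mem_Icc_of_mem_latentSpace (hX₀ i) (hX₀ j)
    rw [hfe, Real.norm_eq_abs, abs_le]
    constructor <;> linarith
  have hmem : ∀ i j, MemLp (f i j) 2 ν := fun i j =>
    MemLp.of_bound (hfc i j).aestronglyMeasurable 1 (hfb i j)
  have hintsq : ∀ i j, Integrable (fun X => f i j X ^ 2) ν := fun i j => (hmem i j).integrable_sq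
  have hmean : ∀ i j, (rdpgPosteriorMean π Y - X₀ * X₀ᵀ) i j = ∫ X, f i j X ∂ν := by
    intro i j
    have h1 : ∀ X, (Matrix.of X * (Matrix.of X)ᵀ) i j = f i j X + (X₀ * X₀ᵀ) i j := fun X => by
      simp only [hf, Matrix.sub_apply]; ring
    rw [Matrix.sub_apply, rdpgPosteriorMean, Matrix.of_apply]
    simp only [h1]
    rw [integral_add ((hmem i j).integrable one_le_two) (integrable_const _)]
    simp
  set A := {X : Fin n → Fin d → ℝ | r < frobSq (Matrix.of X * (Matrix.of X)ᵀ - X₀ * X₀ᵀ)} with hA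
  have hfrob : ∀ X : Fin n → Fin d → ℝ,
      frobSq (Matrix.of X * (Matrix.of X)ᵀ - X₀ * X₀ᵀ) = ∑ i, ∑ j, f i j X ^ 2 := fun X => rfl
  have hAm : MeasurableSet A := by
    have : A = {X | r < ∑ i, ∑ j, f i j X ^ 2} := rfl
    rw [this]
    exact (isOpen_lt continuous_const (by fun_prop)).measurableSet
  calc frobSq (rdpgPosteriorMean π Y - X₀ * X₀ᵀ)
      ≤ ∑ i, ∑ j, ∫ X, f i j X ^ 2 ∂ν := by
        refine Finset.sum_le_sum fun i _ => Finset.sum_le_sum fun j _ => ?_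
        rw [hmean]
        exact sq_integral_le_integral_sq (hmem i j)
    _ = ∫ X, ∑ i, ∑ j, f i j X ^ 2 ∂ν := by
        rw [integral_finsetSum _ fun i _ => integrable_finsetSum _ fun j _ => hintsq i j]
        exact Finset.sum_congr rfl fun i _ => (integral_finsetSum _ fun j _ => hintsq i j).symm
    _ ≤ ∫ X, (r + A.indicator (fun _ => (n : ℝ) ^ 2) X) ∂ν := by
        refine integral_mono_ae (integrable_finsetSum _ fun i _ =>
          integrable_finsetSum _ fun j _ => hintsq i j)
          ((integrable_const _).add ((integrable_const _).indicator hAm)) ?_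
        have hall : ∀ᵐ X ∂ν, ∀ i j, ‖f i j X‖ ≤ 1 := by
          simp only [ae_all_iff]; exact hfb
        filter_upwards [hall] with X hX
        by_cases hXA : X ∈ A
        · rw [Set.indicator_of_mem hXA]
          have : ∑ i, ∑ j, f i j X ^ 2 ≤ ∑ _i : Fin n, ∑ _j : Fin n, (1 : ℝ) :=
            Finset.sum_le_sum fun i _ => Finset.sum_le_sum fun j _ => by
              rw [← sq_abs]; exact pow_le_one₀ (abs_nonneg _) (hX i j)
          simp only [Finset.sum_const, Finset.card_univ, Fintype.card_fin, nsmul_eq_mul,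
            mul_one] at this
          nlinarith
        · rw [Set.indicator_of_notMem hXA, add_zero]
          exact not_lt.mp hXA
    _ = r + n ^ 2 * ν.real A := by
        rw [integral_add (integrable_const _) ((integrable_const _).indicator hAm),
          integral_indicator_const _ hAm]
        simp [mul_comm]
    _ ≤ r + n ^ 2 * ε := by
        gcongr
        exact ENNReal.toReal_le_of_le_ofReal hε hpost

end

/-! ### Distinct rows -/

section

variable {n d : ℕ} {π : (Fin d → ℝ) → ℝ}

lemma rowPrior_singleton (hd : 0 < d) (x : Fin d → ℝ) : rowPrior π {x} = 0 := by
  have : Nonempty (Fin d) := ⟨⟨0, hd⟩⟩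
  refine (withDensity_absolutelyContinuous _ _) ?_
  exact le_antisymm ((Measure.restrict_apply_le _ _).trans (measure_singleton x).le) zero_le

lemma ae_rdpgPrior_injective (hd : 0 < d) (hπ : IsPriorDensity π) (n : ℕ) :
    ∀ᵐ X ∂(rdpgPrior π n), Function.Injective X := by
  have := isProbabilityMeasure_rowPrior hπ
  have := isProbabilityMeasure_rdpgPrior hπ n
  have hne : ∀ i j : Fin n, i ≠ j → ∀ᵐ X ∂(rdpgPrior π n), X i ≠ X j := by
    intro i j hij
    have hind : IndepFun (fun X : Fin n → Fin d → ℝ => X i) (fun X => X j) (rdpgPrior π n) :=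
      (iIndepFun_pi (μ := fun _ : Fin n => rowPrior π) (X := fun _ x => x)
        fun _ => aemeasurable_id).indepFun hij
    have hmap := (indepFun_iff_map_prod_eq_prod_map_map (measurable_pi_apply i).aemeasurable
      (measurable_pi_apply j).aemeasurable).mp hind
    have hev : ∀ k, (rdpgPrior π n).map (fun X => X k) = rowPrior π := fun k =>
      (measurePreserving_eval (fun _ : Fin n => rowPrior π) k).map_eq
    rw [hev, hev] at hmap
    have hdiag : (rowPrior π).prod (rowPrior π) (Set.diagonal (Fin d → ℝ)) = 0 := by
      rw [Measure.measure_prod_null measurableSet_diagonal]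
      refine ae_of_all _ fun x => ?_
      have : Prod.mk x ⁻¹' Set.diagonal (Fin d → ℝ) = {x} := by
        ext y; simp [eq_comm]
      change rowPrior π (Prod.mk x ⁻¹' Set.diagonal (Fin d → ℝ)) = 0
      rw [this]; exact rowPrior_singleton hd x
    rw [← hmap, Measure.map_apply
      ((measurable_pi_apply i).prodMk (measurable_pi_apply j)) measurableSet_diagonal] at hdiag
    rw [ae_iff]
    convert hdiag using 2
    ext X; simp
  have hall : ∀ᵐ X ∂(rdpgPrior π n), ∀ i j, i ≠ j → X i ≠ X j := by
    rw [ae_all_iff]; intro i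
    rw [ae_all_iff]; intro j
    by_cases hij : i = j
    · exact ae_of_all _ fun X h => absurd hij h
    · filter_upwards [hne i j hij] with X hX _ using hX
  filter_upwards [hall] with X hX i j hij
  by_contra h
  exact hX i j h hij

end

/-! ### Clustering -/

section

variable {n d K : ℕ} {X₀ : Matrix (Fin n) (Fin d) ℝ} {xs : Fin K → Fin d → ℝ} {ξ s : ℝ}

lemma mem_centroidMatrices_of_range_eq
    (hrange : (Set.range fun i => X₀ i) = Set.range xs) (hinj : Function.Injective xs) :
    X₀ ∈ centroidMatrices n d K := by
  change (Set.range fun i => X₀ i).ncard = K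
  rw [hrange, ← Set.image_univ, Set.ncard_image_of_injective _ hinj]
  simp [Set.ncard_univ]

lemma le_of_mem_centroidMatrices (h : X₀ ∈ centroidMatrices n d K) : K ≤ n := by
  have h' : (Set.range fun i => X₀ i).ncard = K := h
  rw [← h', ← Set.image_univ]
  refine (Set.ncard_image_le Set.finite_univ).trans ?_
  simp [Set.ncard_univ]

lemma pos_of_mem_centroidMatrices (hn : 0 < n) (h : X₀ ∈ centroidMatrices n d K) : 0 < K := by
  have h' : (Set.range fun i => X₀ i).ncard = K := h
  rw [← h', Set.ncard_pos (Set.finite_range _)]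
  exact ⟨_, ⟨0, hn⟩, rfl⟩

lemma sq_lt_of_row_ne (hξ : 0 < ξ) (hrange : (Set.range fun i => X₀ i) = Set.range xs)
    (hsep : ∀ k k', k ≠ k' → ξ < euclNorm (xs k - xs k')) {i j : Fin n} (hij : X₀ i ≠ X₀ j) :
    ξ ^ 2 < (X₀ i - X₀ j) ⬝ᵥ (X₀ i - X₀ j) := by
  obtain ⟨k, hk⟩ : X₀ i ∈ Set.range xs := hrange ▸ ⟨i, rfl⟩
  obtain ⟨k', hk'⟩ : X₀ j ∈ Set.range xs := hrange ▸ ⟨j, rfl⟩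
  rw [← hk, ← hk'] at hij ⊢
  exact (Real.lt_sqrt hξ.le).mp (hsep k k' fun h => hij (by rw [h]))

lemma lt_card_block (hrange : (Set.range fun i => X₀ i) = Set.range xs)
    (hblock : ∀ k, s < blockSize X₀ (xs k)) {τ₀ : Fin n → Fin K}
    (hτ₀ : ∀ i j, τ₀ i = τ₀ j ↔ X₀ i = X₀ j) (hsurj : Function.Surjective τ₀) (k : Fin K) :
    s < (Finset.univ.filter fun i => τ₀ i = k).card := by
  obtain ⟨i, rfl⟩ := hsurj k
  obtain ⟨k', hk'⟩ : X₀ i ∈ Set.range xs := hrange ▸ ⟨i, rfl⟩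
  refine (hblock k').trans_le (le_of_eq ?_)
  rw [blockSize, hk', ← Set.ncard_coe_finset]
  congr 2
  ext j
  simp [hτ₀]

/-- Clustering of the rows of a matrix that is close to a rotation of `X₀`. -/
lemma misclustered_lt_of_iInf_frobNorm_le {M : ℝ} (hM : 2 ≤ M) (hn : 0 < n) (hξ : 0 < ξ)
    (hrange : (Set.range fun i => X₀ i) = Set.range xs) (hinj : Function.Injective xs)
    (hsep : ∀ k k', k ≠ k' → ξ < euclNorm (xs k - xs k'))
    (hblock : ∀ k, 16 * (M + 1) / ξ ^ 2 < blockSize X₀ (xs k)) {X : Matrix (Fin n) (Fin d) ℝ}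
    (hX : ⨅ W : Matrix.orthogonalGroup (Fin d) ℝ,
      frobNorm (X - X₀ * (W : Matrix (Fin d) (Fin d) ℝ)) ^ 2 ≤ M)
    {τ₀ τ : Fin n → Fin K} (hτ₀ : IsKMeansAssignment K X₀ τ₀) (hτ : IsKMeansAssignment K X τ) :
    (misclustered τ₀ τ : ℝ) < 16 * M ^ 2 / ξ ^ 2 := by
  obtain ⟨W, hW⟩ := exists_lt_of_ciInf_lt (lt_of_le_of_lt hX (lt_add_one M))
  rw [frobNorm_sq] at hW
  have hWW : (W : Matrix (Fin d) (Fin d) ℝ) * (W : Matrix (Fin d) (Fin d) ℝ)ᵀ = 1 :=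
    (Matrix.mem_orthogonalGroup_iff _ _).mp W.2
  have hmem := mem_centroidMatrices_of_range_eq hrange hinj
  have hiff := hτ₀.eq_iff_of_mem hmem
  have hrow : ∀ i, (X₀ * (W : Matrix (Fin d) (Fin d) ℝ)) i
      = X₀ i ᵥ* (W : Matrix (Fin d) (Fin d) ℝ) := fun i => rfl
  have h := (kMeans_stability (A := X) (B := X₀ * (W : Matrix (Fin d) (Fin d) ℝ)) (τ₀ := τ₀)
    (s := 16 * (M + 1) / ξ ^ 2) (pos_of_mem_centroidMatrices hn hmem) hξ (by positivity)
    hτ₀.surjective (fun i j hij => by rw [hrow, hrow, (hiff i j).mp hij])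
    (fun i j hij => by
      rw [hrow, hrow, ← Matrix.sub_vecMul, ← Matrix.mulVec_transpose, dotProduct_mulVec_mulVec,
        Matrix.transpose_transpose, hWW, Matrix.one_mulVec]
      exact sq_lt_of_row_ne hξ hrange hsep fun h => hij ((hiff i j).mpr h))
    (lt_card_block hrange hblock hiff hτ₀.surjective)
    (by
      have : ξ ^ 2 * (16 * (M + 1) / ξ ^ 2) = 16 * (M + 1) := by field_simp
      rw [this]; linarith)).2 τ hτ
  refine h.1.trans_lt ?_
  gcongr
  nlinarith

/-- Clustering of the left singular vectors of the spectral embedding of a matrix close to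
`X₀ X₀ᵀ`. -/
lemma kMeans_leftSingular {κ m : ℝ} {P : Matrix (Fin n) (Fin n) ℝ}
    {Xhat Uhat U₀ : Matrix (Fin n) (Fin d) ℝ} (hn : 0 < n) (hξ : 0 < ξ) (hκ : 0 < κ) (hm : 0 < m)
    (hrange : (Set.range fun i => X₀ i) = Set.range xs) (hinj : Function.Injective xs)
    (hsep : ∀ k k', k ≠ k' → ξ < euclNorm (xs k - xs k')) (hs : 512 * m ^ 2 / (κ ^ 2 * ξ ^ 2) ≤ s)
    (hblock : ∀ k, s < blockSize X₀ (xs k))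
    (hgram : ∀ v, κ * n * (v ⬝ᵥ v) ≤ v ⬝ᵥ ((X₀ᵀ * X₀) *ᵥ v)) (hX₀n : frobSq X₀ ≤ n)
    (hclose : frobSq (P - X₀ * X₀ᵀ) ≤ 2 * m ^ 2 * n) (hlarge : 32 * m ^ 2 ≤ κ ^ 2 * n)
    (hXhat : IsSpectralEmbedding P Xhat) (hUhat : IsLeftSingularMatrix Xhat Uhat)
    (hU₀ : IsLeftSingularMatrix X₀ U₀) :
    (∃ τ₀ : Fin n → Fin K, IsKMeansAssignment K U₀ τ₀) ∧
    (∃ τ : Fin n → Fin K, IsKMeansAssignment K Uhat τ) ∧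
    ∀ τ₀ τ : Fin n → Fin K, IsKMeansAssignment K U₀ τ₀ → IsKMeansAssignment K Uhat τ →
      (misclustered τ τ₀ : ℝ) ≤ s := by
  have hn' : (0 : ℝ) < n := by exact_mod_cast hn
  have hs0 : 0 ≤ s := le_trans (by positivity) hs
  have hmem := mem_centroidMatrices_of_range_eq hrange hinj
  have hK := pos_of_mem_centroidMatrices hn hmem
  have hUrow := hU₀.row_eq_iff (κ := κ * n) (by positivity) hgram
  have hU₀mem : U₀ ∈ centroidMatrices n d K := by
    change (Set.range fun i => U₀ i).ncard = K
    rw [ncard_range_congr fun i j => (hUrow i j).symm]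
    exact hmem
  have hρ : (√(2 * m ^ 2)) ^ 2 = 2 * m ^ 2 := Real.sq_sqrt (by positivity)
  obtain ⟨H, hH, hHx⟩ := exists_leftSingular_near (ρ := √(2 * m ^ 2)) hn hκ (Real.sqrt_nonneg _)
    hgram hX₀n (by rw [hρ]; exact hclose) (by rw [hρ]; linarith) hXhat hUhat
  rw [hρ] at hH
  have hτ₀ex := exists_isKMeansAssignment hK U₀ hU₀mem.ge
  have hrow : ∀ i, (X₀ * H) i = X₀ i ᵥ* H := fun i => rfl
  have hζ : (ξ / (2 * √(n : ℝ))) ^ 2 = 1 / (4 * n) * ξ ^ 2 := by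
    rw [div_pow, mul_pow, Real.sq_sqrt hn'.le]; ring
  have key : ∀ τ₀ : Fin n → Fin K, IsKMeansAssignment K U₀ τ₀ →
      (∃ τ : Fin n → Fin K, IsKMeansAssignment K Uhat τ) ∧
      ∀ τ : Fin n → Fin K, IsKMeansAssignment K Uhat τ →
        (misclustered τ₀ τ : ℝ) ≤ s ∧ (misclustered τ τ₀ : ℝ) ≤ s := by
    intro τ₀ hτ₀
    have hiff : ∀ i j, τ₀ i = τ₀ j ↔ X₀ i = X₀ j := fun i j =>
      (hτ₀.eq_iff_of_mem hU₀mem i j).trans (hUrow i j)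
    refine kMeans_stability (B := X₀ * H) (ζ := ξ / (2 * √(n : ℝ))) hK (by positivity) hs0
      hτ₀.surjective (fun i j hij => by rw [hrow, hrow, (hiff i j).mp hij]) (fun i j hij => ?_)
      (lt_card_block hrange hblock hiff hτ₀.surjective) ?_
    · rw [hrow, hrow, ← Matrix.sub_vecMul, hζ]
      refine lt_of_lt_of_le ?_ (hHx _)
      have := sq_lt_of_row_ne hξ hrange hsep fun h => hij ((hiff i j).mpr h)
      gcongr
    · rw [hζ]
      rw [div_le_iff₀ (by positivity)] at hs
      calc 16 * frobSq (Uhat - X₀ * H) ≤ 16 * (4 * (2 * m ^ 2) / (κ ^ 2 * n)) := by gcongr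
        _ = 512 * m ^ 2 / (4 * (κ ^ 2 * n)) := by field_simp; ring
        _ ≤ s * (κ ^ 2 * ξ ^ 2) / (4 * (κ ^ 2 * n)) := by gcongr
        _ = _ := by field_simp
  obtain ⟨τ₁, hτ₁⟩ := hτ₀ex
  exact ⟨⟨τ₁, hτ₁⟩, (key τ₁ hτ₁).1, fun τ₀ τ h₀ h => ((key τ₀ h₀).2 τ h).2⟩

end

/-! ### Contraction and clustering -/

/-- By Procrustes alignment, a bound for the Gram matrices bounds the distance up to rotation. -/
lemma iInf_frobNorm_le_of_gram_le {n d : ℕ} {X X₀ : Matrix (Fin n) (Fin d) ℝ} {κ m : ℝ}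
    (hn : 0 < n) (hκ : 0 < κ)
    (hgram : ∀ v, κ * n * (v ⬝ᵥ v) ≤ v ⬝ᵥ ((X₀ᵀ * X₀) *ᵥ v))
    (h : frobSq (X * Xᵀ - X₀ * X₀ᵀ) ≤ m ^ 2 * n) :
    ⨅ W : Matrix.orthogonalGroup (Fin d) ℝ,
      frobNorm (X - X₀ * (W : Matrix (Fin d) (Fin d) ℝ)) ^ 2 ≤ 5 * m ^ 2 / (4 * κ) := by
  have hn' : (0 : ℝ) < n := by exact_mod_cast hn
  obtain ⟨W, hW, hle⟩ := exists_orthogonal_frobSq_sub_le X X₀ hgram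
  have hbdd : BddBelow (Set.range fun W : Matrix.orthogonalGroup (Fin d) ℝ =>
      frobNorm (X - X₀ * (W : Matrix (Fin d) (Fin d) ℝ)) ^ 2) :=
    ⟨0, by rintro _ ⟨W, rfl⟩; exact sq_nonneg _⟩
  refine (ciInf_le hbdd ⟨W, hW⟩).trans ?_
  rw [frobNorm_sq, le_div_iff₀ (by positivity)]
  have h1 := hle.trans h
  refine le_of_mul_le_mul_right (a := (n : ℝ)) ?_ hn'
  change frobSq (X - X₀ * W) * (4 * κ) * n ≤ 5 * m ^ 2 * n
  linarith

/-- The events that the noise is large occur only finitely often. -/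
lemma ae_eventually_scoreBound {Ω : Type*} [MeasurableSpace Ω] {μ : Measure Ω}
    [IsProbabilityMeasure μ] {d : ℕ} (hd : 0 < d) {δ : ℝ} (hδ : 0 < δ)
    {X₀ : ∀ n : ℕ, Matrix (Fin n) (Fin d) ℝ} {Y : ∀ n : ℕ, Ω → Matrix (Fin n) (Fin n) Bool}
    (hY : ∀ n, IsRDPG μ (X₀ n) (Y n))
    (hX₀ : ∀ n i j, δ ≤ X₀ n i ⬝ᵥ X₀ n j ∧ X₀ n i ⬝ᵥ X₀ n j ≤ 1 - δ) :
    ∀ᵐ ω ∂μ, ∀ᶠ n : ℕ in atTop, ScoreBound (√(32 * (4 + d)) / δ) (X₀ n) (Y n ω) := by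
  have hsum : ∑' n, μ {ω | ¬ ScoreBound (√(32 * (4 + d)) / δ) (X₀ n) (Y n ω)} ≠ ⊤ := by
    refine ne_top_of_le_ne_top Real.summable_exp_neg_nat.tsum_ofReal_ne_top
      (ENNReal.tsum_le_tsum fun n => ?_)
    rcases Nat.eq_zero_or_pos n with rfl | hn
    · simpa using prob_le_one
    · refine (measure_not_scoreBound_le hn hδ (hX₀ n) (hY n)).trans ?_
      refine ENNReal.ofReal_le_ofReal (Real.exp_le_exp.mpr (neg_le_neg ?_))
      have hd1 : (1 : ℝ) ≤ d := by exact_mod_cast hd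
      exact le_mul_of_one_le_right (Nat.cast_nonneg n) hd1
  filter_upwards [ae_eventually_notMem hsum] with ω hω
  filter_upwards [hω] with n hn
  exact not_not.mp hn

theorem mainTheorem4
    (d : ℕ) (δ : ℝ) (hδ : δ ∈ Set.Ioo (0 : ℝ) (1 / 2))
    (Δ : Matrix (Fin d) (Fin d) ℝ) (hΔ : Δ.PosDef)
    (π : (Fin d → ℝ) → ℝ) (hπ : IsPriorDensity π) :
    ∃ M₁ M₂ : ℝ, 0 < M₁ ∧ 0 < M₂ ∧
      ∀ (Ω : Type*) [MeasurableSpace Ω] (μ : Measure Ω) [IsProbabilityMeasure μ]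
        (X₀ : ∀ n : ℕ, Matrix (Fin n) (Fin d) ℝ)
        (Y : ∀ n : ℕ, Ω → Matrix (Fin n) (Fin n) Bool)
        (ξ : ℝ) (K : ℕ → ℕ) (xs : ∀ n : ℕ, Fin (K n) → Fin d → ℝ),
        (∀ n, IsRDPG μ (X₀ n) (Y n)) →
        Tendsto (fun n : ℕ => (n : ℝ)⁻¹ • ((X₀ n)ᵀ * X₀ n)) atTop (𝓝 Δ) →
        (∀ n i j, δ ≤ X₀ n i ⬝ᵥ X₀ n j ∧ X₀ n i ⬝ᵥ X₀ n j ≤ 1 - δ) →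
        0 < ξ →
        (∀ n, Set.range (fun i => X₀ n i) = Set.range (xs n)) →
        (∀ n, Function.Injective (xs n)) →
        (∀ n k k', k ≠ k' → ξ < euclNorm (xs n k - xs n k')) →
        (∀ m : ℕ, ∀ᶠ n in atTop, ∀ k, m ≤ blockSize (X₀ n) (xs n k)) →
        -- `M₁` and `M₂` are posterior contraction constants
        (∀ᶠ n : ℕ in atTop,
          ∫⁻ ω, rdpgPosterior π (Y n ω)
              {X | M₁ / √(n : ℝ) < (1 / (n : ℝ)) *
                frobNorm (Matrix.of X * (Matrix.of X)ᵀ - X₀ n * (X₀ n)ᵀ)} ∂μ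
            ≤ ENNReal.ofReal (8 * Real.exp (-(1 / 2) * (n : ℝ) * (d : ℝ)))) ∧
        (∀ᶠ n : ℕ in atTop,
          ∫⁻ ω, rdpgPosterior π (Y n ω)
              {X | M₂ / (n : ℝ) < (1 / (n : ℝ)) * ⨅ W : Matrix.orthogonalGroup (Fin d) ℝ,
                frobNorm (Matrix.of X - X₀ n * (W : Matrix (Fin d) (Fin d) ℝ)) ^ 2} ∂μ
            ≤ ENNReal.ofReal (8 * Real.exp (-(1 / 2) * (n : ℝ) * (d : ℝ)))) ∧
        -- clustering of posterior draws
        (∀ᶠ n : ℕ in atTop,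
          (∃ τ₀ : Fin n → Fin (K n), IsKMeansAssignment (K n) (X₀ n) τ₀) ∧
          (∀ ω, ∀ᵐ X ∂(rdpgPosterior π (Y n ω)),
            ∃ τ : Fin n → Fin (K n), IsKMeansAssignment (K n) (Matrix.of X) τ) ∧
          ∫⁻ ω, rdpgPosterior π (Y n ω)
              {X | ∃ τ₀ τ : Fin n → Fin (K n),
                IsKMeansAssignment (K n) (X₀ n) τ₀ ∧ IsKMeansAssignment (K n) (Matrix.of X) τ ∧
                16 * M₂ ^ 2 / ξ ^ 2 ≤ (misclustered τ₀ τ : ℝ)} ∂μ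
            ≤ ENNReal.ofReal (8 * Real.exp (-(1 / 2) * (n : ℝ) * (d : ℝ)))) ∧
        -- clustering of the unscaled eigenvectors of the point estimator
        (∀ᵐ ω ∂μ, ∀ᶠ n : ℕ in atTop,
          ∀ Xhat Uhat U₀ : Matrix (Fin n) (Fin d) ℝ,
            IsSpectralEmbedding (rdpgPosteriorMean π (Y n ω)) Xhat →
            IsLeftSingularMatrix Xhat Uhat →
            IsLeftSingularMatrix (X₀ n) U₀ →
            (∃ τ₀ : Fin n → Fin (K n), IsKMeansAssignment (K n) U₀ τ₀) ∧
            (∃ τ : Fin n → Fin (K n), IsKMeansAssignment (K n) Uhat τ) ∧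
            ∀ τ₀ τ : Fin n → Fin (K n),
              IsKMeansAssignment (K n) U₀ τ₀ → IsKMeansAssignment (K n) Uhat τ →
              (misclustered τ τ₀ : ℝ)
                ≤ 16 / ξ ^ 2 * (8 * M₁ * √(2 * (d : ℝ)) / leastEigenvalue hΔ.1) ^ 2) := by
  obtain ⟨hδ0, -⟩ := hδ
  rcases Nat.eq_zero_or_pos d with rfl | hd
  · -- in dimension `0` the lower bound on the inner products fails
    refine ⟨1, 1, one_pos, one_pos, ?_⟩
    intro Ω _ μ _ X₀ Y ξ K xs _ _ hX₀
    have h := (hX₀ 1 0 0).1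
    simp at h
    linarith
  obtain ⟨κ₀, hκ₀, hΔκ⟩ := hΔ.exists_pos_mul_dotProduct_le
  set κ := κ₀ / 2 with hκdef
  have hκ : 0 < κ := by positivity
  have hΔκ' : ∀ v, 2 * κ * (v ⬝ᵥ v) ≤ v ⬝ᵥ (Δ *ᵥ v) := fun v => by
    rw [hκdef, mul_div_cancel₀ _ two_ne_zero]; exact hΔκ v
  set S := √(32 * (4 + d)) / δ with hS
  have hS0 : 0 ≤ S := by positivity
  obtain ⟨m, hm, hcontr⟩ := exists_contraction_constant hd hπ hδ0 hκ hS0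
  set Λ := leastEigenvalue hΔ.1 with hΛdef
  have hΛ : 0 < Λ := leastEigenvalue_pos hd hΔ
  have hd1 : (1 : ℝ) ≤ d := by exact_mod_cast hd
  -- the contraction statement needs `m ≤ M₁`, the clustering of eigenvectors `m / κ ≤ M₁ / Λ`
  set M₁ := m * (1 + Λ / κ) with hM₁
  -- the summand `2` gives `M₂ + 1 < M₂ ^ 2`, as clustering of posterior draws yields the bound
  -- `16 (M₂ + 1) / ξ ^ 2`
  set M₂ := 5 * m ^ 2 / (4 * κ) + 2 with hM₂
  have hM₁m : m ≤ M₁ := by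
    rw [hM₁]; exact le_mul_of_one_le_right hm.le (by linarith [div_pos hΛ hκ])
  have hM₁Λ : m / κ ≤ M₁ / Λ := by
    rw [hM₁, div_le_div_iff₀ hκ hΛ]
    have : m * (1 + Λ / κ) * κ = m * κ + m * Λ := by field_simp
    rw [this]; nlinarith [mul_pos hm hκ]
  have hM₂2 : 2 ≤ M₂ := by
    have : 0 < 5 * m ^ 2 / (4 * κ) := by positivity
    linarith
  refine ⟨M₁, M₂, by positivity, by positivity, ?_⟩
  intro Ω _ μ _ X₀ Y ξ K xs hY hlim hX₀ hξ hrange hinj hsep hblock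
  have hgram := eventually_gram_ge hκ hΔκ' hlim
  have hlat : ∀ n i, X₀ n i ∈ latentSpace d := fun n => (hY n).mem_latentSpace
  have hbound : ∀ n : ℕ, 2 * Real.exp (-(n * d : ℝ))
      ≤ 8 * Real.exp (-(1 / 2) * (n : ℝ) * (d : ℝ)) := fun n => by
    have hnd : (0 : ℝ) ≤ n * d := by positivity
    have : Real.exp (-(n * d : ℝ)) ≤ Real.exp (-(1 / 2) * (n : ℝ) * (d : ℝ)) :=
      Real.exp_le_exp.mpr (by linarith)
    linarith [Real.exp_pos (-(1 / 2) * (n : ℝ) * (d : ℝ))]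
  have hpost : ∀ᶠ n : ℕ in atTop, ∫⁻ ω, rdpgPosterior π (Y n ω)
      {X | m ^ 2 * n < frobSq (Matrix.of X * (Matrix.of X)ᵀ - X₀ n * (X₀ n)ᵀ)} ∂μ
        ≤ ENNReal.ofReal (8 * Real.exp (-(1 / 2) * (n : ℝ) * (d : ℝ))) := by
    filter_upwards [hcontr, hgram, eventually_gt_atTop 0] with n hn hg hn0
    refine (lintegral_rdpgPosterior_le (Y n) _ {ω | ScoreBound S (X₀ n) (Y n ω)}
      (Real.exp_nonneg (-(n * d : ℝ))) (measure_not_scoreBound_le hn0 hδ0 (hX₀ n) (hY n))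
      fun ω hω => (hn (X₀ n) (Y n ω) (hlat n) (hX₀ n) hg hω).2).trans ?_
    exact ENNReal.ofReal_le_ofReal (hbound n)
  have hblock' : ∀ s : ℝ, ∀ᶠ n in atTop, ∀ k, s < blockSize (X₀ n) (xs n k) := fun s => by
    obtain ⟨N, hN⟩ := exists_nat_gt s
    filter_upwards [hblock N] with n hn k
    exact hN.trans_le (by exact_mod_cast hn k)
  -- outside the exceptional event of the contraction statement `X` is close to a rotation of `X₀`
  have hnear : ∀ᶠ n : ℕ in atTop, ∀ X : Fin n → Fin d → ℝ,
      frobSq (Matrix.of X * (Matrix.of X)ᵀ - X₀ n * (X₀ n)ᵀ) ≤ m ^ 2 * n →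
      ⨅ W : Matrix.orthogonalGroup (Fin d) ℝ,
        frobNorm (Matrix.of X - X₀ n * (W : Matrix (Fin d) (Fin d) ℝ)) ^ 2 ≤ M₂ := by
    filter_upwards [hgram, eventually_gt_atTop 0] with n hg hn0 X hX
    have := iInf_frobNorm_le_of_gram_le hn0 hκ hg hX
    linarith
  refine ⟨?_, ?_, ?_, ?_⟩
  · filter_upwards [hpost, eventually_gt_atTop 0] with n hn hn0
    refine (lintegral_mono fun ω => measure_mono fun X hX => ?_).trans hn
    have hn' : (0 : ℝ) < n := by exact_mod_cast hn0
    have hX' : M₁ / √(n : ℝ) < (1 / (n : ℝ)) *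
      frobNorm (Matrix.of X * (Matrix.of X)ᵀ - X₀ n * (X₀ n)ᵀ) := hX
    have h1 : m * √(n : ℝ) < frobNorm (Matrix.of X * (Matrix.of X)ᵀ - X₀ n * (X₀ n)ᵀ) := by
      rw [one_div, ← div_eq_inv_mul, lt_div_iff₀ hn'] at hX'
      refine lt_of_le_of_lt ?_ hX'
      rw [div_mul_eq_mul_div, mul_div_assoc, Real.div_sqrt]
      gcongr
    have h2 := pow_lt_pow_left₀ h1 (by positivity) two_ne_zero
    rwa [frobNorm_sq, mul_pow, Real.sq_sqrt hn'.le] at h2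
  · filter_upwards [hpost, hnear, eventually_gt_atTop 0] with n hn hnr hn0
    refine (lintegral_mono fun ω => measure_mono fun X hX => ?_).trans hn
    have hn' : (0 : ℝ) < n := by exact_mod_cast hn0
    by_contra hle
    have h1 := hnr X (not_lt.mp hle)
    have hX' : M₂ / (n : ℝ) < (1 / (n : ℝ)) * ⨅ W : Matrix.orthogonalGroup (Fin d) ℝ,
      frobNorm (Matrix.of X - X₀ n * (W : Matrix (Fin d) (Fin d) ℝ)) ^ 2 := hX
    refine absurd hX' (not_lt.mpr ?_)
    rw [one_div, ← div_eq_inv_mul]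
    gcongr
  · filter_upwards [hpost, hnear, hblock' (16 * (M₂ + 1) / ξ ^ 2), eventually_gt_atTop 0]
      with n hn hnr hbl hn0
    have hmem := mem_centroidMatrices_of_range_eq (hrange n) (hinj n)
    have hK := pos_of_mem_centroidMatrices hn0 hmem
    refine ⟨exists_isKMeansAssignment hK (X₀ n) hmem.ge, fun ω => ?_, ?_⟩
    · filter_upwards [(rdpgPosterior_absolutelyContinuous (Y n ω)).ae_le
        (ae_rdpgPrior_injective hd hπ n)] with X hX
      refine exists_isKMeansAssignment hK (Matrix.of X) ?_
      calc K n ≤ n := le_of_mem_centroidMatrices hmem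
        _ = (Set.range X).ncard := by
          rw [← Set.image_univ, Set.ncard_image_of_injective _ hX]; simp [Set.ncard_univ]
    · refine (lintegral_mono fun ω => measure_mono fun X hX => ?_).trans hn
      obtain ⟨τ₀, τ, hτ₀, hτ, hle⟩ := hX
      by_contra hnot
      exact absurd (misclustered_lt_of_iInf_frobNorm_le hM₂2 hn0 hξ (hrange n) (hinj n) (hsep n)
        hbl (hnr X (not_lt.mp hnot)) hτ₀ hτ) (not_lt.mpr hle)
  · set s := 16 / ξ ^ 2 * (8 * M₁ * √(2 * (d : ℝ)) / Λ) ^ 2 with hs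
    have hs' : 512 * m ^ 2 / (κ ^ 2 * ξ ^ 2) ≤ s := by
      have h1 : s = 2048 * d * (M₁ / Λ) ^ 2 / ξ ^ 2 := by
        rw [hs, div_pow, mul_pow, Real.sq_sqrt (by positivity)]; field_simp; ring
      have h2 : 512 * m ^ 2 / (κ ^ 2 * ξ ^ 2) = 512 * 1 * (m / κ) ^ 2 / ξ ^ 2 := by
        field_simp
      rw [h1, h2]
      gcongr
      norm_num
    have hexp : ∀ᶠ n : ℕ in atTop, (n : ℝ) ^ 2 * Real.exp (-(n * d : ℝ)) ≤ m ^ 2 * n := by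
      have h := ((Real.tendsto_pow_mul_exp_neg_atTop_nhds_zero 1).comp
        tendsto_natCast_atTop_atTop).eventually_le_const (show (0 : ℝ) < m ^ 2 by positivity)
      filter_upwards [h] with n hn
      simp only [Function.comp_apply, pow_one] at hn
      have hle : Real.exp (-(n * d : ℝ)) ≤ Real.exp (-(n : ℝ)) :=
        Real.exp_le_exp.mpr (neg_le_neg (le_mul_of_one_le_right (Nat.cast_nonneg n) hd1))
      calc (n : ℝ) ^ 2 * Real.exp (-(n * d : ℝ)) ≤ (n : ℝ) ^ 2 * Real.exp (-(n : ℝ)) := by gcongr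
        _ = n * Real.exp (-(n : ℝ)) * n := by ring
        _ ≤ m ^ 2 * n := by gcongr
    have hlarge : ∀ᶠ n : ℕ in atTop, 32 * m ^ 2 ≤ κ ^ 2 * n := by
      filter_upwards [tendsto_natCast_atTop_atTop.eventually_ge_atTop (32 * m ^ 2 / κ ^ 2)]
        with n hn
      rw [div_le_iff₀ (by positivity)] at hn
      linarith
    filter_upwards [ae_eventually_scoreBound hd hδ0 hY hX₀] with ω hω
    filter_upwards [hω, hcontr, hgram, hblock' s, hexp, hlarge, eventually_gt_atTop 0]
      with n hgood hn hg hbl hex hla hn0 Xhat Uhat U₀ hXhat hUhat hU₀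
    obtain ⟨hden, hpost⟩ := hn (X₀ n) (Y n ω) (hlat n) (hX₀ n) hg hgood
    have hmean := frobSq_rdpgPosteriorMean_sub_le hπ hden (hlat n) (by positivity)
      (Real.exp_nonneg _) hpost
    exact kMeans_leftSingular hn0 hξ hκ hm (hrange n) (hinj n) (hsep n) hs' hbl hg
      (frobSq_le_of_mem_latentSpace (hlat n)) (by linarith) hla hXhat hUhat hU₀
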